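/- Let $\kappa$ be a weakly compact cardinal, where $\aleph_0$ is allowed: $\kappa$ is infinite and regular, $\alpha^{\gamma}<\kappa$ for all $\alpha,\gamma<\kappa$, and $\kappa$ has the tree property. All categories denoted $\mathcal C$, $\mathcal C_F$ below are small. Definitions. A category is $\kappa$-lex if it has $\kappa$-small limits; a functor is $\kappa$-lex if it preserves them, and $\kappa$-regular if moreover it preserves effective epimorphisms. A category is $(\kappa,\kappa)$-coherent if it is $\kappa$-lex, has pullback-stable (effective epi, mono) factorizations, has pullback-stable $\kappa$-small unions of subobjects, and, for every rooted cotree (opposite of a rooted tree) which is continuous (at limit nodes it is given by limits), has all branches of length $<\kappa$, and in which the predecessors of each vertex that is not the last one of a branch form an extremal epimorphic family of size $<\kappa$, the transfinite cocompositions of the branches form an extremal epimorphic family on the root. (Nodes at a limit level of the tree are determined by the branch below them.) A functor is $(\kappa,\kappa)$-coherent if it preserves $\kappa$-small limits, effective epimorphisms and $\kappa$-small unions. A $\kappa$-topology is a Grothendieck topology closed under forming such cotrees out of covers (with no bound on the size of the covers), and $\langle E\rangle_\kappa$ is the smallest $\kappa$-topology in which the families in $E$ are covers. For a $\kappa$-lex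 category $\mathcal C$ and a $\kappa$-lex functor $F:\mathcal C\to\mathbf{Set}$, let $\mathcal C_F=\operatorname{colim}_{(x,a)\in(\int F)^{op}}\mathcal C/x$ be the 2-colimit in $\mathbf{Cat}$ of the slices of $\mathcal C$, with pullback functors as transition maps, indexed by the opposite of the category of elements of $F$; let $\varphi_F:\mathcal C\simeq\mathcal C/1\to\mathcal C_F$ be the cocone map at $(1,*)$, where $*$ is the element of $F(1)$. Let $Sub^{\neg}_{\mathcal C_F}(1)$ be the poset of complemented subobjects of the terminal object of $\mathcal C_F$, and $i:Sub^{\neg}_{\mathcal C_F}(1)\to\mathcal C_F$ the inclusion. Theorem. Let $\mathcal C$ be a small $(\kappa,\kappa)$-coherent category with $\kappa$-small disjoint coproducts, and let $F:\mathcal C\to\mathbf{Set}$ be $\kappa$-lex. (i) The category $\mathcal C_F$ and the functor $\varphi_F:\mathcal C\to\mathcal C_F$ are $(\kappa,\kappa)$-coherent, and $\mathcal C_F$ has $\kappa$-small disjoint coproducts. If $E$ is the collection of $\kappa$-small effective epimorphic families of $\mathcal C$, then the topology $\langle\varphi_F[E]\rangle_\kappa$ on $\mathcal C_F$ coincides with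 the $\kappa$-small effective epimorphic families: a sieve is covering if and only if it contains a $\kappa$-small effective epimorphic family, and a $\kappa$-small family generates a covering sieve if and only if it is effective epimorphic. The poset $Sub^{\neg}_{\mathcal C_F}(1)$ is a Boolean algebra and is $(\kappa,\kappa)$-coherent as a category, and the inclusion $i$ is a $(\kappa,\kappa)$-coherent functor. (ii) If $F$ is $\kappa$-regular, then the representable functors on $\mathcal C_F$ are sheaves for $\langle\varphi_F[E]\rangle_\kappa$, precomposition with $i$ defines a functor $i_*:Sh(\mathcal C_F,\langle\varphi_F[E]\rangle_\kappa)\to Sh(Sub^{\neg}_{\mathcal C_F}(1))$, where $Sub^{\neg}_{\mathcal C_F}(1)$ carries the topology of $\kappa$-small unions, and the composite $$\mathcal C_F\xrightarrow{\;Y\;}Sh(\mathcal C_F,\langle\varphi_F[E]\rangle_\kappa)\xrightarrow{\;i_*\;}Sh(Sub^{\neg}_{\mathcal C_F}(1)),\qquad x\mapsto\mathcal C_F(i(-),x),$$ is $(\kappa,\kappa)$-coherent. -/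

import Mathlib

open CategoryTheory CategoryTheory.Limits Opposite

universe w v u v' u'

namespace KappaCoh

/-! ### Weakly compact cardinals -/

/-- A partial order is a tree if the predecessors of every node are well-ordered. -/
def IsTreeOrder (T : Type w) [PartialOrder T] : Prop :=
  ∀ t : T, IsWellOrder (Set.Iio t) (· < ·)

/-- The height of a node of a tree: the order type of the set of its predecessors. -/
noncomputable def nodeHeight {T : Type w} [PartialOrder T] (hT : IsTreeOrder T) (t : T) :
    Ordinal.{w} :=
  haveI := hT t
  Ordinal.type (α := Set.Iio t) (· < ·)

/-- The tree property: every tree of height `κ` all of whose levels have size `< κ` has a branch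
(a maximal chain) of size `κ`. -/
def HasTreeProperty (κ : Cardinal.{w}) : Prop :=
  ∀ (T : Type w) [PartialOrder T] (hT : IsTreeOrder T),
    (∀ t : T, nodeHeight hT t < κ.ord) →
    (∀ α < κ.ord, ∃ t : T, nodeHeight hT t = α) →
    (∀ α < κ.ord, HasCardinalLT {t : T // nodeHeight hT t = α} κ) →
    ∃ b : Flag T, Cardinal.mk b = κ

/-- Weakly compact cardinals, with `ℵ₀` allowed: infinite regular cardinals `κ` with
`(<κ)^{<κ} = (<κ)` and with the tree property. -/
structure IsWeaklyCompact (κ : Cardinal.{w}) : Prop where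
  regular : κ.IsRegular
  pow_lt : ∀ α < κ, ∀ γ < κ, α ^ γ < κ
  treeProperty : HasTreeProperty κ

/-! ### Infinitary exactness properties -/

section Exactness

variable (lam κ : Cardinal.{w})
variable (C : Type u) [Category.{v} C] {D : Type u'} [Category.{v'} D]

/-- `C` is `κ`-lex: it has `κ`-small limits. -/
def IsLexCategory : Prop :=
  ∀ (J : Type w) [SmallCategory J], HasCardinalLT (Arrow J) κ → HasLimitsOfShape J C

variable {C}

/-- `G` is `κ`-lex: it preserves `κ`-small limits. -/
def IsLexFunctor (G : C ⥤ D) : Prop :=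
  ∀ (J : Type w) [SmallCategory J], HasCardinalLT (Arrow J) κ → PreservesLimitsOfShape J G

/-- `G` is `κ`-regular: it preserves `κ`-small limits and effective epimorphisms. -/
structure IsRegularFunctor (G : C ⥤ D) : Prop where
  lex : IsLexFunctor κ G
  effectiveEpi : ∀ ⦃X Y : C⦄ (f : X ⟶ Y), EffectiveEpi f → EffectiveEpi (G.map f)

/-- A family of maps with common codomain is extremal epimorphic if every monomorphism through
which all its members factor is invertible. -/
def ExtremalEpiFamily {X : C} {ι : Type*} (Y : ι → C) (f : ∀ i, Y i ⟶ X) : Prop :=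
  ∀ ⦃Z : C⦄ (m : Z ⟶ X), Mono m → (∀ i, ∃ g : Y i ⟶ Z, g ≫ m = f i) → IsIso m

/-- The monomorphism `m` represents the union (the supremum in the poset of subobjects of `X`)
of the subobjects represented by the monomorphisms `u i`. -/
structure IsUnion {X : C} {ι : Type w} {Y : ι → C} (u : ∀ i, Y i ⟶ X) {U : C} (m : U ⟶ X) :
    Prop where
  mono : Mono m
  factors : ∀ i, ∃ g : Y i ⟶ U, g ≫ m = u i
  least : ∀ ⦃Z : C⦄ (n : Z ⟶ X), Mono n → (∀ i, ∃ g : Y i ⟶ Z, g ≫ n = u i) →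
    ∃ k : U ⟶ Z, k ≫ n = m

variable (C) in
/-- A rooted cotree in `C` (a diagram on the opposite of a rooted tree) which is continuous and
all of whose branches have length `< κ`. -/
structure Cotree where
  /-- the nodes -/
  T : Type w
  [po : PartialOrder T]
  [bot : OrderBot T]
  isTree : IsTreeOrder T
  /-- A node at a limit level is determined by the branch below it. -/
  limit_unique : ∀ s t : T, Order.IsSuccLimit s → Set.Iio s = Set.Iio t → s = t
  /-- Every branch is shorter than `κ`. -/
  branch_lt : ∀ b : Flag T, HasCardinalLT b κ
  /-- the diagram -/
  obj : Tᵒᵖ ⥤ C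
  /-- Continuity: at a limit node, the diagram has the limit of the chain below the node. -/
  continuous : ∀ t : T, Order.IsSuccLimit t →
    Nonempty (IsLimit
      ({ pt := obj.obj (op t)
         π := { app := fun s => obj.map (homOfLE (le_of_lt s.unop.2)).op
                naturality := fun _ _ _ => by
                  dsimp
                  rw [Category.id_comp, ← obj.map_comp]
                  rfl } } :
        Cone ((Subtype.mono_coe (· ∈ Set.Iio t)).functor.op ⋙ obj)))

attribute [instance] Cotree.po Cotree.bot

namespace Cotree

variable {κ} (K : Cotree κ C)

/-- The root object. -/
def root : C := K.obj.obj (op ⊥)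

/-- The object at the node `t`. -/
def at' (t : K.T) : C := K.obj.obj (op t)

/-- The nodes directly above `t` in the tree, i.e. the predecessors of `t` in the cotree. -/
def Next (t : K.T) : Type w := {s : K.T // t ⋖ s}

/-- The map from the object at a predecessor of `t` in the cotree to the object at `t`. -/
def step (t : K.T) (s : K.Next t) : K.at' s.1 ⟶ K.at' t :=
  K.obj.map (homOfLE s.2.le).op

/-- The restriction of the diagram to a branch. -/
def branchDiagram (b : Flag K.T) : (b : Set K.T)ᵒᵖ ⥤ C :=
  (Subtype.mono_coe (· ∈ (b : Set K.T))).functor.op ⋙ K.obj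

/-- The transfinite cocomposition of a branch `b`: the projection to the root of a limit cone
on the branch. -/
def cocomposition (b : Flag K.T) (c : Cone (K.branchDiagram b)) : c.pt ⟶ K.root :=
  c.π.app (op ⟨⊥, b.bot_mem⟩)

end Cotree

variable (C) in
/-- `(λ, κ)`-coherent categories. Vertices of a cotree which are not the last member of a branch
are those which are not maximal in the tree. -/
structure IsCoherentCategory : Prop where
  lex : IsLexCategory κ C
  factorization : ∀ ⦃X Y : C⦄ (f : X ⟶ Y), ∃ (I : C) (e : X ⟶ I) (m : I ⟶ Y),
    EffectiveEpi e ∧ Mono m ∧ e ≫ m = f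
  effectiveEpi_stable : ∀ ⦃P X Y Z : C⦄ (fst : P ⟶ X) (snd : P ⟶ Y) (f : X ⟶ Z) (g : Y ⟶ Z),
    IsPullback fst snd f g → EffectiveEpi f → EffectiveEpi snd
  union : ∀ (X : C) (ι : Type w), HasCardinalLT ι lam → ∀ (Y : ι → C) (u : ∀ i, Y i ⟶ X),
    (∀ i, Mono (u i)) → ∃ (U : C) (m : U ⟶ X), IsUnion u m
  union_stable : ∀ (X : C) (ι : Type w), HasCardinalLT ι lam →
    ∀ (Y : ι → C) (u : ∀ i, Y i ⟶ X), (∀ i, Mono (u i)) →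
    ∀ (U : C) (m : U ⟶ X), IsUnion u m →
    ∀ (X' : C) (g : X' ⟶ X) (Y' : ι → C) (u' : ∀ i, Y' i ⟶ X') (p : ∀ i, Y' i ⟶ Y i)
      (U' : C) (m' : U' ⟶ X') (q : U' ⟶ U),
    (∀ i, IsPullback (p i) (u' i) (u i) g) → IsPullback q m' m g → IsUnion u' m'
  cotree : ∀ K : Cotree κ C,
    (∀ t : K.T, ¬ IsMax t → HasCardinalLT (K.Next t) lam ∧
      ExtremalEpiFamily (fun s : K.Next t => K.at' s.1) (K.step t)) →
    ∀ (c : ∀ b : Flag K.T, Cone (K.branchDiagram b)), (∀ b, Nonempty (IsLimit (c b))) →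
      ExtremalEpiFamily (fun b : Flag K.T => (c b).pt) (fun b => K.cocomposition b (c b))

/-- `(λ, κ)`-coherent functors: they preserve `κ`-small limits, effective epimorphisms and
`λ`-small unions. -/
structure IsCoherentFunctor (G : C ⥤ D) : Prop where
  lex : IsLexFunctor κ G
  effectiveEpi : ∀ ⦃X Y : C⦄ (f : X ⟶ Y), EffectiveEpi f → EffectiveEpi (G.map f)
  union : ∀ (X : C) (ι : Type w), HasCardinalLT ι lam → ∀ (Y : ι → C) (u : ∀ i, Y i ⟶ X),
    (∀ i, Mono (u i)) → ∀ (U : C) (m : U ⟶ X), IsUnion u m →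
      IsUnion (fun i => G.map (u i)) (G.map m)

variable (C) in
/-- `C` has `κ`-small disjoint coproducts. -/
def HasDisjointCoproducts : Prop :=
  ∀ (ι : Type w), HasCardinalLT ι κ → ∀ X : ι → C, HasCoproduct X ∧ CoproductDisjoint X

/-! ### `κ`-topologies -/

/-- A Grothendieck topology is a `κ`-topology if it is closed under building cotrees: if on each
vertex the predecessors form a cover, then so do the cocompositions of the branches. -/
def IsKappaTopology (J : GrothendieckTopology C) : Prop :=
  ∀ K : Cotree κ C,
    (∀ t : K.T, ¬ IsMax t →
      Sieve.ofArrows (fun s : K.Next t => K.at' s.1) (K.step t) ∈ J (K.at' t)) →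
    ∀ (c : ∀ b : Flag K.T, Cone (K.branchDiagram b)), (∀ b, Nonempty (IsLimit (c b))) →
      Sieve.ofArrows (fun b : Flag K.T => (c b).pt) (fun b => K.cocomposition b (c b)) ∈ J K.root

/-- The `κ`-topology `⟨E⟩_κ` generated by a collection `E` of families: the smallest
`κ`-topology in which the members of `E` are covers. -/
def generatedTopology (E : Precoverage C) : GrothendieckTopology C :=
  sInf {J | IsKappaTopology κ J ∧ ∀ (X : C), ∀ R ∈ E X, Sieve.generate R ∈ J X}

variable (C) in
/-- The collection of `κ`-small effective epimorphic families. -/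
def effectiveEpiFamilies : Precoverage C where
  coverings X := {R | ∃ (ι : Type w) (Y : ι → C) (f : ∀ i, Y i ⟶ X),
    HasCardinalLT ι κ ∧ EffectiveEpiFamily Y f ∧ R = Presieve.ofArrows Y f}

/-- The image of a family in `E` under a functor. -/
inductive ImageCovering (G : C ⥤ D) (E : Precoverage C) : ∀ X' : D, Presieve X' → Prop
  | mk {X : C} {R : Presieve X} (hR : R ∈ E X) : ImageCovering G E (G.obj X) (R.map G)

/-- The collection `G[E]` of the images of the families in `E`. -/
def imageFamilies (G : C ⥤ D) (E : Precoverage C) : Precoverage D where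
  coverings X' := {R | ImageCovering G E X' R}

end Exactness

/-! ### The category `C_F` -/

section Diagram

variable {C : Type u} [Category.{v} C] (F : C ⥤ Type w)

/-- Pairs `(u ⟶ x, a)` where `u ⟶ x` is a map of `C` and `a ∈ F x`. -/
structure Elt where
  /-- the object `x` -/
  base : C
  /-- the element `a` of `F x` -/
  pt : F.obj base
  /-- the object `u ⟶ x` of the slice over `x` -/
  arr : Over base

namespace Elt

variable {F}

/-- A map `(u ⟶ x, a) ⟶ (v ⟶ y, b)`: a map `x ⟶ y` taking `a` to `b`, with a map `u ⟶ v`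
over it. -/
@[ext]
structure Hom (X Y : Elt F) where
  /-- the map `x ⟶ y` -/
  base : X.base ⟶ Y.base
  /-- the map `u ⟶ v` -/
  top : X.arr.left ⟶ Y.arr.left
  map_pt : F.map base X.pt = Y.pt
  comm : top ≫ Y.arr.hom = X.arr.hom ≫ base

/-- The total category of the slices `C/x` indexed by the `(x, a)` in the category of elements
of `F`. -/
instance : Category (Elt F) where
  Hom := Hom
  id X := { base := 𝟙 _, top := 𝟙 _, map_pt := by simp, comm := by simp }
  comp f g :=
    { base := f.base ≫ g.base
      top := f.top ≫ g.top
      map_pt := by simp [f.map_pt, g.map_pt]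
      comm := by rw [Category.assoc, g.comm, ← Category.assoc, f.comm, Category.assoc] }
  id_comp f := by ext <;> exact Category.id_comp _
  comp_id f := by ext <;> exact Category.comp_id _
  assoc f g h := by ext <;> exact Category.assoc _ _ _

variable (F) in
/-- The maps `(u ⟶ x, a) ⟶ (v ⟶ y, b)` which identify `u ⟶ x` with the pullback of `v ⟶ y`
along `x ⟶ y`. -/
def cartesian : MorphismProperty (Elt F) :=
  fun X Y f => IsPullback (Hom.top f) X.arr.hom Y.arr.hom (Hom.base f)

end Elt

/-- The category `C_F`, the 2-colimit of the slices `C/x` (with the pullback functors between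
them) over the `(x, a)` in the opposite of the category of elements of `F`. As for the 2-colimit
of any pseudofunctor, it is the total category of the slices with the cartesian maps inverted. -/
def CF : Type _ := (Elt.cartesian F).Localization

instance : Category (CF F) := inferInstanceAs (Category (Elt.cartesian F).Localization)

/-- The localization functor. -/
def toCF : Elt F ⥤ CF F := (Elt.cartesian F).Q

instance : (toCF F).IsLocalization (Elt.cartesian F) :=
  inferInstanceAs ((Elt.cartesian F).Q.IsLocalization (Elt.cartesian F))

namespace Elt

variable {F}

/-- If `C` has pullbacks and equalizers and `F` preserves them, then the maps of `C_F` are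
fractions of maps of the total category. -/
theorem hasRightCalculusOfFractions [HasPullbacks C] [HasEqualizers C]
    [PreservesLimitsOfShape WalkingCospan F] [PreservesLimitsOfShape WalkingParallelPair F] :
    (cartesian F).HasRightCalculusOfFractions where
  id_mem X := IsPullback.id_horiz X.arr.hom
  comp_mem f g hf hg := IsPullback.paste_horiz hf hg
  exists_rightFraction X Y φ := by
    obtain ⟨f, s, hs⟩ := φ
    obtain ⟨c, hc₁, hc₂⟩ := Types.exists_of_isPullback
      ((IsPullback.of_hasPullback (Hom.base f) (Hom.base s)).map F) X.pt Y.pt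
      (by rw [Hom.map_pt f, Hom.map_pt s])
    let r := pullback (Hom.base f) (Hom.base s)
    let q : pullback X.arr.hom (pullback.fst (Hom.base f) (Hom.base s)) ⟶ Y.arr.left :=
      IsPullback.lift hs (pullback.fst _ _ ≫ Hom.top f) (pullback.snd _ _ ≫ pullback.snd _ _) (by
        rw [Category.assoc, Hom.comm f, ← Category.assoc, pullback.condition, Category.assoc,
          pullback.condition, Category.assoc])
    let Z : Elt F := ⟨r, c, Over.mk (pullback.snd X.arr.hom (pullback.fst _ _))⟩
    let s' : Z ⟶ X := { base := pullback.fst _ _, top := pullback.fst _ _, map_pt := hc₁,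
                        comm := pullback.condition }
    let f' : Z ⟶ Y := { base := pullback.snd _ _, top := q, map_pt := hc₂,
                        comm := IsPullback.lift_snd _ _ _ _ }
    refine ⟨MorphismProperty.RightFraction.mk s' (IsPullback.of_hasPullback _ _) f', ?_⟩
    apply Hom.ext
    · exact pullback.condition
    · exact (IsPullback.lift_fst hs _ _ _).symm
  ext X Y Y' f₁ f₂ s hs h := by
    have hb : Hom.base f₁ ≫ Hom.base s = Hom.base f₂ ≫ Hom.base s := congrArg Hom.base h
    have ht : Hom.top f₁ ≫ Hom.top s = Hom.top f₂ ≫ Hom.top s := congrArg Hom.top h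
    obtain ⟨c, hc, -⟩ := Types.unique_of_type_equalizer _ _
      (isLimitForkMapOfIsLimit F (equalizer.condition (Hom.base f₁) (Hom.base f₂))
        (equalizerIsEqualizer _ _)) X.pt (by rw [Hom.map_pt f₁, Hom.map_pt f₂])
    refine ⟨⟨_, c, Over.mk (pullback.snd X.arr.hom
        (equalizer.ι (Hom.base f₁) (Hom.base f₂)))⟩,
      { base := equalizer.ι _ _, top := pullback.fst _ _, map_pt := hc,
        comm := pullback.condition }, IsPullback.of_hasPullback _ _, ?_⟩
    have hb' := equalizer.condition (Hom.base f₁) (Hom.base f₂)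
    apply Hom.ext
    · exact hb'
    · apply IsPullback.hom_ext hs
      · change (pullback.fst _ _ ≫ Hom.top f₁) ≫ _ = (pullback.fst _ _ ≫ Hom.top f₂) ≫ _
        rw [Category.assoc, ht, Category.assoc]
      · change (pullback.fst _ _ ≫ Hom.top f₁) ≫ _ = (pullback.fst _ _ ≫ Hom.top f₂) ≫ _
        rw [Category.assoc, Hom.comm, Category.assoc, Hom.comm, pullback.condition_assoc,
          pullback.condition_assoc, hb']

end Elt

/-- The maps `(u ⟶ x, a) ⟶ (v ⟶ y, b)` of `C_F` are represented by a map to `v ⟶ y` from the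
pullback of `u ⟶ x` along some `h : r ⟶ x` marked with `c ∈ F r` which `F h` takes to `a`. -/
theorem CF.exists_representative [HasPullbacks C] [HasEqualizers C]
    [PreservesLimitsOfShape WalkingCospan F] [PreservesLimitsOfShape WalkingParallelPair F]
    {X Y : Elt F} (φ : (toCF F).obj X ⟶ (toCF F).obj Y) :
    ∃ (Z : Elt F) (s : Z ⟶ X) (f : Z ⟶ Y), Elt.cartesian F s ∧
      (toCF F).map s ≫ φ = (toCF F).map f := by
  have := Elt.hasRightCalculusOfFractions (F := F)
  obtain ⟨ψ, rfl⟩ := Localization.exists_rightFraction (toCF F) (Elt.cartesian F) φ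
  exact ⟨ψ.X', ψ.s, ψ.f, ψ.hs, by simp⟩

/-- Two maps become equal in `C_F` when they are identified by pulling back along some
`h : r ⟶ x` marked with `c ∈ F r`. -/
theorem CF.map_eq_iff [HasPullbacks C] [HasEqualizers C]
    [PreservesLimitsOfShape WalkingCospan F] [PreservesLimitsOfShape WalkingParallelPair F]
    {X Y : Elt F} (f g : X ⟶ Y) :
    (toCF F).map f = (toCF F).map g ↔
      ∃ (Z : Elt F) (s : Z ⟶ X), Elt.cartesian F s ∧ s ≫ f = s ≫ g := by
  have := Elt.hasRightCalculusOfFractions (F := F)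
  rw [MorphismProperty.map_eq_iff_precomp (toCF F) (Elt.cartesian F)]
  simp only [exists_prop]

/-- The cocone map `C/x ⥤ C_F` at the element `(x, a)`. -/
def sliceFunctor (x : C) (a : F.obj x) : Over x ⥤ CF F where
  obj k := (toCF F).obj ⟨x, a, k⟩
  map {k l} f := (toCF F).map
    (X := ⟨x, a, k⟩) (Y := ⟨x, a, l⟩)
    { base := 𝟙 x, top := f.left, map_pt := by simp, comm := by simp }
  map_id k := (toCF F).map_id _
  map_comp f g := by
    rw [← (toCF F).map_comp]
    congr 1
    exact Elt.Hom.ext (Category.comp_id _).symm rfl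

/-- The functor `C ⥤ C/1`, for a terminal object `1`. -/
def toOverTerminal {one : C} (h : IsTerminal one) : C ⥤ Over one where
  obj y := Over.mk (h.from y)
  map f := Over.homMk f (h.hom_ext _ _)

/-- The functor `φ_F : C ⥤ C_F`, the cocone map at the element `(1, *)`. -/
def phi {one : C} (h : IsTerminal one) (pt : F.obj one) : C ⥤ CF F :=
  toOverTerminal h ⋙ sliceFunctor F one pt

end Diagram

/-! ### Complemented subobjects -/

section Complemented

/-- `b` and `c` are complements of each other. -/
def AreComplements {P : Type u} [PartialOrder P] (b c : P) : Prop :=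
  (∃ z : P, IsBot z ∧ IsGLB {b, c} z) ∧ (∃ z : P, IsTop z ∧ IsLUB {b, c} z)

variable {C : Type u} [Category.{v} C]

/-- The poset of complemented subobjects of `X`. -/
abbrev ComplSub (X : C) : Type (max u v) :=
  {b : Subobject X // ∃ c : Subobject X, AreComplements b c}

/-- The inclusion of the complemented subobjects of `X`, taking a subobject to its domain. -/
noncomputable def complSubInclusion (X : C) : ComplSub X ⥤ C :=
  (Subtype.mono_coe (fun b : Subobject X => ∃ c, AreComplements b c)).functor ⋙
    Subobject.underlying

/-- `P` is a Boolean algebra. -/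
def IsBooleanAlgebra (P : Type u) [PartialOrder P] : Prop :=
  ∃ (B : Type u) (_ : BooleanAlgebra B), Nonempty (P ≃o B)

/-- The topology on a poset formed by the `κ`-small unions. -/
def unionTopology (κ : Cardinal.{w}) (P : Type u) [PartialOrder P] : GrothendieckTopology P :=
  Precoverage.toGrothendieck
    { coverings := fun b => {R | ∃ (ι : Type w) (x : ι → P) (hx : ∀ i, x i ≤ b),
        HasCardinalLT ι κ ∧ IsLUB (Set.range x) b ∧
        R = Presieve.ofArrows x (fun i => homOfLE (hx i))} }

end Complemented

end KappaCoh

open KappaCoh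

/-!
Throughout, covers are `κ`-small *extremal epimorphic* families: families which factor through no
proper subobject of their codomain. If images exist and these families are stable under pullback
(`HasStableImages`), then they are effective (`HasStableImages.effectiveEpiFamily`), and effective
epimorphisms, images and unions can all be expressed by them. Coherence then amounts to `κ`-small
limits, stable images and the condition on cotrees.

*Exactness of `C_F`.* The colimit defining `C_F` is `κ`-filtered, since `F` is `κ`-lex. Hence a
`κ`-small diagram in `C_F` comes from a slice `C/x` (`IsLexPair.exists_lift_diagram`), and a
`κ`-small family of equalities, isomorphisms or covers holds in `C_F` if and only if it holds after
pulling back to some later slice (`IsLexPair.exists_common_stage`, `IsLexPair.exists_isIso_stage`,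
`IsLexPair.extremal_atStage`, `IsLexPair.exists_extremal_stage`). Limits, images and disjoint
coproducts therefore pass from `C` to `C_F`. For cotrees this argument needs the cotree to be a
`κ`-small diagram, and this is where weak compactness enters: a tree with `κ`-small branching and
branches of length less than `κ` is `κ`-small by the tree property (`IsTreeOrder.hasCardinalLT`,
`IsLexPair.extremal_cocomposition`).

*The topology.* The sieves containing a `κ`-small cover form a `κ`-topology: a cotree of covers of
arbitrary size is pruned to one with `κ`-small covers (`Cotree.prune`,
`isKappaTopology_extremalTopology`), whose branches are branches of the original one. It is the
topology generated by the covers of `C`, because every map of a slice is, in `C_F`, a pullback of a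
map in the image of `φ_F` (`IsLexPair.isPullback_phi`, `IsLexPair.generatedTopology_eq`).

*Complemented subobjects.* The union of fewer than `κ` complemented subobjects `b i` of the
terminal object is complemented by the intersection of their complements `c i`. To see that these
two cover, well-order the indices and split off one `b i` after the other; this is a cotree whose
branches end inside some `b i` or in the intersection of all `c i` (`SpineTree`,
`IsCoherentCategory.top_le_of_complements`). So the complemented subobjects are closed under
`κ`-small unions and intersections, and they inherit coherence from `C_F`
(`IsCoherentCategory.of_functor`).

*The restricted Yoneda functor.* If `F` is `κ`-regular, then the terminal object of `C_F` is
projective: a cover of it is the class of an effective epimorphism `k ⟶ x` at an element `a` of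
`F x`, and a preimage of `a` in `F k` is a stage at which it splits (`IsLexPair.exists_section`).
Adding the complement shows that complemented subobjects are projective as well
(`HasStableImages.exists_hom_of_effectiveEpi`), so effective epimorphisms become surjective on
sections (`effectiveEpi_restrictedYoneda`). A map from a complemented subobject `b` to an
object covered by a `κ`-small family lifts to the coproduct of the family; the decomposition of the
coproduct pulls back to a partition of `b` into complemented subobjects, which is a cover of `b`
(`HasStableImages.exists_partition`), and unions are preserved (`isUnion_restrictedYoneda`).
-/

namespace KappaCoh

/-! ### Extremal epimorphic families -/

section Families

variable {D : Type u} [Category.{v} D]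

theorem isIso_of_mono_of_section {X Y : D} (m : X ⟶ Y) (hm : Mono m) (s : Y ⟶ X)
    (h : s ≫ m = 𝟙 Y) : IsIso m :=
  ⟨s, by rw [← cancel_mono m, Category.assoc, h, Category.comp_id, Category.id_comp], h⟩

namespace ExtremalEpiFamily

variable {X : D} {ι : Type*} {Y : ι → D} {f : ∀ i, Y i ⟶ X}

theorem of_effectiveEpiFamily (h : EffectiveEpiFamily Y f) : ExtremalEpiFamily Y f := by
  intro Z m hm hf
  choose g hg using hf
  have hc : ∀ {Z' : D} (a₁ a₂ : ι) (g₁ : Z' ⟶ Y a₁) (g₂ : Z' ⟶ Y a₂),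
      g₁ ≫ f _ = g₂ ≫ f _ → g₁ ≫ g _ = g₂ ≫ g _ := by
    intro Z' a b g₁ g₂ h'
    rw [← cancel_mono m]
    simpa [hg] using h'
  refine isIso_of_mono_of_section m hm (EffectiveEpiFamily.desc Y f g hc) ?_
  refine EffectiveEpiFamily.hom_ext Y f _ _ fun i => ?_
  simp [hg]

/-- A family through which an extremal epimorphic family factors is extremal epimorphic. -/
theorem of_factors (h : ExtremalEpiFamily Y f) {ι' : Type*} {Y' : ι' → D} {f' : ∀ i, Y' i ⟶ X}
    (hf : ∀ i, ∃ (j : ι') (g : Y i ⟶ Y' j), g ≫ f' j = f i) : ExtremalEpiFamily Y' f' := by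
  intro Z m hm hZ
  refine h m hm fun i => ?_
  obtain ⟨j, g, hg⟩ := hf i
  obtain ⟨k, hk⟩ := hZ j
  exact ⟨g ≫ k, by rw [Category.assoc, hk, hg]⟩

/-- Extremal epimorphic families compose: a monomorphism through which the composites factor is
pulled back along each `f i` and so becomes invertible there. -/
theorem comp [HasPullbacks D] (h : ExtremalEpiFamily Y f) {α : ι → Type*}
    {Z : ∀ i, α i → D} {g : ∀ i j, Z i j ⟶ Y i} (hg : ∀ i, ExtremalEpiFamily (Z i) (g i)) :
    ExtremalEpiFamily (fun p : Σ i, α i => Z p.1 p.2) (fun p => g p.1 p.2 ≫ f p.1) := by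
  intro W m hm hW
  refine h m hm fun i => ?_
  have : IsIso (pullback.snd m (f i)) := hg i _ inferInstance fun j => by
    obtain ⟨k, hk⟩ := hW ⟨i, j⟩
    exact ⟨pullback.lift k (g i j) hk, pullback.lift_snd _ _ _⟩
  exact ⟨inv (pullback.snd m (f i)) ≫ pullback.fst m (f i), by simp [pullback.condition]⟩

theorem hom_ext [HasEqualizers D] (h : ExtremalEpiFamily Y f) {W : D} {a b : X ⟶ W}
    (hab : ∀ i, f i ≫ a = f i ≫ b) : a = b := by
  have : IsIso (equalizer.ι a b) := h _ inferInstance fun i =>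
    ⟨equalizer.lift (f i) (hab i), by simp⟩
  rw [← cancel_epi (equalizer.ι a b), equalizer.condition]

/-- The codomain may be replaced by an isomorphic object. -/
theorem comp_isIso (h : ExtremalEpiFamily Y f) {X' : D} (e : X ⟶ X') [IsIso e] :
    ExtremalEpiFamily Y (fun i => f i ≫ e) := by
  intro Z m hm hZ
  have : IsIso (m ≫ inv e) := h _ inferInstance fun i => by
    obtain ⟨k, hk⟩ := hZ i
    exact ⟨k, by rw [← Category.assoc, hk, Category.assoc, IsIso.hom_inv_id, Category.comp_id]⟩
  exact IsIso.of_isIso_comp_right m (inv e)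

theorem of_effectiveEpi {X Y : D} (f : Y ⟶ X) (h : EffectiveEpi f) :
    ExtremalEpiFamily (fun _ : PUnit.{w + 1} => Y) (fun _ => f) := by
  intro Z m hm hf
  obtain ⟨g, hg⟩ := hf ⟨⟩
  have hc : ∀ {Z' : D} (g₁ g₂ : Z' ⟶ Y), g₁ ≫ f = g₂ ≫ f → g₁ ≫ g = g₂ ≫ g := by
    intro Z' g₁ g₂ h'
    rw [← cancel_mono m]
    simpa [hg] using h'
  refine isIso_of_mono_of_section m hm (EffectiveEpi.desc f g hc) ?_
  rw [← cancel_epi f]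
  simp [hg]

/-- Orthogonality: a map `b` factors through a monomorphism as soon as its composites with the
members of an extremal epimorphic family do. -/
theorem exists_lift [HasPullbacks D] (h : ExtremalEpiFamily Y f) {A B : D} (m : A ⟶ B) [Mono m]
    (b : X ⟶ B) (t : ∀ i, ∃ k : Y i ⟶ A, k ≫ m = f i ≫ b) : ∃ k : X ⟶ A, k ≫ m = b := by
  have : IsIso (pullback.snd m b) := h _ inferInstance fun i => by
    obtain ⟨k, hk⟩ := t i
    exact ⟨pullback.lift k (f i) hk, pullback.lift_snd _ _ _⟩
  exact ⟨inv (pullback.snd m b) ≫ pullback.fst m b, by simp [pullback.condition]⟩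

end ExtremalEpiFamily

theorem effectiveEpi_of_effectiveEpiFamily {X Y : D} {f : Y ⟶ X}
    (h : EffectiveEpiFamily (fun _ : PUnit.{w + 1} => Y) (fun _ => f)) : EffectiveEpi f :=
  ⟨⟨{ desc := fun e he => EffectiveEpiFamily.desc _ _ (fun _ => e) (fun _ _ => he)
      fac := fun e he => EffectiveEpiFamily.fac _ _ (fun _ => e) (fun _ _ => he) PUnit.unit
      uniq := fun e he m hm =>
        EffectiveEpiFamily.uniq _ _ (fun _ => e) (fun _ _ => he) m fun _ => hm }⟩⟩

end Families

/-! ### Images and stability -/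

section StableImages

variable (κ : Cardinal.{w}) (D : Type u) [Category.{v} D]

/-- `D` has finite limits, every `κ`-small family factors as an extremal epimorphic family followed
by a monomorphism, and the `κ`-small extremal epimorphic families are stable under pullback. This
packages images, `κ`-small unions and their stability in one notion. -/
structure HasStableImages : Prop where
  hasFiniteLimits : HasFiniteLimits D
  image : ∀ (X : D) (ι : Type w), HasCardinalLT ι κ → ∀ (Y : ι → D) (f : ∀ i, Y i ⟶ X),
    ∃ (I : D) (m : I ⟶ X) (g : ∀ i, Y i ⟶ I), Mono m ∧ (∀ i, g i ≫ m = f i) ∧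
      ExtremalEpiFamily Y g
  stable : ∀ (X : D) (ι : Type w), HasCardinalLT ι κ → ∀ (Y : ι → D) (f : ∀ i, Y i ⟶ X),
    ExtremalEpiFamily Y f → ∀ (X' : D) (g : X' ⟶ X) (Y' : ι → D) (f' : ∀ i, Y' i ⟶ X')
      (p : ∀ i, Y' i ⟶ Y i), (∀ i, IsPullback (p i) (f' i) (f i) g) → ExtremalEpiFamily Y' f'

variable {κ D}

theorem hasCardinalLT_punit (hκ : Cardinal.aleph0 ≤ κ) : HasCardinalLT PUnit.{w + 1} κ :=
  hasCardinalLT_of_finite _ _ hκ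

theorem IsLexCategory.hasFiniteLimits (hκ : Cardinal.aleph0 ≤ κ) (h : IsLexCategory κ D) :
    HasFiniteLimits D :=
  hasFiniteLimits_of_hasFiniteLimits_of_size _ fun J _ _ =>
    h J (hasCardinalLT_of_finite _ _ hκ)

theorem IsLexFunctor.preservesFiniteLimits {E : Type u'} [Category.{v'} E] {G : D ⥤ E}
    (hκ : Cardinal.aleph0 ≤ κ) (h : IsLexFunctor κ G) : PreservesFiniteLimits G :=
  preservesFiniteLimits_of_preservesFiniteLimitsOfSize G fun J _ _ =>
    h J (hasCardinalLT_of_finite _ _ hκ)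

theorem IsUnion.isUnion_id {X : D} {ι : Type w} {Y : ι → D} {f : ∀ i, Y i ⟶ X}
    (h : ExtremalEpiFamily Y f) : IsUnion f (𝟙 X) where
  mono := inferInstance
  factors i := ⟨f i, Category.comp_id _⟩
  least Z n hn hf := by
    have := h n hn hf
    exact ⟨inv n, by simp⟩

/-- The image of a family is the union of the images of its members, and it is stable because both
steps are. Only the finite limits, factorizations and unions of a coherent category are used. -/
theorem IsCoherentCategory.hasStableImages (hκ : Cardinal.aleph0 ≤ κ)
    (h : IsCoherentCategory κ κ D) : HasStableImages κ D where
  hasFiniteLimits := h.lex.hasFiniteLimits hκ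
  image X ι hι Y f := by
    choose I e n he hn hen using fun i => h.factorization (f i)
    obtain ⟨U, m, hU⟩ := h.union X ι hι I n hn
    choose k hk using hU.factors
    have := hU.mono
    refine ⟨U, m, fun i => e i ≫ k i, hU.mono, fun i => by rw [Category.assoc, hk, hen], ?_⟩
    intro Z m' hm' hZ
    obtain ⟨t, ht⟩ := hU.least (m' ≫ m) (mono_comp _ _) fun i => by
      obtain ⟨g, hg⟩ := hZ i
      have := he i
      have sq : CommSq g (e i) m' (k i) := ⟨hg⟩
      exact ⟨sq.lift, by rw [← Category.assoc, sq.fac_right, hk]⟩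
    refine isIso_of_mono_of_section m' hm' t ?_
    rw [← cancel_mono m, Category.assoc, ht, Category.id_comp]
  stable X ι hι Y f hf X' g Y' f' p hp := by
    have := h.lex.hasFiniteLimits hκ
    choose I e n he hn hen using fun i => h.factorization (f i)
    have hU : IsUnion n (𝟙 X) := .isUnion_id (hf.of_factors fun i => ⟨i, e i, hen i⟩)
    have hU' : IsUnion (fun i => pullback.snd (n i) g) (𝟙 X') :=
      h.union_stable X ι hι I n hn X (𝟙 X) hU X' g _ _ (fun i => pullback.fst (n i) g) X' (𝟙 X') g
        (fun i => IsPullback.of_hasPullback _ _) (IsPullback.of_vert_isIso ⟨by simp⟩)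
    intro Z m hm hZ
    obtain ⟨t, ht⟩ := hU'.least m hm fun i => by
      obtain ⟨k, hk⟩ := hZ i
      let q : Y' i ⟶ pullback (n i) g := pullback.lift (p i ≫ e i) (f' i) (by
        rw [Category.assoc, hen, (hp i).w])
      have hq₁ : q ≫ pullback.fst (n i) g = p i ≫ e i := pullback.lift_fst _ _ _
      have hq₂ : q ≫ pullback.snd (n i) g = f' i := pullback.lift_snd _ _ _
      have hq : IsPullback (p i) q (e i) (pullback.fst (n i) g) := by
        refine IsPullback.of_right (t := (IsPullback.of_hasPullback (n i) g).flip) ?_ hq₁ |>.flip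
        rw [hq₂, hen]
        exact (hp i).flip
      have := h.effectiveEpi_stable _ _ _ _ hq (he i)
      have sq : CommSq k q m (pullback.snd (n i) g) := ⟨by rw [hk, hq₂]⟩
      exact ⟨sq.lift, sq.fac_right⟩
    exact isIso_of_mono_of_section m hm t ht

namespace HasStableImages

variable (h : HasStableImages κ D)
include h

theorem stable_pullback {X : D} {ι : Type w} (hι : HasCardinalLT ι κ) {Y : ι → D}
    {f : ∀ i, Y i ⟶ X} (hf : ExtremalEpiFamily Y f) {X' : D} (g : X' ⟶ X)
    [∀ i, HasPullback (f i) g] :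
    ExtremalEpiFamily (fun i => pullback (f i) g) (fun i => pullback.snd (f i) g) :=
  h.stable X ι hι Y f hf X' g _ _ _ fun _ => IsPullback.of_hasPullback _ _

/-- In the presence of stable images, extremal epimorphic families are effective: a compatible
family `e i : Y i ⟶ W` on `f i : Y i ⟶ X` descends because the image of the `(f i, e i)` in
`X ⨯ W` is the graph of a map. -/
theorem effectiveEpiFamily {X : D} {ι : Type w} (hι : HasCardinalLT ι κ) {Y : ι → D}
    {f : ∀ i, Y i ⟶ X} (hf : ExtremalEpiFamily Y f) : EffectiveEpiFamily Y f := by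
  have := h.hasFiniteLimits
  have key : ∀ {W : D} (e : ∀ i, Y i ⟶ W),
      (∀ {Z : D} (a₁ a₂ : ι) (g₁ : Z ⟶ Y a₁) (g₂ : Z ⟶ Y a₂),
        g₁ ≫ f _ = g₂ ≫ f _ → g₁ ≫ e _ = g₂ ≫ e _) → ∃ d : X ⟶ W, ∀ i, f i ≫ d = e i := by
    intro W e he
    obtain ⟨I, m, g, hm, hgm, hg⟩ := h.image (X ⨯ W) ι hι Y fun i => prod.lift (f i) (e i)
    have hp : ∀ i, g i ≫ m ≫ prod.fst = f i := fun i => by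
      rw [← Category.assoc, hgm, prod.lift_fst]
    have hq : ∀ i, g i ≫ m ≫ prod.snd = e i := fun i => by
      rw [← Category.assoc, hgm, prod.lift_snd]
    have hmono : Mono (m ≫ prod.fst) := by
      refine ⟨fun {Z} a b hab => ?_⟩
      have hZ := h.stable_pullback hι hg a
      have hZ' := hZ.comp fun i => h.stable_pullback hι hg (pullback.snd (g i) a ≫ b)
      have hsnd : a ≫ m ≫ prod.snd = b ≫ m ≫ prod.snd := by
        refine hZ'.hom_ext fun ⟨i, j⟩ => ?_
        have h₁ : pullback.fst (g i) a ≫ g i = pullback.snd (g i) a ≫ a := pullback.condition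
        have h₂ : pullback.fst (g j) (pullback.snd (g i) a ≫ b) ≫ g j =
          pullback.snd (g j) (pullback.snd (g i) a ≫ b) ≫ pullback.snd (g i) a ≫ b :=
          pullback.condition
        have h₃ := he i j (pullback.snd (g j) (pullback.snd (g i) a ≫ b) ≫ pullback.fst (g i) a)
          (pullback.fst (g j) (pullback.snd (g i) a ≫ b)) (by
            rw [← hp i, ← hp j, Category.assoc, reassoc_of% h₁, reassoc_of% h₂, hab])
        rw [← hq i, ← hq j, Category.assoc, reassoc_of% h₁, reassoc_of% h₂] at h₃
        simpa using h₃
      rw [← cancel_mono m]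
      refine prod.hom_ext ?_ ?_
      · simpa using hab
      · simpa using hsnd
    have hiso : IsIso (m ≫ prod.fst) := hf _ hmono fun i => ⟨g i, hp i⟩
    refine ⟨inv (m ≫ (prod.fst : X ⨯ W ⟶ X)) ≫ m ≫ prod.snd, fun i => ?_⟩
    rw [← hq i, ← hp i]
    simp only [Category.assoc]
    rw [← Category.assoc m prod.fst (inv _ ≫ _), IsIso.hom_inv_id_assoc]
  refine ⟨⟨{ desc := fun e he => (key e he).choose
             fac := fun e he => (key e he).choose_spec
             uniq := fun e he m hm => hf.hom_ext fun i => ?_ }⟩⟩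
  rw [hm, (key e he).choose_spec]

theorem extremal_iff {X : D} {ι : Type w} (hι : HasCardinalLT ι κ) {Y : ι → D}
    {f : ∀ i, Y i ⟶ X} : ExtremalEpiFamily Y f ↔ EffectiveEpiFamily Y f :=
  ⟨h.effectiveEpiFamily hι, .of_effectiveEpiFamily⟩

theorem effectiveEpi_iff (hκ : Cardinal.aleph0 ≤ κ) {X Y : D} (f : Y ⟶ X) : EffectiveEpi f ↔
    ExtremalEpiFamily (fun _ : PUnit.{w + 1} => Y) (fun _ => f) :=
  ⟨.of_effectiveEpi f, fun hf => effectiveEpi_of_effectiveEpiFamily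
    (h.effectiveEpiFamily (hasCardinalLT_punit hκ) hf)⟩

/-- Unions are the monomorphic parts of the factorizations into an extremal epimorphic family and a
monomorphism. -/
theorem isUnion_iff {X : D} {ι : Type w} {Y : ι → D}
    {u : ∀ i, Y i ⟶ X} {U : D} {m : U ⟶ X} : IsUnion u m ↔
      Mono m ∧ ∃ g : ∀ i, Y i ⟶ U, (∀ i, g i ≫ m = u i) ∧ ExtremalEpiFamily Y g := by
  have := h.hasFiniteLimits
  constructor
  · intro hU
    have := hU.mono
    choose g hg using hU.factors
    refine ⟨hU.mono, g, hg, fun Z n hn hZ => ?_⟩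
    obtain ⟨t, ht⟩ := hU.least (n ≫ m) (mono_comp _ _) fun i => by
      obtain ⟨k, hk⟩ := hZ i
      exact ⟨k, by rw [← Category.assoc, hk, hg]⟩
    refine isIso_of_mono_of_section n hn t ?_
    rw [← cancel_mono m, Category.assoc, ht, Category.id_comp]
  · rintro ⟨hm, g, hg, hge⟩
    refine ⟨hm, fun i => ⟨g i, hg i⟩, fun Z n hn hZ => ?_⟩
    refine hge.exists_lift n m fun i => ?_
    obtain ⟨k, hk⟩ := hZ i
    exact ⟨k, by rw [hk, hg]⟩

/-- A category with stable images is coherent once it has `κ`-small limits and its cotrees behave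
well. -/
theorem isCoherentCategory (hκ : Cardinal.aleph0 ≤ κ) (hlex : IsLexCategory κ D)
    (hcotree : ∀ K : Cotree κ D,
      (∀ t : K.T, ¬ IsMax t → HasCardinalLT (K.Next t) κ ∧
        ExtremalEpiFamily (fun s : K.Next t => K.at' s.1) (K.step t)) →
      ∀ (c : ∀ b : Flag K.T, Cone (K.branchDiagram b)), (∀ b, Nonempty (IsLimit (c b))) →
        ExtremalEpiFamily (fun b : Flag K.T => (c b).pt) (fun b => K.cocomposition b (c b))) :
    IsCoherentCategory κ κ D where
  lex := hlex
  cotree := hcotree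
  factorization X Y f := by
    obtain ⟨I, m, g, hm, hg, hge⟩ := h.image Y PUnit (hasCardinalLT_punit hκ) (fun _ => X)
      (fun _ => f)
    exact ⟨I, g ⟨⟩, m, (h.effectiveEpi_iff hκ _).2 hge, hm, hg ⟨⟩⟩
  effectiveEpi_stable P X Y Z fst snd f g hp hf :=
    (h.effectiveEpi_iff hκ _).2 (h.stable Z PUnit (hasCardinalLT_punit hκ) _ _
      ((h.effectiveEpi_iff hκ _).1 hf) _ g _ _ (fun _ => fst) fun _ => hp)
  union X ι hι Y u hu := by
    obtain ⟨I, m, g, hm, hg, hge⟩ := h.image X ι hι Y u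
    exact ⟨I, m, h.isUnion_iff.2 ⟨hm, g, hg, hge⟩⟩
  union_stable X ι hι Y u hu U m hU X' g Y' u' p U' m' q hp hq := by
    obtain ⟨hm, k, hk, hke⟩ := h.isUnion_iff.1 hU
    refine h.isUnion_iff.2 ⟨⟨fun a b hab => ?_⟩, fun i => hq.lift (p i ≫ k i) (u' i) ?_,
      fun i => hq.lift_snd _ _ _, ?_⟩
    · refine hq.hom_ext ?_ hab
      rw [← cancel_mono m, Category.assoc, Category.assoc, hq.w, reassoc_of% hab]
    · rw [Category.assoc, hk, (hp i).w]
    · refine h.stable U ι hι Y k hke U' q Y' _ p fun i => ?_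
      refine IsPullback.of_right (t := hq.flip) ?_ ?_ |>.flip
      · simpa [hk] using (hp i).flip
      · simp

/-- The empty extremal epimorphic family exhibits its codomain as an initial object. -/
theorem isInitial_of_extremal {X : D} {ι : Type w} [IsEmpty ι] (hι : HasCardinalLT ι κ)
    {Y : ι → D} {f : ∀ i, Y i ⟶ X} (hf : ExtremalEpiFamily Y f) : Nonempty (IsInitial X) := by
  have := h.effectiveEpiFamily hι hf
  exact ⟨IsInitial.ofUniqueHom
    (fun W => EffectiveEpiFamily.desc Y f (fun i => isEmptyElim i) fun i => isEmptyElim i)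
    (fun W m => EffectiveEpiFamily.hom_ext Y f _ _ fun i => isEmptyElim i)⟩

end HasStableImages

theorem extremal_of_isInitial {X : D} (hX : IsInitial X) {ι : Type*}
    {Y : ι → D} {f : ∀ i, Y i ⟶ X} : ExtremalEpiFamily Y f :=
  fun Z m hm _ => isIso_of_mono_of_section m hm (hX.to Z) (hX.hom_ext _ _)

namespace HasStableImages

variable (h : HasStableImages κ D)
include h

theorem isInitial_of_hom (hκ : Cardinal.aleph0 ≤ κ) {X Y : D} (hX : IsInitial X) (g : Y ⟶ X) :
    Nonempty (IsInitial Y) := by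
  have := h.hasFiniteLimits
  exact h.isInitial_of_extremal (ι := PEmpty) (hasCardinalLT_of_finite _ _ hκ)
    (h.stable_pullback (ι := PEmpty) (Y := fun i => i.elim) (f := fun i => i.elim)
    (hasCardinalLT_of_finite _ _ hκ) (extremal_of_isInitial hX) g)

/-- An extremal epimorphic family of pairwise disjoint monomorphisms is a coproduct cocone. -/
theorem isColimit_of_disjoint {X : D} {ι : Type w}
    (hι : HasCardinalLT ι κ) {Y : ι → D} {f : ∀ i, Y i ⟶ X} (hf : ExtremalEpiFamily Y f)
    (hm : ∀ i, Mono (f i))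
    (hd : ∀ i j, i ≠ j → ∀ {Z : D} (a : Z ⟶ Y i) (b : Z ⟶ Y j), a ≫ f i = b ≫ f j →
      Nonempty (IsInitial Z)) : Nonempty (IsColimit (Cofan.mk X f)) := by
  have := h.hasFiniteLimits
  have := h.effectiveEpiFamily hι hf
  refine ⟨Cofan.IsColimit.mk _ (fun s => EffectiveEpiFamily.desc Y f s.inj ?_) ?_ ?_⟩
  · intro Z i j a b hab
    by_cases hij : i = j
    · subst hij
      rw [(cancel_mono (f i)).1 hab]
    · obtain ⟨hZ⟩ := hd i j hij a b hab
      exact hZ.hom_ext _ _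
  · intro s i
    exact EffectiveEpiFamily.fac Y f _ _ i
  · intro s m hm
    exact EffectiveEpiFamily.hom_ext Y f _ _ fun i => by
      rw [EffectiveEpiFamily.fac]; exact hm i

end HasStableImages

theorem extremal_of_isColimit {X : D} {ι : Type*} {Y : ι → D} {f : ∀ i, Y i ⟶ X}
    (hc : IsColimit (Cofan.mk X f)) : ExtremalEpiFamily Y f := by
  intro Z m hm hZ
  choose g hg using hZ
  refine isIso_of_mono_of_section m hm (Cofan.IsColimit.desc hc g) ?_
  refine Cofan.IsColimit.hom_ext hc _ _ fun i => ?_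
  rw [← Category.assoc, Cofan.IsColimit.fac hc, hg]
  exact (Category.comp_id _).symm

end StableImages

/-! ### Trees without long branches -/

section Trees

variable {T : Type w} [PartialOrder T] (hT : IsTreeOrder T)

include hT

theorem IsTreeOrder.le_total {a b t : T} (ha : a ≤ t) (hb : b ≤ t) : a ≤ b ∨ b ≤ a := by
  rcases ha.eq_or_lt with rfl | ha
  · exact .inr hb
  rcases hb.eq_or_lt with rfl | hb
  · exact .inl ha.le
  have := hT t
  rcases Std.Trichotomous.rel_or_eq_or_rel_swap (r := ((· < ·) : Set.Iio t → Set.Iio t → Prop))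
    (a := ⟨a, ha⟩) (b := ⟨b, hb⟩) with h | h | h
  · exact .inl (le_of_lt h)
  · exact .inl (congrArg Subtype.val h).le
  · exact .inr (le_of_lt h)

theorem IsTreeOrder.wellFoundedLT : WellFoundedLT T := by
  refine ⟨⟨fun t => ⟨t, fun s hs => ?_⟩⟩⟩
  have := hT t
  have hacc := (IsWellFounded.wf (r := ((· < ·) : Set.Iio t → Set.Iio t → Prop))).apply ⟨s, hs⟩
  suffices ∀ x : Set.Iio t, Acc (· < ·) x → Acc (· < ·) x.1 from this _ hacc
  intro x hx
  induction hx with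
  | intro x _ ih => exact ⟨_, fun y hy => ih ⟨y, hy.trans x.2⟩ hy⟩

theorem IsTreeOrder.isChain_Iic (t : T) : IsChain (· ≤ ·) (Set.Iic t) :=
  fun _ ha _ hb _ => hT.le_total ha hb

/-- A node below `s` has a successor which is still below `s`. -/
theorem IsTreeOrder.exists_covBy_le {t s : T} (h : t < s) : ∃ r, t ⋖ r ∧ r ≤ s := by
  have := hT.wellFoundedLT
  obtain ⟨r, ⟨hr₁, hr₂⟩, hr⟩ := WellFounded.has_min
    (IsWellFounded.wf (r := ((· < ·) : T → T → Prop))) {r | t < r ∧ r ≤ s} ⟨s, h, le_rfl⟩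
  exact ⟨r, ⟨hr₁, fun x hx hxr => hr x ⟨hx, hxr.le.trans hr₂⟩ hxr⟩, hr₂⟩

omit hT in
/-- The predecessors of `s` form a principal segment of the predecessors of any `t > s`. -/
def iioPrincipalSeg {s t : T} (hst : s < t) :
    PrincipalSeg ((· < ·) : Set.Iio s → Set.Iio s → Prop)
      ((· < ·) : Set.Iio t → Set.Iio t → Prop) where
  toFun a := ⟨a.1, a.2.trans hst⟩
  inj' a b h := Subtype.ext (Subtype.mk.inj h)
  map_rel_iff' := Iff.rfl
  top := ⟨s, hst⟩
  mem_range_iff_rel' b := ⟨by rintro ⟨a, rfl⟩; exact a.2, fun hb => ⟨⟨b.1, hb⟩, rfl⟩⟩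

theorem nodeHeight_lt {s t : T} (hst : s < t) : nodeHeight hT s < nodeHeight hT t := by
  have := hT s
  have := hT t
  unfold nodeHeight
  rw [← Ordinal.typein_top (iioPrincipalSeg hst)]
  exact Ordinal.typein_lt_type _ _

theorem exists_nodeHeight_eq {t : T} {β : Ordinal.{w}} (hβ : β < nodeHeight hT t) :
    ∃ s < t, nodeHeight hT s = β := by
  have := hT t
  unfold nodeHeight at hβ
  obtain ⟨⟨s, hs⟩, hsβ⟩ := Ordinal.typein_surj _ hβ
  have := hT s
  refine ⟨s, hs, ?_⟩
  rw [← hsβ]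
  unfold nodeHeight
  exact (Ordinal.typein_top (iioPrincipalSeg hs)).symm

variable {κ : Cardinal.{w}} (hκ : IsWeaklyCompact κ) [OrderBot T]
  (hu : ∀ s t : T, Order.IsSuccLimit s → Set.Iio s = Set.Iio t → s = t)
  (hb : ∀ b : Flag T, HasCardinalLT b κ) (hn : ∀ t : T, HasCardinalLT {s : T // t ⋖ s} κ)

omit hT [OrderBot T] [PartialOrder T] in
theorem IsWeaklyCompact.hasCardinalLT_set (hκ : IsWeaklyCompact κ) (h : HasCardinalLT T κ) :
    HasCardinalLT (Set T) κ := by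
  rw [hasCardinalLT_iff_cardinal_mk_lt] at h ⊢
  rw [Cardinal.mk_set]
  exact hκ.pow_lt _ (lt_of_lt_of_le (Cardinal.natCast_lt_aleph0 (n := 2)) hκ.regular.aleph0_le) _ h

include hκ hu hn in
/-- The levels of the tree are `κ`-small, given that the part below the level is: this uses that
`κ` is a strong limit, since the nodes of a limit level correspond to sets of nodes of smaller
height. -/
theorem hasCardinalLT_level {α : Ordinal.{w}}
    (h : HasCardinalLT {t : T // nodeHeight hT t < α} κ) :
    HasCardinalLT {t : T // nodeHeight hT t = α} κ := by
  classical
  have := Fact.mk hκ.regular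
  let N := {t : T // nodeHeight hT t < α}
  -- A node of height `α` is the root, or the successor of a node of smaller height, or it is
  -- determined by the set of its predecessors.
  let g : PUnit.{w + 1} ⊕ (Σ a : N, {s : T // a.1 ⋖ s}) ⊕ Set N → T := fun x =>
    match x with
    | .inl _ => ⊥
    | .inr (.inl p) => p.2.1
    | .inr (.inr A) =>
      if h : ∃ t : T, Order.IsSuccLimit t ∧ Set.Iio t = Subtype.val '' A then h.choose else ⊥
  have hg : ∀ t : T, nodeHeight hT t = α → ∃ x, g x = t := by
    intro t ht
    by_cases hmin : IsMin t
    · exact ⟨.inl ⟨⟩, hmin.eq_bot.symm⟩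
    by_cases hpre : ∃ a, a ⋖ t
    · obtain ⟨a, ha⟩ := hpre
      exact ⟨.inr (.inl ⟨⟨a, ht ▸ nodeHeight_lt hT ha.lt⟩, ⟨t, ha⟩⟩), rfl⟩
    · have hlim : Order.IsSuccLimit t := ⟨hmin, fun a ha => hpre ⟨a, ha⟩⟩
      let A : Set N := {a | a.1 < t}
      have hA : Set.Iio t = Subtype.val '' A := by
        ext s
        constructor
        · intro hs
          exact ⟨⟨s, ht ▸ nodeHeight_lt hT hs⟩, hs, rfl⟩
        · rintro ⟨s, hs, rfl⟩
          exact hs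
      have hex : ∃ t : T, Order.IsSuccLimit t ∧ Set.Iio t = Subtype.val '' A := ⟨t, hlim, hA⟩
      refine ⟨.inr (.inr A), ?_⟩
      change (if h : _ then _ else _) = t
      rw [dif_pos hex]
      exact hu _ _ hex.choose_spec.1 (hex.choose_spec.2.trans hA.symm)
  choose x hx using hg
  have hsum : HasCardinalLT (PUnit.{w + 1} ⊕ (Σ a : N, {s : T // a.1 ⋖ s}) ⊕ Set N) κ := by
    rw [hasCardinalLT_sum_iff _ _ _ hκ.regular.aleph0_le,
      hasCardinalLT_sum_iff _ _ _ hκ.regular.aleph0_le]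
    exact ⟨hasCardinalLT_punit hκ.regular.aleph0_le, hasCardinalLT_sigma _ _ h fun a => hn a.1,
      hκ.hasCardinalLT_set h⟩
  refine hsum.of_injective (fun t : {t : T // nodeHeight hT t = α} => x t.1 t.2) ?_
  intro s t hst
  ext
  rw [← hx s.1 s.2, ← hx t.1 t.2]
  exact congrArg g hst

omit [OrderBot T] in
theorem hasCardinalLT_height_lt (hκ : IsWeaklyCompact κ) {α : Ordinal.{w}} (hα : α < κ.ord)
    (h : ∀ β < α, HasCardinalLT {t : T // nodeHeight hT t = β} κ) :
    HasCardinalLT {t : T // nodeHeight hT t < α} κ := by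
  have := Fact.mk hκ.regular
  have hα' : HasCardinalLT α.ToType κ := by
    rw [hasCardinalLT_iff_cardinal_mk_lt, Cardinal.mk_toType]
    exact Cardinal.lt_ord.1 hα
  refine (hasCardinalLT_iUnion
    (fun β : α.ToType => {t : T | nodeHeight hT t = (Ordinal.ToType.mk.symm β).1}) hα'
    fun β => h _ (Ordinal.ToType.mk.symm β).2).of_injective
      (fun t => ⟨t.1, Set.mem_iUnion.2
        ⟨Ordinal.ToType.mk ⟨nodeHeight hT t.1, t.2⟩, by simp⟩⟩) ?_
  intro s t hst
  exact Subtype.ext (Subtype.mk.inj hst)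

include hκ hu hb hn in
/-- By the tree property, a tree with a root, with `κ`-small branching and with branches shorter
than `κ` is `κ`-small. -/
theorem IsTreeOrder.hasCardinalLT : HasCardinalLT T κ := by
  have hlt : ∀ t : T, nodeHeight hT t < κ.ord := by
    intro t
    have := hT t
    rw [Cardinal.lt_ord]
    unfold nodeHeight
    rw [Ordinal.card_type, ← hasCardinalLT_iff_cardinal_mk_lt]
    obtain ⟨b, hbt⟩ := (hT.isChain_Iic t).exists_subset_flag
    exact (hb b).of_injective (fun s : Set.Iio t => (⟨s.1, hbt (le_of_lt s.2)⟩ : b))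
      fun s s' hs => Subtype.ext (Subtype.mk.inj hs)
  have hlev : ∀ α : Ordinal.{w}, α < κ.ord → HasCardinalLT {t : T // nodeHeight hT t = α} κ := by
    intro α
    induction α using WellFoundedLT.induction with
    | ind α ih =>
      intro hα
      exact hasCardinalLT_level hT hκ hu hn
        (hasCardinalLT_height_lt hT hκ hα fun β hβ => ih β hβ (hβ.trans hα))
  have hempty : ∃ α < κ.ord, ∀ t : T, nodeHeight hT t ≠ α := by
    by_contra! hne
    obtain ⟨b, hbκ⟩ := hκ.treeProperty T hT hlt hne hlev
    have := (hasCardinalLT_iff_cardinal_mk_lt _ _).1 (hb b)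
    exact this.ne hbκ
  obtain ⟨α, hα, hαt⟩ := hempty
  refine (hasCardinalLT_height_lt hT hκ hα fun β hβ => hlev β (hβ.trans hα)).of_injective
    (fun t : T => ⟨t, ?_⟩) fun s t hst => congrArg Subtype.val hst
  by_contra! hle
  obtain h | h := hle.eq_or_lt
  · exact hαt t h.symm
  · obtain ⟨s, -, hs⟩ := exists_nodeHeight_eq hT h
    exact hαt s hs

omit hT [OrderBot T] in
theorem IsWeaklyCompact.hasCardinalLT_flag (hκ : IsWeaklyCompact κ) (h : HasCardinalLT T κ) :
    HasCardinalLT (Flag T) κ :=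
  (hκ.hasCardinalLT_set h).of_injective (fun b => (b : Set T)) SetLike.coe_injective

end Trees

namespace Cotree

variable {κ : Cardinal.{w}} {D : Type u} [Category.{v} D]

theorem hasCardinalLT_nodes (hκ : IsWeaklyCompact κ) (K : Cotree κ D)
    (h : ∀ t : K.T, ¬ IsMax t → HasCardinalLT (K.Next t) κ) : HasCardinalLT K.T κ := by
  refine K.isTree.hasCardinalLT hκ K.limit_unique K.branch_lt fun t => ?_
  by_cases ht : IsMax t
  · have : IsEmpty {s : K.T // t ⋖ s} := ⟨fun s => ht.not_lt s.2.lt⟩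
    exact hasCardinalLT_of_finite _ _ hκ.regular.aleph0_le
  · exact h t ht

end Cotree

/-! ### Limits in the total category of the slices -/

section Small

theorem hasCardinalLT_arrow_of_thin {κ : Cardinal.{w}} (hκ : Cardinal.aleph0 ≤ κ) (J : Type u)
    [Category.{v} J] [Quiver.IsThin J] (hJ : HasCardinalLT J κ) : HasCardinalLT (Arrow J) κ := by
  refine (hasCardinalLT_prod hκ hJ hJ).of_injective (fun f => (f.left, f.right)) ?_
  rintro ⟨X, Y, f⟩ ⟨X', Y', f'⟩ h
  obtain ⟨rfl, rfl⟩ := Prod.mk.inj h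
  obtain rfl := Subsingleton.elim (α := X ⟶ Y) f f'
  rfl

theorem hasCardinalLT_of_arrow {κ : Cardinal.{w}} {J : Type u} [Category.{v} J]
    (hJ : HasCardinalLT (Arrow J) κ) : HasCardinalLT J κ :=
  hJ.of_injective (fun j => Arrow.mk (𝟙 j)) fun _ _ h => congrArg Comma.left h

end Small

section Sections

theorem functor_map_comp_apply {C : Type u} [Category.{v} C] (F : C ⥤ Type w) {X Y Z : C}
    (f : X ⟶ Y) (g : Y ⟶ Z) (x : F.obj X) : F.map (f ≫ g) x = F.map g (F.map f x) := by
  simp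

variable {C : Type u} [Category.{v} C] {J : Type u'} [Category.{v'} J] {D : J ⥤ C}
  (F : C ⥤ Type w) [PreservesLimit D F] {c : Cone D} (hc : IsLimit c)

include hc

/-- If `F` preserves a limit, then a compatible family of elements of `F` has an amalgam at the
limit; it is unique by `element_ext_of_isLimit`. -/
theorem exists_element_of_isLimit (x : ∀ j, F.obj (D.obj j))
    (hx : ∀ {i j : J} (f : i ⟶ j), F.map (D.map f) (x i) = x j) :
    ∃ y : F.obj c.pt, ∀ j, F.map (c.π.app j) y = x j := by
  obtain ⟨y, hy, -⟩ := (Types.isLimit_iff _).1 ⟨isLimitOfPreserves F hc⟩ x fun f => hx f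
  exact ⟨y, hy⟩

theorem element_ext_of_isLimit {y z : F.obj c.pt}
    (h : ∀ j, F.map (c.π.app j) y = F.map (c.π.app j) z) : y = z := by
  obtain ⟨a, -, ha⟩ := (Types.isLimit_iff _).1 ⟨isLimitOfPreserves F hc⟩
    (fun j => F.map (c.π.app j) z) fun {i j} f => by
      change F.map (D.map f) (F.map (c.π.app i) z) = F.map (c.π.app j) z
      rw [← c.w f, functor_map_comp_apply]
  exact (ha y h).trans (ha z fun _ => rfl).symm

end Sections

variable {C : Type u} [Category.{v} C]

namespace Elt

variable {F : C ⥤ Type w}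

@[simp] theorem comp_base {X Y Z : Elt F} (f : X ⟶ Y) (g : Y ⟶ Z) :
    Hom.base (f ≫ g) = Hom.base f ≫ Hom.base g := rfl

theorem hom_ext {X Y : Elt F} {f g : X ⟶ Y} (hb : Hom.base f = Hom.base g)
    (ht : Hom.top f = Hom.top g) : f = g := Hom.ext hb ht

/-- The map of `Elt F` with given components. -/
abbrev homMk {X Y : Elt F} (b : X.base ⟶ Y.base) (t : X.arr.left ⟶ Y.arr.left)
    (hpt : F.map b X.pt = Y.pt) (hc : t ≫ Y.arr.hom = X.arr.hom ≫ b) : X ⟶ Y :=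
  { base := b, top := t, map_pt := hpt, comm := hc }

variable (F) in
/-- The functor taking `(u ⟶ x, a)` to `x`. -/
def baseFunctor : Elt F ⥤ C where
  obj X := X.base
  map f := Hom.base f

variable (F) in
/-- The functor taking `(u ⟶ x, a)` to `u`. -/
def topFunctor : Elt F ⥤ C where
  obj X := X.arr.left
  map f := Hom.top f

/-- A cone in `Elt F` is a limit as soon as its two components are. -/
theorem isLimit_of_components {J : Type u'} [Category.{v'} J] {D : J ⥤ Elt F}
    [PreservesLimit (D ⋙ baseFunctor F) F] {c : Cone D}
    (hb : Nonempty (IsLimit ((baseFunctor F).mapCone c)))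
    (ht : Nonempty (IsLimit ((topFunctor F).mapCone c))) : Nonempty (IsLimit c) := by
  obtain ⟨hb⟩ := hb
  obtain ⟨ht⟩ := ht
  have fb : ∀ (s : Cone D) (j : J), hb.lift ((baseFunctor F).mapCone s) ≫ Hom.base (c.π.app j) =
    Hom.base (s.π.app j) := fun s j => hb.fac ((baseFunctor F).mapCone s) j
  have ft : ∀ (s : Cone D) (j : J), ht.lift ((topFunctor F).mapCone s) ≫ Hom.top (c.π.app j) =
    Hom.top (s.π.app j) := fun s j => ht.fac ((topFunctor F).mapCone s) j
  refine ⟨{ lift := fun s => homMk (hb.lift ((baseFunctor F).mapCone s))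
              (ht.lift ((topFunctor F).mapCone s)) ?_ ?_
            fac := fun s j => hom_ext (fb s j) (ft s j)
            uniq := fun s m hm => hom_ext (hb.hom_ext fun j => ?_) (ht.hom_ext fun j => ?_) }⟩
  · refine element_ext_of_isLimit F hb fun j => ?_
    have h₁ := Hom.map_pt (s.π.app j)
    have h₂ := Hom.map_pt (c.π.app j)
    rw [← fb s j] at h₁
    refine Eq.trans ?_ (h₁.trans h₂.symm)
    exact (functor_map_comp_apply F _ _ _).symm
  · refine hb.hom_ext fun j => ?_
    have h₁ := Hom.comm (s.π.app j)
    have h₂ := Hom.comm (c.π.app j)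
    refine (Category.assoc _ _ _).trans ((congrArg (_ ≫ ·) h₂.symm).trans ?_)
    refine ((Category.assoc _ _ _).symm.trans (congrArg (· ≫ _) (ft s j))).trans ?_
    exact h₁.trans ((congrArg (_ ≫ ·) (fb s j).symm).trans (Category.assoc _ _ _).symm)
  · exact (congrArg Hom.base (hm j)).trans (fb s j).symm
  · exact (congrArg Hom.top (hm j)).trans (ft s j).symm

/-- Limits in `Elt F` are computed componentwise, the element at the limit of the bases being the
amalgam of the given elements. -/
theorem hasLimit {J : Type u'} [Category.{v'} J] (D : J ⥤ Elt F) [HasLimitsOfShape J C]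
    [PreservesLimitsOfShape J F] : HasLimit D := by
  let cb := limit.cone (D ⋙ baseFunctor F)
  let ct := limit.cone (D ⋙ topFunctor F)
  have hb : IsLimit cb := limit.isLimit _
  have ht : IsLimit ct := limit.isLimit _
  obtain ⟨y, hy⟩ := exists_element_of_isLimit F hb (fun j => (D.obj j).pt)
    fun f => Hom.map_pt (D.map f)
  let k : ct.pt ⟶ cb.pt := hb.lift
    { pt := ct.pt
      π := { app := fun j => ct.π.app j ≫ (D.obj j).arr.hom
             naturality := fun i j f => by
              have h₁ := Hom.comm (D.map f)
              have h₂ : ct.π.app i ≫ Hom.top (D.map f) = ct.π.app j := ct.w f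
              refine (Category.id_comp _).trans ((congrArg (· ≫ _) h₂.symm).trans ?_)
              exact (Category.assoc _ _ _).trans
                ((congrArg (_ ≫ ·) h₁).trans (Category.assoc _ _ _).symm) } }
  have hk : ∀ j, k ≫ cb.π.app j = ct.π.app j ≫ (D.obj j).arr.hom := fun j => hb.fac _ j
  let c : Cone D :=
    { pt := ⟨cb.pt, y, Over.mk k⟩
      π := { app := fun j => homMk (cb.π.app j) (ct.π.app j) (hy j) (hk j).symm
             naturality := fun i j f => hom_ext (cb.π.naturality f) (ct.π.naturality f) } }
  obtain ⟨hc⟩ := isLimit_of_components (c := c)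
    ⟨IsLimit.ofIsoLimit hb (Cone.ext (Iso.refl _) fun j => (Category.id_comp _).symm)⟩
    ⟨IsLimit.ofIsoLimit ht (Cone.ext (Iso.refl _) fun j => (Category.id_comp _).symm)⟩
  exact ⟨c, hc⟩

theorem isPullback_of_components [PreservesLimitsOfShape WalkingCospan F] {P X Y Z : Elt F}
    {fst : P ⟶ X} {snd : P ⟶ Y} {f : X ⟶ Z} {g : Y ⟶ Z}
    (hb : IsPullback (Hom.base fst) (Hom.base snd) (Hom.base f) (Hom.base g))
    (ht : IsPullback (Hom.top fst) (Hom.top snd) (Hom.top f) (Hom.top g)) :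
    IsPullback fst snd f g := by
  have w : fst ≫ f = snd ≫ g := hom_ext hb.w ht.w
  refine ⟨⟨w⟩, isLimit_of_components ⟨?_⟩ ⟨?_⟩⟩
  · exact (isLimitMapConePullbackConeEquiv (baseFunctor F) w).symm hb.isLimit
  · exact (isLimitMapConePullbackConeEquiv (topFunctor F) w).symm ht.isLimit

/-- Cartesian maps are cartesian with respect to `baseFunctor F`. -/
theorem exists_cartesian_lift {Z E Z' : Elt F} {s : Z ⟶ E} (hs : cartesian F s) (f : Z' ⟶ E)
    (t : Z'.base ⟶ Z.base) (ht : t ≫ Hom.base s = Hom.base f) (hpt : F.map t Z'.pt = Z.pt) :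
    ∃ k : Z' ⟶ Z, Hom.base k = t ∧ k ≫ s = f := by
  have hs' : IsPullback (Hom.top s) Z.arr.hom E.arr.hom (Hom.base s) := hs
  refine ⟨homMk t (hs'.lift (Hom.top f) (Z'.arr.hom ≫ t) ?_) hpt (hs'.lift_snd _ _ _), rfl,
    hom_ext ht (hs'.lift_fst _ _ _)⟩
  rw [Category.assoc, ht, Hom.comm f]

/-- The restriction of an object of `Elt F` along a map of elements of `F`. -/
noncomputable abbrev restrict [HasPullbacks C] (E : Elt F) {y : C} (h : y ⟶ E.base) (b : F.obj y) :
    Elt F := ⟨y, b, Over.mk (pullback.snd E.arr.hom h)⟩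

/-- The cartesian map from a restriction. -/
noncomputable abbrev restrictHom [HasPullbacks C] (E : Elt F) {y : C} (h : y ⟶ E.base) (b : F.obj y)
    (hb : F.map h b = E.pt) : E.restrict h b ⟶ E :=
  homMk h (pullback.fst _ _) hb pullback.condition

theorem cartesian_restrictHom [HasPullbacks C] (E : Elt F) {y : C} (h : y ⟶ E.base) (b : F.obj y)
    (hb : F.map h b = E.pt) : cartesian F (E.restrictHom h b hb) :=
  IsPullback.of_hasPullback _ _

end Elt

/-! ### Limits in `C_F` -/

/-- A `κ`-lex category `C` with a `κ`-lex functor `F : C ⥤ Type`. -/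
structure IsLexPair (κ : Cardinal.{w}) (F : C ⥤ Type w) : Prop where
  isRegular : κ.IsRegular
  lexCategory : IsLexCategory κ C
  lexFunctor : IsLexFunctor κ F

theorem CF.exists_eq_toCF {F : C ⥤ Type w} (X : CF F) : ∃ E : Elt F, (toCF F).obj E = X :=
  ⟨(Localization.Construction.objEquiv _).symm X,
    (Localization.Construction.objEquiv _).apply_symm_apply X⟩

theorem isIso_toCF_map {F : C ⥤ Type w} {X Y : Elt F} {s : X ⟶ Y} (hs : Elt.cartesian F s) :
    IsIso ((toCF F).map s) :=
  Localization.inverts (toCF F) (Elt.cartesian F) s hs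

namespace IsLexPair

variable {κ : Cardinal.{w}} {F : C ⥤ Type w} (h : IsLexPair κ F)
include h

theorem aleph0_le : Cardinal.aleph0 ≤ κ := h.isRegular.aleph0_le

theorem hasFiniteLimits : HasFiniteLimits C := h.lexCategory.hasFiniteLimits h.aleph0_le

theorem preservesFiniteLimits : PreservesFiniteLimits F :=
  h.lexFunctor.preservesFiniteLimits h.aleph0_le

/-- A `κ`-small family of maps `y i ⟶ x` taking `b i ∈ F (y i)` to `a ∈ F x` is dominated by one
such map. -/
theorem exists_common_base {x : C} (a : F.obj x) {ι : Type w} (hι : HasCardinalLT ι κ)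
    (y : ι → C) (b : ∀ i, F.obj (y i)) (t : ∀ i, y i ⟶ x) (ht : ∀ i, F.map (t i) (b i) = a) :
    ∃ (z : C) (c : F.obj z) (r : z ⟶ x) (q : ∀ i, z ⟶ y i), F.map r c = a ∧
      (∀ i, F.map (q i) c = b i) ∧ ∀ i, q i ≫ t i = r := by
  have hJ : HasCardinalLT (Arrow (WidePullbackShape ι)) κ :=
    hasCardinalLT_arrow_of_thin h.aleph0_le _
      ((hasCardinalLT_option_iff _ _ h.aleph0_le).2 hι)
  have := h.lexCategory _ hJ
  have := h.lexFunctor _ hJ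
  let D := WidePullbackShape.wideCospan x y t
  obtain ⟨c, hc⟩ := exists_element_of_isLimit F (limit.isLimit D)
    (fun j => match j with
      | none => a
      | some i => b i) (by
      rintro _ _ (_ | i)
      · exact (congrArg (fun f => F.map f _) (D.map_id _)).trans (by simp)
      · exact ht i)
  exact ⟨limit D, c, limit.π D none, fun i => limit.π D (some i), hc none, fun i => hc (some i),
    fun i => limit.w D (WidePullbackShape.Hom.term i)⟩

/-- A `κ`-small family of cartesian maps to `W` is dominated by one cartesian map. -/
theorem exists_common_cartesian {W : Elt F} {ι : Type w} (hι : HasCardinalLT ι κ)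
    (Z : ι → Elt F) (s : ∀ i, Z i ⟶ W) (hs : ∀ i, Elt.cartesian F (s i)) :
    ∃ (V : Elt F) (r : V ⟶ W) (q : ∀ i, V ⟶ Z i), Elt.cartesian F r ∧ ∀ i, q i ≫ s i = r := by
  have := h.hasFiniteLimits
  obtain ⟨z, c, r, q, hr, hq, hqr⟩ := h.exists_common_base W.pt hι (fun i => (Z i).base)
    (fun i => (Z i).pt) (fun i => Elt.Hom.base (s i)) fun i => Elt.Hom.map_pt (s i)
  choose k hk hks using fun i => Elt.exists_cartesian_lift (hs i) (W.restrictHom r c hr) (q i)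
    (hqr i) (hq i)
  exact ⟨W.restrict r c, W.restrictHom r c hr, k, W.cartesian_restrictHom r c hr, hks⟩

/-- A `κ`-small family of maps of `C_F` with common source has a common denominator. -/
theorem exists_representatives {W : Elt F} {ι : Type w} (hι : HasCardinalLT ι κ)
    (E : ι → Elt F) (φ : ∀ i, (toCF F).obj W ⟶ (toCF F).obj (E i)) :
    ∃ (V : Elt F) (r : V ⟶ W) (f : ∀ i, V ⟶ E i), Elt.cartesian F r ∧
      ∀ i, (toCF F).map r ≫ φ i = (toCF F).map (f i) := by
  have := h.hasFiniteLimits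
  have := h.preservesFiniteLimits
  choose Z s f hs hf using fun i => CF.exists_representative F (φ i)
  obtain ⟨V, r, q, hr, hq⟩ := h.exists_common_cartesian hι Z s hs
  refine ⟨V, r, fun i => q i ≫ f i, hr, fun i => ?_⟩
  rw [← hq i, Functor.map_comp, Functor.map_comp, Category.assoc, hf]

/-- A `κ`-small family of equalities of `C_F` is witnessed by one cartesian map. -/
theorem exists_equalizing {W : Elt F} {ι : Type w} (hι : HasCardinalLT ι κ)
    {E : ι → Elt F} (f g : ∀ i, W ⟶ E i) (hfg : ∀ i, (toCF F).map (f i) = (toCF F).map (g i)) :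
    ∃ (V : Elt F) (r : V ⟶ W), Elt.cartesian F r ∧ ∀ i, r ≫ f i = r ≫ g i := by
  have := h.hasFiniteLimits
  have := h.preservesFiniteLimits
  choose Z s hs hf using fun i => (CF.map_eq_iff F (f i) (g i)).1 (hfg i)
  obtain ⟨V, r, q, hr, hq⟩ := h.exists_common_cartesian hι Z s hs
  refine ⟨V, r, hr, fun i => ?_⟩
  rw [← hq i, Category.assoc, Category.assoc, hf]

/-- The localization functor preserves `κ`-small limits, because a `κ`-small cone of fractions
has a common denominator. -/
theorem isLimit_toCF_mapCone {J : Type w} [SmallCategory J] (hJ : HasCardinalLT (Arrow J) κ)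
    {D : J ⥤ Elt F} {c : Cone D} (hc : IsLimit c) : Nonempty (IsLimit ((toCF F).mapCone c)) := by
  have hJ' := hasCardinalLT_of_arrow hJ
  have huniq : ∀ (X : CF F) (φ ψ : X ⟶ (toCF F).obj c.pt),
      (∀ j, φ ≫ (toCF F).map (c.π.app j) = ψ ≫ (toCF F).map (c.π.app j)) → φ = ψ := by
    intro X φ ψ hφψ
    obtain ⟨W, rfl⟩ := X.exists_eq_toCF
    obtain ⟨V, r, f, hr, hf⟩ := h.exists_representatives (ι := ULift Bool)
      (hasCardinalLT_of_finite _ _ h.aleph0_le) (fun _ => c.pt) fun i => if i.down then φ else ψ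
    have h₁ : (toCF F).map r ≫ φ = (toCF F).map (f ⟨true⟩) := hf ⟨true⟩
    have h₂ : (toCF F).map r ≫ ψ = (toCF F).map (f ⟨false⟩) := hf ⟨false⟩
    obtain ⟨V', r', hr', he⟩ := h.exists_equalizing hJ' (fun j => f ⟨true⟩ ≫ c.π.app j)
      (fun j => f ⟨false⟩ ≫ c.π.app j) fun j => by
        rw [Functor.map_comp, Functor.map_comp, ← h₁, ← h₂, Category.assoc, Category.assoc, hφψ]
    have h₃ : r' ≫ f ⟨true⟩ = r' ≫ f ⟨false⟩ := hc.hom_ext fun j => by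
      rw [Category.assoc, Category.assoc, he]
    have := isIso_toCF_map hr
    have := isIso_toCF_map hr'
    rw [← cancel_epi ((toCF F).map r), ← cancel_epi ((toCF F).map r'), h₁, h₂,
      ← Functor.map_comp, ← Functor.map_comp, h₃]
  have hex : ∀ s : Cone (D ⋙ toCF F), ∃ φ : s.pt ⟶ (toCF F).obj c.pt,
      ∀ j, φ ≫ (toCF F).map (c.π.app j) = s.π.app j := by
    rintro ⟨X, π⟩
    obtain ⟨W, rfl⟩ := X.exists_eq_toCF
    obtain ⟨V, r, f, hr, hf⟩ := h.exists_representatives hJ' D.obj fun j => π.app j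
    obtain ⟨V', r', hr', he⟩ := h.exists_equalizing hJ (fun a => f a.left ≫ D.map a.hom)
      (fun a => f a.right) fun a => by
        rw [Functor.map_comp, ← hf, ← hf, Category.assoc]
        exact congrArg _ ((π.naturality a.hom).symm.trans (Category.id_comp _))
    have := isIso_toCF_map hr
    have := isIso_toCF_map hr'
    let l : V' ⟶ c.pt := hc.lift
      { pt := V'
        π := { app := fun j => r' ≫ f j
               naturality := fun i j a => by
                have := he (Arrow.mk a)
                simpa using this.symm } }
    have hl : ∀ j, l ≫ c.π.app j = r' ≫ f j := fun j => hc.fac _ j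
    refine ⟨inv ((toCF F).map r) ≫ inv ((toCF F).map r') ≫ (toCF F).map l, fun j => ?_⟩
    simp only [Category.assoc]
    rw [← Functor.map_comp, hl, Functor.map_comp, ← hf]
    simp
  choose φ hφ using hex
  exact ⟨{ lift := φ, fac := hφ, uniq := fun s m hm => huniq _ _ _ fun j =>
    (hm j).trans (hφ s j).symm }⟩

theorem lexFunctor_toCF : IsLexFunctor κ (toCF F) :=
  fun _ _ hJ => ⟨⟨fun hc => h.isLimit_toCF_mapCone hJ hc⟩⟩

theorem isPullback_toCF {P X Y Z : Elt F} {fst : P ⟶ X} {snd : P ⟶ Y} {f : X ⟶ Z} {g : Y ⟶ Z}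
    (hb : IsPullback (Elt.Hom.base fst) (Elt.Hom.base snd) (Elt.Hom.base f) (Elt.Hom.base g))
    (ht : IsPullback (Elt.Hom.top fst) (Elt.Hom.top snd) (Elt.Hom.top f) (Elt.Hom.top g)) :
    IsPullback ((toCF F).map fst) ((toCF F).map snd) ((toCF F).map f) ((toCF F).map g) := by
  have := h.preservesFiniteLimits
  have := h.lexFunctor_toCF.preservesFiniteLimits h.aleph0_le
  exact (Elt.isPullback_of_components hb ht).map (toCF F)

end IsLexPair

/-! ### Stages of the colimit -/

section Stages

variable {C : Type u} [Category.{v} C] {F : C ⥤ Type w}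

variable (F) in
/-- The stages of the colimit: the elements of `F`, that is, objects `x` with an `a ∈ F x`. -/
structure Stage where
  /-- the object `x` -/
  obj : C
  /-- the element `a` of `F x` -/
  pt : F.obj obj

namespace Stage

/-- A map of stages is a map of `C` taking one element to the other. -/
@[ext]
structure Hom (x y : Stage F) where
  /-- the map of `C` -/
  map : x.obj ⟶ y.obj
  map_pt : F.map map x.pt = y.pt

instance : Category (Stage F) where
  Hom := Hom
  id x := ⟨𝟙 _, by simp⟩
  comp f g := ⟨f.map ≫ g.map, by rw [functor_map_comp_apply, f.map_pt, g.map_pt]⟩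
  id_comp _ := Hom.ext (Category.id_comp _)
  comp_id _ := Hom.ext (Category.comp_id _)
  assoc _ _ _ := Hom.ext (Category.assoc _ _ _)

end Stage

/-- The slice `C/x` inside the total category, at an element `(x, a)` of `F`. -/
abbrev sliceElt (x : Stage F) : Over x.obj ⥤ Elt F where
  obj k := ⟨x.obj, x.pt, k⟩
  map f := Elt.homMk (𝟙 _) f.left (by simp) (by simp)
  map_id _ := rfl
  map_comp _ _ := Elt.hom_ext (Category.comp_id _).symm rfl

/-- The cocone map `C/x ⥤ C_F` at an element `(x, a)` of `F`. -/
abbrev atStage (x : Stage F) : Over x.obj ⥤ CF F := sliceElt x ⋙ toCF F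

variable [HasPullbacks C]

/-- The cartesian map comparing an object of a slice with its restriction to a later stage. -/
noncomputable abbrev stageElt {x y : Stage F} (p : y ⟶ x) (k : Over x.obj) :
    (sliceElt y).obj ((Over.pullback (Stage.Hom.map p)).obj k) ⟶ (sliceElt x).obj k :=
  Elt.homMk (Stage.Hom.map p) (pullback.fst k.hom (Stage.Hom.map p)) (Stage.Hom.map_pt p)
    pullback.condition

theorem cartesian_stageElt {x y : Stage F} (p : y ⟶ x) (k : Over x.obj) :
    Elt.cartesian F (stageElt p k) :=
  IsPullback.of_hasPullback _ _

theorem stageElt_naturality {x y : Stage F} (p : y ⟶ x) {k l : Over x.obj} (f : k ⟶ l) :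
    (sliceElt y).map ((Over.pullback (Stage.Hom.map p)).map f) ≫ stageElt p l =
      stageElt p k ≫ (sliceElt x).map f := by
  refine Elt.hom_ext ?_ ?_
  · exact (Category.id_comp _).trans (Category.comp_id _).symm
  · exact pullback.lift_fst _ _ _

/-- An object of a slice and its restriction to a later stage are identified in `C_F`. -/
noncomputable def stageIso {x y : Stage F} (p : y ⟶ x) :
    Over.pullback (Stage.Hom.map p) ⋙ atStage y ≅ atStage x :=
  NatIso.ofComponents
    (fun k =>
      @asIso _ _ _ _ ((toCF F).map (stageElt p k)) (isIso_toCF_map (cartesian_stageElt p k)))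
    fun f => by
      have := congrArg (toCF F).map (stageElt_naturality p f)
      rw [Functor.map_comp, Functor.map_comp] at this
      exact this

theorem stageIso_hom_app {x y : Stage F} (p : y ⟶ x) (k : Over x.obj) :
    (stageIso p).hom.app k = (toCF F).map (stageElt p k) := rfl

/-- Restriction to a later stage factors through restriction to the stages in between. -/
theorem stageElt_comp {x y z : Stage F} (q : z ⟶ y) (p : y ⟶ x) (k : Over x.obj) :
    ∃ u : (sliceElt z).obj ((Over.pullback (Stage.Hom.map (q ≫ p))).obj k) ⟶
      (sliceElt y).obj ((Over.pullback (Stage.Hom.map p)).obj k), Elt.Hom.base u = Stage.Hom.map q ∧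
      u ≫ stageElt p k = stageElt (q ≫ p) k :=
  Elt.exists_cartesian_lift (cartesian_stageElt p k) (stageElt (q ≫ p) k) (Stage.Hom.map q) rfl
    (Stage.Hom.map_pt q)

end Stages

namespace IsLexPair

variable {C : Type u} [Category.{v} C] {κ : Cardinal.{w}} {F : C ⥤ Type w} (h : IsLexPair κ F)

include h

/-- `κ`-small families of conditions, each of which holds from some stage on, hold simultaneously
from some stage on. -/
theorem exists_common_stage {x : Stage F} {ι : Type w} (hι : HasCardinalLT ι κ)
    (P : ι → ∀ y : Stage F, (y ⟶ x) → Prop)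
    (hP : ∀ i y z (q : z ⟶ y) (p : y ⟶ x), P i y p → P i z (q ≫ p))
    (hex : ∀ i, ∃ y p, P i y p) : ∃ y p, ∀ i, P i y p := by
  choose y p hp using hex
  obtain ⟨z, c, r, q, hr, hq, hqr⟩ := h.exists_common_base x.pt hι (fun i => (y i).obj)
    (fun i => (y i).pt) (fun i => Stage.Hom.map (p i)) fun i => Stage.Hom.map_pt (p i)
  refine ⟨⟨z, c⟩, ⟨r, hr⟩, fun i => ?_⟩
  have := hP i _ ⟨z, c⟩ ⟨q i, hq i⟩ (p i) (hp i)
  have he : Stage.Hom.mk r hr = (⟨q i, hq i⟩ : Stage.Hom ⟨z, c⟩ (y i)) ≫ p i :=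
    Stage.Hom.ext (hqr i).symm
  exact he ▸ this

theorem exists_stage_over_family {ι : Type w} (hι : HasCardinalLT ι κ) (x : ι → Stage F) :
    ∃ (z : Stage F), ∀ i, Nonempty (z ⟶ x i) := by
  have hJ : HasCardinalLT (Arrow (Discrete ι)) κ :=
    hasCardinalLT_arrow_of_thin h.aleph0_le _
      ((hasCardinalLT_iff_of_equiv discreteEquiv κ).2 hι)
  have := h.lexCategory _ hJ
  have := h.lexFunctor _ hJ
  let D := Discrete.functor fun i => (x i).obj
  obtain ⟨c, hc⟩ := exists_element_of_isLimit F (limit.isLimit D) (fun j => (x j.as).pt) (by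
    rintro ⟨i⟩ ⟨j⟩ f
    obtain rfl : i = j := Discrete.eq_of_hom f
    exact (congrArg (fun f => F.map f _) (D.map_id _)).trans (by simp))
  exact ⟨⟨limit D, c⟩, fun i => ⟨⟨limit.π D ⟨i⟩, hc ⟨i⟩⟩⟩⟩

variable [HasPullbacks C]

/-- A `κ`-small family of objects of `C_F` comes from one slice. -/
theorem exists_lift_objects {ι : Type w} (hι : HasCardinalLT ι κ) (X : ι → CF F) :
    ∃ (z : Stage F) (k : ι → Over z.obj), ∀ i, Nonempty ((atStage z).obj (k i) ≅ X i) := by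
  choose E hE using fun i => (X i).exists_eq_toCF
  obtain ⟨z, hz⟩ := h.exists_stage_over_family hι fun i => (⟨(E i).base, (E i).pt⟩ : Stage F)
  refine ⟨z, fun i => (Over.pullback (Stage.Hom.map (hz i).some)).obj (E i).arr, fun i => ⟨?_⟩⟩
  exact (stageIso (hz i).some).app (E i).arr ≪≫ eqToIso (hE i)

/-- A map of `C_F` between objects of a slice comes from a map of the total category over the later
stage at which the base components of its numerator and its denominator agree. -/
theorem exists_lift_map {x : Stage F} {k l : Over x.obj}
    (φ : (atStage x).obj k ⟶ (atStage x).obj l) :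
    ∃ (y : Stage F) (p : y ⟶ x)
      (t : (sliceElt y).obj ((Over.pullback (Stage.Hom.map p)).obj k) ⟶ (sliceElt x).obj l),
      Elt.Hom.base t = Stage.Hom.map p ∧ (toCF F).map t = (toCF F).map (stageElt p k) ≫ φ := by
  have := h.hasFiniteLimits
  have := h.preservesFiniteLimits
  obtain ⟨Z, s, f, hs, hf⟩ := CF.exists_representative F (X := (sliceElt x).obj k)
    (Y := (sliceElt x).obj l) φ
  -- The two components on the base are equalized at a later stage.
  let sb : Z.base ⟶ x.obj := Elt.Hom.base s
  let fb : Z.base ⟶ x.obj := Elt.Hom.base f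
  have hpts : F.map sb Z.pt = F.map fb Z.pt := (Elt.Hom.map_pt s).trans (Elt.Hom.map_pt f).symm
  let e := equalizer.ι sb fb
  obtain ⟨c, hc, -⟩ := Types.unique_of_type_equalizer _ _
    (isLimitForkMapOfIsLimit F (equalizer.condition sb fb) (equalizerIsEqualizer _ _)) Z.pt hpts
  let y : Stage F := ⟨equalizer sb fb, c⟩
  have hpt : F.map (e ≫ sb) c = x.pt := by
    rw [functor_map_comp_apply]
    exact (congrArg _ hc).trans (Elt.Hom.map_pt s)
  let p : y ⟶ x := ⟨e ≫ sb, hpt⟩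
  obtain ⟨u, hu, hus⟩ := Elt.exists_cartesian_lift hs (stageElt p k) e rfl hc
  refine ⟨y, p, u ≫ f, ?_, ?_⟩
  · rw [Elt.comp_base, hu]
    exact (equalizer.condition sb fb).symm
  · rw [← hus, Functor.map_comp, Functor.map_comp, Category.assoc, hf]

/-- `κ`-small families of maps of `C_F` between objects of a slice come from maps at a later
stage. -/
theorem exists_lift_maps {x : Stage F} {ι : Type w} (hι : HasCardinalLT ι κ)
    {k l : ι → Over x.obj} (φ : ∀ i, (atStage x).obj (k i) ⟶ (atStage x).obj (l i)) :
    ∃ (y : Stage F) (p : y ⟶ x)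
      (g : ∀ i, (Over.pullback (Stage.Hom.map p)).obj (k i) ⟶
        (Over.pullback (Stage.Hom.map p)).obj (l i)),
      ∀ i, (atStage y).map (g i) ≫ (stageIso p).hom.app (l i) =
        (stageIso p).hom.app (k i) ≫ φ i := by
  obtain ⟨y, p, hp⟩ := h.exists_common_stage hι
    (fun i y p => ∃ (t : (sliceElt y).obj ((Over.pullback (Stage.Hom.map p)).obj (k i)) ⟶
        (sliceElt x).obj (l i)),
      Elt.Hom.base t = Stage.Hom.map p ∧ (toCF F).map t = (toCF F).map (stageElt p (k i)) ≫ φ i)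
    (by
      rintro i y z q p ⟨t, ht, htφ⟩
      obtain ⟨u, hu, hup⟩ := stageElt_comp q p (k i)
      refine ⟨u ≫ t, ?_, ?_⟩
      · rw [Elt.comp_base, hu, ht]
        rfl
      · rw [Functor.map_comp, htφ, ← hup, Functor.map_comp, Category.assoc])
    fun i => h.exists_lift_map (φ i)
  choose t ht htφ using hp
  choose g hg hgt using fun i => Elt.exists_cartesian_lift (cartesian_stageElt p (l i)) (t i) (𝟙 _)
    ((Category.id_comp _).trans (ht i).symm) (by simp)
  refine ⟨y, p, fun i => Over.homMk (Elt.Hom.top (g i)) ?_, fun i => ?_⟩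
  · have := Elt.Hom.comm (g i)
    rw [hg] at this
    exact this.trans (Category.comp_id _)
  · rw [stageIso_hom_app, stageIso_hom_app, ← htφ i, ← hgt i, Functor.map_comp]
    congr 1
    refine congrArg (toCF F).map (Elt.hom_ext (hg i).symm rfl)

/-- Maps of a slice that become equal in `C_F` become equal at a later stage. -/
theorem exists_eq_stage {x : Stage F} {k l : Over x.obj} (f g : k ⟶ l)
    (hfg : (atStage x).map f = (atStage x).map g) :
    ∃ (y : Stage F) (p : y ⟶ x),
      (Over.pullback (Stage.Hom.map p)).map f = (Over.pullback (Stage.Hom.map p)).map g := by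
  have := h.hasFiniteLimits
  have := h.preservesFiniteLimits
  obtain ⟨Z, s, hs, hsf⟩ := (CF.map_eq_iff F _ _).1 hfg
  refine ⟨⟨Z.base, Z.pt⟩, ⟨Elt.Hom.base s, Elt.Hom.map_pt s⟩, ?_⟩
  obtain ⟨u, -, hus⟩ := Elt.exists_cartesian_lift hs (stageElt (y := ⟨Z.base, Z.pt⟩)
    ⟨Elt.Hom.base s, Elt.Hom.map_pt s⟩ k) (𝟙 _) (Category.id_comp _) (by simp)
  have h₁ := congrArg Elt.Hom.top (congrArg (u ≫ ·) hsf)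
  dsimp only at h₁
  rw [← Category.assoc, ← Category.assoc, hus] at h₁
  ext
  refine pullback.hom_ext ?_ ?_
  · refine (pullback.lift_fst _ _ _).trans (Eq.trans ?_ (pullback.lift_fst _ _ _).symm)
    exact h₁
  · exact (pullback.lift_snd _ _ _).trans (pullback.lift_snd _ _ _).symm

omit h in
theorem pullback_map_eq {x y z : Stage F} (q : z ⟶ y) (p : y ⟶ x) {k l : Over x.obj}
    {f g : k ⟶ l}
    (hfg : (Over.pullback (Stage.Hom.map p)).map f = (Over.pullback (Stage.Hom.map p)).map g) :
    (Over.pullback (Stage.Hom.map (q ≫ p))).map f =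
      (Over.pullback (Stage.Hom.map (q ≫ p))).map g := by
  change (Over.pullback (Stage.Hom.map q ≫ Stage.Hom.map p)).map f =
    (Over.pullback (Stage.Hom.map q ≫ Stage.Hom.map p)).map g
  rw [← cancel_mono ((Over.pullbackComp (Stage.Hom.map q) (Stage.Hom.map p)).hom.app l),
    NatTrans.naturality, NatTrans.naturality, Functor.comp_map, Functor.comp_map, hfg]

/-- `κ`-small families of equalities of `C_F` between maps of a slice hold at a later stage. -/
theorem exists_eq_stages {x : Stage F} {ι : Type w} (hι : HasCardinalLT ι κ)
    {k l : ι → Over x.obj} (f g : ∀ i, k i ⟶ l i)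
    (hfg : ∀ i, (atStage x).map (f i) = (atStage x).map (g i)) :
    ∃ (y : Stage F) (p : y ⟶ x), ∀ i,
      (Over.pullback (Stage.Hom.map p)).map (f i) = (Over.pullback (Stage.Hom.map p)).map (g i) :=
  h.exists_common_stage hι
    (fun i _ p => (Over.pullback (Stage.Hom.map p)).map (f i) =
      (Over.pullback (Stage.Hom.map p)).map (g i))
    (fun _ _ _ q p => pullback_map_eq q p) fun i => h.exists_eq_stage (f i) (g i) (hfg i)

/-- Every `κ`-small diagram in `C_F` comes from a diagram in a slice. -/
theorem exists_lift_diagram {J : Type w} [SmallCategory J] (hJ : HasCardinalLT (Arrow J) κ)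
    (D : J ⥤ CF F) : ∃ (x : Stage F) (D' : J ⥤ Over x.obj), Nonempty (D' ⋙ atStage x ≅ D) := by
  have hJ' := hasCardinalLT_of_arrow hJ
  obtain ⟨x, k, hk⟩ := h.exists_lift_objects hJ' D.obj
  let e := fun j => (hk j).some
  obtain ⟨y, p, g', hg'⟩ := h.exists_lift_maps hJ
    (k := fun a => k a.left) (l := fun a => k a.right)
    fun a => (e a.left).hom ≫ D.map a.hom ≫ (e a.right).inv
  let g : ∀ {i j : J} (_ : i ⟶ j),
      (Over.pullback (Stage.Hom.map p)).obj (k i) ⟶ (Over.pullback (Stage.Hom.map p)).obj (k j) :=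
    fun f => g' (Arrow.mk f)
  let d : ∀ j, (atStage y).obj ((Over.pullback (Stage.Hom.map p)).obj (k j)) ≅ D.obj j := fun j =>
    (stageIso p).app (k j) ≪≫ e j
  have hg : ∀ {i j : J} (f : i ⟶ j), (atStage y).map (g f) = (d i).hom ≫ D.map f ≫ (d j).inv := by
    intro i j f
    have := hg' (Arrow.mk f)
    rw [← cancel_mono ((stageIso p).hom.app (k j))]
    refine this.trans ?_
    simp [d]
  let ι := J ⊕ (Σ (i j l : J), (i ⟶ j) × (j ⟶ l))
  have hι : HasCardinalLT ι κ := by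
    rw [hasCardinalLT_sum_iff _ _ _ h.aleph0_le]
    refine ⟨hJ', (hasCardinalLT_prod h.aleph0_le hJ hJ).of_injective
      (fun a => (Arrow.mk a.2.2.2.1, Arrow.mk a.2.2.2.2)) ?_⟩
    rintro ⟨i, j, l, f, f'⟩ ⟨i', j', l', u, u'⟩ huv
    obtain ⟨h₁, h₂⟩ := Prod.mk.inj huv
    cases h₁
    cases h₂
    rfl
  obtain ⟨z, q, hq⟩ := h.exists_common_stage hι
    (fun (a : ι) _ q => match a with
      | .inl j =>
        (Over.pullback (Stage.Hom.map q)).map (g (𝟙 j)) =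
          (Over.pullback (Stage.Hom.map q)).map (𝟙 _)
      | .inr ⟨_, _, _, f, f'⟩ =>
        (Over.pullback (Stage.Hom.map q)).map (g f ≫ g f') =
          (Over.pullback (Stage.Hom.map q)).map (g (f ≫ f')))
    (by
      rintro (j | ⟨i, j, l, f, f'⟩) y z q p hp
      · exact pullback_map_eq q p hp
      · exact pullback_map_eq q p hp)
    (by
      rintro (j | ⟨i, j, l, f, f'⟩)
      · exact h.exists_eq_stage _ _ ((hg _).trans (by
          rw [CategoryTheory.Functor.map_id, Category.id_comp, Iso.hom_inv_id]
          exact ((atStage y).map_id _).symm))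
      · exact h.exists_eq_stage _ _ (by rw [Functor.map_comp, hg, hg, hg]; simp))
  refine ⟨z, { obj := fun j => (Over.pullback (Stage.Hom.map q)).obj
                 ((Over.pullback (Stage.Hom.map p)).obj (k j))
               map := fun f => (Over.pullback (Stage.Hom.map q)).map (g f)
               map_id := fun j => (hq (.inl j)).trans (CategoryTheory.Functor.map_id _ _)
               map_comp := fun f f' => (hq (.inr ⟨_, _, _, f, f'⟩)).symm.trans
                (Functor.map_comp _ _ _) },
    ⟨NatIso.ofComponents (fun j => (stageIso q).app _ ≪≫ d j) fun {i j} f => ?_⟩⟩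
  have h₁ := (stageIso q).hom.naturality (g f)
  rw [hg] at h₁
  have h₂ := congrArg (· ≫ (d j).hom) h₁
  simpa using h₂

end IsLexPair

/-! ### Monomorphisms and extremal epimorphic families at a stage -/

section

variable {C : Type u} [Category.{v} C]

theorem ExtremalEpiFamily.of_iso {X X' : C} {ι : Type*} {Y Y' : ι → C} {f : ∀ i, Y i ⟶ X}
    {f' : ∀ i, Y' i ⟶ X'} (hf : ExtremalEpiFamily Y f) (e : X ≅ X') (d : ∀ i, Y i ≅ Y' i)
    (hw : ∀ i, f i ≫ e.hom = (d i).hom ≫ f' i) : ExtremalEpiFamily Y' f' :=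
  (hf.comp_isIso e.hom).of_factors fun i => ⟨i, (d i).hom, (hw i).symm⟩

theorem mono_of_isPullback {P X Y : C} {a b : P ⟶ X} {m : X ⟶ Y} (hp : IsPullback a b m m)
    (hab : a = b) : Mono m :=
  ⟨fun s t hst => (hp.lift_fst s t hst).symm.trans
    ((congrArg (hp.lift s t hst ≫ ·) hab).trans (hp.lift_snd s t hst))⟩

theorem Over.isIso_of_isIso_left {x : C} {k l : Over x} (f : k ⟶ l) (hf : IsIso f.left) :
    IsIso f :=
  have : IsIso ((Over.forget x).map f) := hf
  isIso_of_reflects_iso f (Over.forget x)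

variable [HasPullbacks C]

/-- The restrictions of a map `f` of a slice are pullbacks of `f`. -/
theorem isPullback_pullback_map {x y : C} (p : y ⟶ x) {k l : Over x} (f : k ⟶ l) :
    IsPullback (pullback.fst k.hom p) ((Over.pullback p).map f).left f.left
      (pullback.fst l.hom p) := by
  refine IsPullback.of_bot (h₂₁ := pullback.fst l.hom p) (v₂₁ := pullback.snd l.hom p)
    (v₂₂ := l.hom) (h₃₁ := p) ?_ ?_ (IsPullback.of_hasPullback _ _)
  · have h₁ : ((Over.pullback p).map f).left ≫ pullback.snd l.hom p = pullback.snd k.hom p :=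
      pullback.lift_snd _ _ _
    rw [h₁, Over.w f]
    exact IsPullback.of_hasPullback _ _
  · exact (pullback.lift_fst _ _ _).symm

theorem HasStableImages.extremal_pullback {κ : Cardinal.{w}} (hS : HasStableImages κ C) {x y : C}
    (p : y ⟶ x) {ι : Type w} (hι : HasCardinalLT ι κ) {k : ι → Over x} {l : Over x}
    {f : ∀ i, k i ⟶ l} (hf : ExtremalEpiFamily (fun i => (k i).left) (fun i => (f i).left)) :
    ExtremalEpiFamily (fun i => ((Over.pullback p).obj (k i)).left)
      (fun i => ((Over.pullback p).map (f i)).left) :=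
  hS.stable _ ι hι _ _ hf _ _ _ _ _ fun i => isPullback_pullback_map p (f i)

variable {F : C ⥤ Type w}

theorem isIso_pullback_comp {x y z : Stage F} (q : z ⟶ y) (p : y ⟶ x) {k l : Over x.obj}
    (f : k ⟶ l) : IsIso ((Over.pullback (Stage.Hom.map (q ≫ p))).map f) ↔
      IsIso ((Over.pullback (Stage.Hom.map q)).map ((Over.pullback (Stage.Hom.map p)).map f)) :=
  NatIso.isIso_map_iff (Over.pullbackComp (Stage.Hom.map q) (Stage.Hom.map p)) f

theorem isIso_atStage_pullback {x y : Stage F} (p : y ⟶ x) {k l : Over x.obj}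
    (f : k ⟶ l) : IsIso ((atStage y).map ((Over.pullback (Stage.Hom.map p)).map f)) ↔
      IsIso ((atStage x).map f) :=
  NatIso.isIso_map_iff (stageIso p) f

end

namespace IsLexPair

variable {C : Type u} [Category.{v} C] {κ : Cardinal.{w}} {F : C ⥤ Type w} (h : IsLexPair κ F)
include h

theorem isPullback_atStage {x : Stage F} {P X Y Z : Over x.obj} {fst : P ⟶ X} {snd : P ⟶ Y}
    {f : X ⟶ Z} {g : Y ⟶ Z} (hp : IsPullback fst.left snd.left f.left g.left) :
    IsPullback ((atStage x).map fst) ((atStage x).map snd) ((atStage x).map f)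
      ((atStage x).map g) :=
  h.isPullback_toCF (P := (sliceElt x).obj P) (X := (sliceElt x).obj X) (Y := (sliceElt x).obj Y)
    (Z := (sliceElt x).obj Z) (fst := (sliceElt x).map fst) (snd := (sliceElt x).map snd)
    (f := (sliceElt x).map f) (g := (sliceElt x).map g)
    (IsPullback.of_vert_isIso (f := 𝟙 x.obj) (g := 𝟙 x.obj) ⟨rfl⟩) hp

theorem mono_atStage {x : Stage F} {k l : Over x.obj} (m : k ⟶ l) (hm : Mono m.left) :
    Mono ((atStage x).map m) :=
  mono_of_isPullback (h.isPullback_atStage (fst := 𝟙 k) (snd := 𝟙 k) (f := m) (g := m)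
    (IsKernelPair.id_of_mono m.left)) rfl

variable [HasPullbacks C]

theorem exists_mono_stage {x : Stage F} {k l : Over x.obj} (m : k ⟶ l)
    (hm : Mono ((atStage x).map m)) :
    ∃ (y : Stage F) (p : y ⟶ x), Mono ((Over.pullback (Stage.Hom.map p)).map m) := by
  have hp := IsPullback.of_hasPullback m m
  obtain ⟨y, p, hpq⟩ := h.exists_eq_stage (pullback.fst m m) (pullback.snd m m) (by
    rw [← cancel_mono ((atStage x).map m), ← Functor.map_comp, ← Functor.map_comp, hp.w])
  exact ⟨y, p, mono_of_isPullback (hp.map (Over.pullback (Stage.Hom.map p))) hpq⟩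

/-- A map of a slice that becomes invertible in `C_F` is invertible at a later stage. -/
theorem exists_isIso_stage {x : Stage F} {k l : Over x.obj} (f : k ⟶ l)
    (hf : IsIso ((atStage x).map f)) :
    ∃ (y : Stage F) (p : y ⟶ x), IsIso ((Over.pullback (Stage.Hom.map p)).map f) := by
  obtain ⟨y, p, hp⟩ := h.exists_mono_stage f inferInstance
  obtain ⟨z, q, g, hg⟩ := h.exists_lift_maps (x := y) (hasCardinalLT_punit h.aleph0_le)
    (fun _ => (stageIso p).hom.app l ≫ inv ((atStage x).map f) ≫ (stageIso p).inv.app k)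
  have hgf : (atStage z).map (g ⟨⟩ ≫ (Over.pullback (Stage.Hom.map q)).map
      ((Over.pullback (Stage.Hom.map p)).map f)) = (atStage z).map (𝟙 _) := by
    have h₁ := (stageIso q).hom.naturality ((Over.pullback (Stage.Hom.map p)).map f)
    have h₂ := (stageIso p).hom.naturality f
    have h₃ := hg ⟨⟩
    rw [← cancel_mono ((stageIso q).hom.app _), Functor.map_comp, Category.assoc]
    refine (congrArg (_ ≫ ·) h₁).trans ?_
    rw [← Category.assoc, h₃]
    have h₄ : (stageIso p).inv.app k ≫ (atStage y).map ((Over.pullback (Stage.Hom.map p)).map f) =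
        (atStage x).map f ≫ (stageIso p).inv.app l := ((stageIso p).inv.naturality f).symm
    simp only [Category.assoc]
    rw [h₄, IsIso.inv_hom_id_assoc, Iso.hom_inv_id_app]
    refine (Category.comp_id _).trans ?_
    rw [CategoryTheory.Functor.map_id]
    exact (Category.id_comp _).symm
  obtain ⟨t, r, hr⟩ := h.exists_eq_stage _ _ hgf
  refine ⟨t, r ≫ q ≫ p, ?_⟩
  rw [isIso_pullback_comp]
  have : Mono ((Over.pullback (Stage.Hom.map r)).map ((Over.pullback (Stage.Hom.map q)).map
    ((Over.pullback (Stage.Hom.map p)).map f))) := inferInstance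
  have h₅ : IsIso ((Over.pullback (Stage.Hom.map r)).map ((Over.pullback (Stage.Hom.map q)).map
    ((Over.pullback (Stage.Hom.map p)).map f))) := by
    refine isIso_of_mono_of_section _ this ((Over.pullback (Stage.Hom.map r)).map (g ⟨⟩)) ?_
    rw [← Functor.map_comp, hr, CategoryTheory.Functor.map_id]
  exact (NatIso.isIso_map_iff (Functor.isoWhiskerRight
    (Over.pullbackComp (Stage.Hom.map q) (Stage.Hom.map p)) (Over.pullback (Stage.Hom.map r))) f).2
    h₅

omit h in
theorem isIso_pullback_of_isIso {x y z : Stage F} (q : z ⟶ y) (p : y ⟶ x) {k l : Over x.obj}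
    {f : k ⟶ l} (hf : IsIso ((Over.pullback (Stage.Hom.map p)).map f)) :
    IsIso ((Over.pullback (Stage.Hom.map (q ≫ p))).map f) := by
  rw [isIso_pullback_comp]
  infer_instance

omit h in
theorem atStage_map_pullback {x y : Stage F} (p : y ⟶ x) {k l : Over x.obj} (f : k ⟶ l) :
    (atStage y).map ((Over.pullback (Stage.Hom.map p)).map f) =
      (stageIso p).hom.app k ≫ (atStage x).map f ≫ (stageIso p).inv.app l := by
  have h₁ := (stageIso p).hom.naturality f
  rw [← Category.assoc, ← h₁, Category.assoc, Iso.hom_inv_id_app]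
  exact (Category.comp_id _).symm

section Extremal

variable (hS : HasStableImages κ C)
include hS

/-- A monomorphism of a slice through which an extremal epimorphic family factors in `C_F` is
invertible in `C_F`, because the factorizations exist at a later stage. -/
theorem isIso_of_lift_of_mono {x : Stage F} {ι : Type w} (hι : HasCardinalLT ι κ)
    {k : ι → Over x.obj} {l z : Over x.obj} {f : ∀ i, k i ⟶ l}
    (hf : ExtremalEpiFamily (fun i => (k i).left) (fun i => (f i).left)) (n : z ⟶ l) [Mono n]
    (G : ∀ i, (atStage x).obj (k i) ⟶ (atStage x).obj z)
    (hG : ∀ i, G i ≫ (atStage x).map n = (atStage x).map (f i)) : IsIso ((atStage x).map n) := by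
  obtain ⟨y, p, γ, hγ⟩ := h.exists_lift_maps hι G
  obtain ⟨t, q, hq⟩ := h.exists_eq_stages hι
    (fun i => γ i ≫ (Over.pullback (Stage.Hom.map p)).map n)
    (fun i => (Over.pullback (Stage.Hom.map p)).map (f i)) fun i => by
      rw [Functor.map_comp, atStage_map_pullback, atStage_map_pullback, ← Category.assoc, hγ,
        ← hG i]
      simp only [Category.assoc]
  have hq' := hS.extremal_pullback (Stage.Hom.map q) hι
    (hS.extremal_pullback (Stage.Hom.map p) hι hf)
  rw [← isIso_atStage_pullback p, ← isIso_atStage_pullback q]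
  have : IsIso ((Over.pullback (Stage.Hom.map q)).map
      ((Over.pullback (Stage.Hom.map p)).map n)) := by
    refine Over.isIso_of_isIso_left _ (hq' _ inferInstance fun i => ?_)
    refine ⟨((Over.pullback (Stage.Hom.map q)).map (γ i)).left, ?_⟩
    rw [← Over.comp_left, ← Functor.map_comp, hq]
  infer_instance

/-- The same for a monomorphism of `C_F` between objects of a slice, which comes from a monomorphism
at a later stage. -/
theorem isIso_of_lift {x : Stage F} {ι : Type w} (hι : HasCardinalLT ι κ)
    {k : ι → Over x.obj} {l z : Over x.obj} {f : ∀ i, k i ⟶ l}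
    (hf : ExtremalEpiFamily (fun i => (k i).left) (fun i => (f i).left))
    (m : (atStage x).obj z ⟶ (atStage x).obj l) [Mono m]
    (G : ∀ i, (atStage x).obj (k i) ⟶ (atStage x).obj z)
    (hG : ∀ i, G i ≫ m = (atStage x).map (f i)) : IsIso m := by
  obtain ⟨y, p, μ, hμ⟩ := h.exists_lift_maps (x := x) (hasCardinalLT_punit h.aleph0_le)
    (fun _ => m)
  have hμ' : (atStage y).map (μ ⟨⟩) =
      (stageIso p).hom.app z ≫ m ≫ (stageIso p).inv.app l := by
    have := congrArg (· ≫ (stageIso p).inv.app l) (hμ ⟨⟩)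
    simp only [Category.assoc, Iso.hom_inv_id_app] at this
    exact (Category.comp_id _).symm.trans this
  have hmono : Mono ((atStage y).map (μ ⟨⟩)) := by rw [hμ']; infer_instance
  obtain ⟨t, q, hq⟩ := h.exists_mono_stage _ hmono
  have hiso := h.isIso_of_lift_of_mono hS hι (hS.extremal_pullback (Stage.Hom.map q) hι
    (hS.extremal_pullback (Stage.Hom.map p) hι hf))
    ((Over.pullback (Stage.Hom.map q)).map (μ ⟨⟩))
    (fun i => (stageIso q).hom.app _ ≫ ((stageIso p).hom.app _ ≫ G i ≫ (stageIso p).inv.app _) ≫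
      (stageIso q).inv.app _) fun i => by
      rw [atStage_map_pullback, atStage_map_pullback, atStage_map_pullback, hμ', ← hG i]
      simp only [Category.assoc]
      rw [Iso.inv_hom_id_app_assoc, Iso.inv_hom_id_app_assoc]
  rw [isIso_atStage_pullback, hμ'] at hiso
  have h₁ : IsIso (m ≫ (stageIso p).inv.app l) :=
    IsIso.of_isIso_comp_left ((stageIso p).hom.app z) _
  exact IsIso.of_isIso_comp_right _ ((stageIso p).inv.app l)

/-- The maps `C/x ⥤ C_F` preserve `κ`-small extremal epimorphic families. -/
theorem extremal_atStage {x : Stage F} {ι : Type w} (hι : HasCardinalLT ι κ)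
    {k : ι → Over x.obj} {l : Over x.obj} {f : ∀ i, k i ⟶ l}
    (hf : ExtremalEpiFamily (fun i => (k i).left) (fun i => (f i).left)) :
    ExtremalEpiFamily (fun i => (atStage x).obj (k i)) (fun i => (atStage x).map (f i)) := by
  intro Z m hm hZ
  choose G hG using hZ
  obtain ⟨z, k₀, hk₀⟩ := h.exists_lift_objects (hasCardinalLT_punit h.aleph0_le) fun _ => Z
  obtain ⟨y, hy⟩ := h.exists_stage_over_family (ι := ULift Bool)
    (hasCardinalLT_of_finite _ _ h.aleph0_le) fun i => if i.down then x else z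
  obtain ⟨p⟩ : Nonempty (y ⟶ x) := hy ⟨true⟩
  obtain ⟨r⟩ : Nonempty (y ⟶ z) := hy ⟨false⟩
  let e : (atStage y).obj ((Over.pullback (Stage.Hom.map r)).obj (k₀ ⟨⟩)) ≅ Z :=
    (stageIso r).app _ ≪≫ (hk₀ ⟨⟩).some
  have hiso := h.isIso_of_lift hS hι (hS.extremal_pullback (Stage.Hom.map p) hι hf)
    (e.hom ≫ m ≫ (stageIso p).inv.app l)
    (fun i => (stageIso p).hom.app _ ≫ G i ≫ e.inv) fun i => by
      rw [atStage_map_pullback, ← show G i ≫ m = (atStage x).map (f i) from hG i]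
      simp
  have h₁ : IsIso (m ≫ (stageIso p).inv.app l) := IsIso.of_isIso_comp_left e.hom _
  exact IsIso.of_isIso_comp_right _ ((stageIso p).inv.app l)

/-- A `κ`-small family of maps of a slice that becomes extremal epimorphic in `C_F` is extremal
epimorphic at a later stage. -/
theorem exists_extremal_stage {x : Stage F} {ι : Type w} (hι : HasCardinalLT ι κ)
    {k : ι → Over x.obj} {l : Over x.obj} {f : ∀ i, k i ⟶ l}
    (hf : ExtremalEpiFamily (fun i => (atStage x).obj (k i)) (fun i => (atStage x).map (f i))) :
    ∃ (y : Stage F) (p : y ⟶ x),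
      ExtremalEpiFamily (fun i => ((Over.pullback (Stage.Hom.map p)).obj (k i)).left)
        (fun i => ((Over.pullback (Stage.Hom.map p)).map (f i)).left) := by
  obtain ⟨I, m, g, hm, hg, hge⟩ := hS.image l.left ι hι _ fun i => (f i).left
  let I' : Over x.obj := Over.mk (m ≫ l.hom)
  let m' : I' ⟶ l := Over.homMk m
  let g' : ∀ i, k i ⟶ I' := fun i => Over.homMk (g i) (by
    change g i ≫ m ≫ l.hom = _
    rw [← Category.assoc, hg, Over.w])
  have hfg : ∀ i, g' i ≫ m' = f i := fun i => by
    ext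
    exact hg i
  have hiso : IsIso ((atStage x).map m') := hf _ (h.mono_atStage m' hm) fun i =>
    ⟨(atStage x).map (g' i), by rw [← Functor.map_comp, hfg]⟩
  obtain ⟨y, p, hp⟩ := h.exists_isIso_stage m' hiso
  refine ⟨y, p, ?_⟩
  have h₁ := hS.extremal_pullback (Stage.Hom.map p) hι (f := g') hge
  have h₂ : IsIso ((Over.pullback (Stage.Hom.map p)).map m').left :=
    inferInstanceAs (IsIso ((Over.forget _).map ((Over.pullback (Stage.Hom.map p)).map m')))
  refine (h₁.comp_isIso ((Over.pullback (Stage.Hom.map p)).map m').left).of_factors fun i =>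
    ⟨i, 𝟙 _, ?_⟩
  rw [← Over.comp_left, ← Functor.map_comp, hfg, Category.id_comp]

omit h in
theorem extremal_pullback_comp {x y z : Stage F} (q : z ⟶ y) (p : y ⟶ x) {ι : Type w}
    (hι : HasCardinalLT ι κ) {k : ι → Over x.obj} {l : Over x.obj} {f : ∀ i, k i ⟶ l}
    (hf : ExtremalEpiFamily (fun i => ((Over.pullback (Stage.Hom.map p)).obj (k i)).left)
        (fun i => ((Over.pullback (Stage.Hom.map p)).map (f i)).left)) :
    ExtremalEpiFamily (fun i => ((Over.pullback (Stage.Hom.map (q ≫ p))).obj (k i)).left)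
        (fun i => ((Over.pullback (Stage.Hom.map (q ≫ p))).map (f i)).left) := by
  let c := Functor.isoWhiskerRight (Over.pullbackComp (Stage.Hom.map q) (Stage.Hom.map p))
    (Over.forget _)
  exact (hS.extremal_pullback (Stage.Hom.map q) hι hf).of_iso (c.symm.app l)
    (fun i => c.symm.app (k i)) fun i => c.symm.hom.naturality (f i)

end Extremal

end IsLexPair

/-! ### Coproducts and coherent functors -/

section

variable {κ : Cardinal.{w}} {D : Type u} [Category.{v} D]

/-- An extremal epimorphic family of pairwise disjoint monomorphisms is a disjoint coproduct. -/
theorem HasStableImages.coproductDisjoint (h : HasStableImages κ D) {X : D} {ι : Type w}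
    (hι : HasCardinalLT ι κ) {Y : ι → D} {f : ∀ i, Y i ⟶ X} (hf : ExtremalEpiFamily Y f)
    (hm : ∀ i, Mono (f i))
    (hd : ∀ i j, i ≠ j → ∀ {Z : D} (a : Z ⟶ Y i) (b : Z ⟶ Y j), a ≫ f i = b ≫ f j →
      Nonempty (IsInitial Z)) : HasCoproduct Y ∧ CoproductDisjoint Y := by
  have := h.hasFiniteLimits
  obtain ⟨hc⟩ := h.isColimit_of_disjoint hι hf hm hd
  have : ∀ i, Mono ((Cofan.mk X f).inj i) := hm
  exact ⟨⟨_, hc⟩, CoproductDisjoint.of_cofan hc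
    (fun {i j} _ => PullbackCone.mk _ _ (pullback.condition (f := f i) (g := f j)))
    (fun {i j} _ => pullbackIsPullback (f i) (f j))
    (fun {i j} hij => (hd i j hij _ _ pullback.condition).some)⟩

/-- Coherent functors are the functors preserving `κ`-small limits and `κ`-small extremal epimorphic
families. -/
theorem IsCoherentFunctor.of_extremal {E : Type u'} [Category.{v'} E] {G : D ⥤ E}
    (hκ : Cardinal.aleph0 ≤ κ) (hD : HasStableImages κ D) (hE : HasStableImages κ E)
    (hlex : IsLexFunctor κ G)
    (hG : ∀ (X : D) (ι : Type w), HasCardinalLT ι κ → ∀ (Y : ι → D) (f : ∀ i, Y i ⟶ X),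
      ExtremalEpiFamily Y f → ExtremalEpiFamily (fun i => G.obj (Y i)) (fun i => G.map (f i))) :
    IsCoherentFunctor κ κ G where
  lex := hlex
  effectiveEpi X Y f hf := (hE.effectiveEpi_iff hκ _).2
    (hG _ _ (hasCardinalLT_punit hκ) _ _ ((hD.effectiveEpi_iff hκ _).1 hf))
  union X ι hι Y u hu U m hU := by
    have := hD.hasFiniteLimits
    have := hlex.preservesFiniteLimits hκ
    obtain ⟨hm, g, hg, hge⟩ := hD.isUnion_iff.1 hU
    exact hE.isUnion_iff.2 ⟨inferInstance, fun i => G.map (g i),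
      fun i => by rw [← Functor.map_comp, hg], hG _ ι hι _ _ hge⟩

end

/-! ### Limits, images and coproducts in `C_F` -/

namespace IsLexPair

variable {C : Type u} [Category.{v} C] {κ : Cardinal.{w}} {F : C ⥤ Type w} (h : IsLexPair κ F)
include h

theorem lexCategory_CF : IsLexCategory κ (CF F) := by
  intro J _ hJ
  have := h.hasFiniteLimits
  have := h.lexCategory J hJ
  have := h.lexFunctor J hJ
  have := h.lexFunctor_toCF J hJ
  refine ⟨fun D => ?_⟩
  obtain ⟨x, D', ⟨e⟩⟩ := h.exists_lift_diagram hJ D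
  have := Elt.hasLimit (D' ⋙ sliceElt x)
  have : HasLimit (D' ⋙ atStage x) :=
    inferInstanceAs (HasLimit ((D' ⋙ sliceElt x) ⋙ toCF F))
  exact hasLimit_of_iso e

/-- The base component of `φ_F` is constant with value the terminal object, and its other
component is the identity; both preserve limits. -/
theorem lexFunctor_phi {one : C} (hone : IsTerminal one) (pt : F.obj one) :
    IsLexFunctor κ (phi F hone pt) := by
  intro J _ hJ
  have := h.lexFunctor J hJ
  have := h.lexFunctor_toCF J hJ
  let G : C ⥤ Elt F := toOverTerminal hone ⋙ sliceElt ⟨one, pt⟩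
  have : PreservesLimitsOfShape J G := ⟨⟨fun {c} hc => Elt.isLimit_of_components
    ⟨{ lift := fun s => hone.from _
       fac := fun s j => hone.hom_ext _ _
       uniq := fun s m _ => hone.hom_ext _ _ }⟩ ⟨hc⟩⟩⟩
  exact inferInstanceAs (PreservesLimitsOfShape J (G ⋙ toCF F))

variable [HasPullbacks C]

/-- Every `κ`-small family of maps of `C_F` with common codomain comes from a slice. -/
theorem exists_lift_sink {ι : Type w} (hι : HasCardinalLT ι κ) {X : CF F} {Y : ι → CF F}
    (φ : ∀ i, Y i ⟶ X) : ∃ (x : Stage F) (l : Over x.obj) (k : ι → Over x.obj)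
      (f : ∀ i, k i ⟶ l) (e : (atStage x).obj l ≅ X) (d : ∀ i, (atStage x).obj (k i) ≅ Y i),
      ∀ i, (atStage x).map (f i) ≫ e.hom = (d i).hom ≫ φ i := by
  have hJ : HasCardinalLT (Arrow (WidePullbackShape ι)) κ :=
    hasCardinalLT_arrow_of_thin h.aleph0_le _
      ((hasCardinalLT_option_iff _ _ h.aleph0_le).2 hι)
  obtain ⟨x, D', ⟨e⟩⟩ := h.exists_lift_diagram hJ (WidePullbackShape.wideCospan X Y φ)
  exact ⟨x, D'.obj none, fun i => D'.obj (some i),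
    fun i => D'.map (WidePullbackShape.Hom.term i), e.app none, fun i => e.app (some i),
    fun i => e.hom.naturality (WidePullbackShape.Hom.term i)⟩

theorem exists_lift_sink_and_map {ι : Type w} (hι : HasCardinalLT ι κ) {X X' : CF F} {Y : ι → CF F}
    (φ : ∀ i, Y i ⟶ X) (g : X' ⟶ X) : ∃ (x : Stage F) (l l' : Over x.obj) (k : ι → Over x.obj)
      (f : ∀ i, k i ⟶ l) (f' : l' ⟶ l) (e : (atStage x).obj l ≅ X) (e' : (atStage x).obj l' ≅ X')
      (d : ∀ i, (atStage x).obj (k i) ≅ Y i),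
      (∀ i, (atStage x).map (f i) ≫ e.hom = (d i).hom ≫ φ i) ∧
        (atStage x).map f' ≫ e.hom = e'.hom ≫ g := by
  obtain ⟨x, l, k, f, e, d, hw⟩ := h.exists_lift_sink (ι := Option ι)
    ((hasCardinalLT_option_iff _ _ h.aleph0_le).2 hι) (X := X)
    (Y := fun i => i.elim X' Y) fun i => match i with
      | none => g
      | some i => φ i
  exact ⟨x, l, k none, fun i => k (some i), fun i => f (some i), f none, e, d none,
    fun i => d (some i), fun i => hw (some i), hw none⟩

variable (hS : HasStableImages κ C)
include hS

/-- Images are those of a slice, and a pullback square of `C_F` comes from one of a slice. -/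
theorem hasStableImages_CF : HasStableImages κ (CF F) where
  hasFiniteLimits := h.lexCategory_CF.hasFiniteLimits h.aleph0_le
  image X ι hι Y φ := by
    obtain ⟨x, l, k, f, e, d, hw⟩ := h.exists_lift_sink hι φ
    obtain ⟨I, m, g, hm, hg, hge⟩ := hS.image l.left ι hι _ fun i => (f i).left
    let I' : Over x.obj := Over.mk (m ≫ l.hom)
    let m' : I' ⟶ l := Over.homMk m
    let g' : ∀ i, k i ⟶ I' := fun i => Over.homMk (g i) (by
      change g i ≫ m ≫ l.hom = _
      rw [← Category.assoc, hg, Over.w])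
    have hfg : ∀ i, g' i ≫ m' = f i := fun i => by
      ext
      exact hg i
    have := h.mono_atStage m' hm
    refine ⟨(atStage x).obj I', (atStage x).map m' ≫ e.hom,
      fun i => (d i).inv ≫ (atStage x).map (g' i), inferInstance, fun i => ?_, ?_⟩
    · rw [Category.assoc, ← Category.assoc _ _ e.hom, ← Functor.map_comp, hfg, hw,
        Iso.inv_hom_id_assoc]
    · refine (h.extremal_atStage hS hι (f := g') hge).of_iso (Iso.refl _) d fun i => ?_
      rw [Iso.hom_inv_id_assoc]
      exact Category.comp_id _
  stable X ι hι Y φ hφ X' g Y' φ' p hp := by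
    obtain ⟨x, l, l', k, f, f', e, e', d, hw, hw'⟩ := h.exists_lift_sink_and_map hι φ g
    have hf : ExtremalEpiFamily (fun i => (atStage x).obj (k i))
        (fun i => (atStage x).map (f i)) :=
      hφ.of_iso e.symm (fun i => (d i).symm) fun i => by
        rw [Iso.symm_hom, Iso.symm_hom, Iso.comp_inv_eq, Category.assoc, hw,
          Iso.inv_hom_id_assoc]
    obtain ⟨y, q, hq⟩ := h.exists_extremal_stage hS hι hf
    let P := Over.pullback (Stage.Hom.map q)
    let a : ∀ i, P.obj (k i) ⟶ P.obj l := fun i => P.map (f i)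
    let b : P.obj l' ⟶ P.obj l := P.map f'
    have hR := h.extremal_atStage hS hι (x := y) (f := fun i => pullback.snd (a i) b)
      (hS.stable _ ι hι _ _ hq _ b.left _ _ (fun i => (pullback.fst (a i) b).left) fun i =>
        (IsPullback.of_hasPullback (a i) b).map (Over.forget _))
    have h₁ : ∀ i, (atStage y).map (a i) ≫ (stageIso q).hom.app l ≫ e.hom =
        (stageIso q).hom.app (k i) ≫ (d i).hom ≫ φ i := fun i => by
      rw [atStage_map_pullback, ← hw i]
      simp only [Category.assoc]
      rw [Iso.inv_hom_id_app_assoc]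
    have h₂ : (atStage y).map b ≫ (stageIso q).hom.app l ≫ e.hom =
        (stageIso q).hom.app l' ≫ e'.hom ≫ g := by
      rw [atStage_map_pullback, ← hw']
      simp only [Category.assoc]
      rw [Iso.inv_hom_id_app_assoc]
    have h₃ : ∀ i, (atStage y).map (pullback.fst (a i) b) ≫ (atStage y).map (a i) =
        (atStage y).map (pullback.snd (a i) b) ≫ (atStage y).map b := fun i => by
      rw [← Functor.map_comp, ← Functor.map_comp, pullback.condition]
    refine (hR.comp_isIso ((stageIso q).hom.app l' ≫ e'.hom)).of_factors fun i =>
      ⟨i, (hp i).lift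
        ((atStage y).map (pullback.fst (a i) b) ≫ (stageIso q).hom.app _ ≫ (d i).hom)
        ((atStage y).map (pullback.snd (a i) b) ≫ (stageIso q).hom.app l' ≫ e'.hom) ?_,
        (hp i).lift_snd _ _ _⟩
    rw [Category.assoc, Category.assoc, Category.assoc, Category.assoc, ← h₁, ← h₂,
      ← Category.assoc, h₃, Category.assoc]

theorem extremal_phi {one : C} (hone : IsTerminal one) (pt : F.obj one) (X : C) (ι : Type w)
    (hι : HasCardinalLT ι κ) (Y : ι → C) (f : ∀ i, Y i ⟶ X) (hf : ExtremalEpiFamily Y f) :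
    ExtremalEpiFamily (fun i => (phi F hone pt).obj (Y i)) (fun i => (phi F hone pt).map (f i)) :=
  h.extremal_atStage hS hι (x := ⟨one, pt⟩) (f := fun i => (toOverTerminal hone).map (f i)) hf

theorem isCoherentFunctor_phi {one : C} (hone : IsTerminal one) (pt : F.obj one) :
    IsCoherentFunctor κ κ (phi F hone pt) :=
  .of_extremal h.aleph0_le hS (h.hasStableImages_CF hS) (h.lexFunctor_phi hone pt)
    (h.extremal_phi hS hone pt)

theorem isInitial_atStage {x : Stage F} {k : Over x.obj} (hk : IsInitial k.left) :
    Nonempty (IsInitial ((atStage x).obj k)) :=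
  (h.hasStableImages_CF hS).isInitial_of_extremal (ι := PEmpty)
    (hasCardinalLT_of_finite _ _ h.aleph0_le)
    (h.extremal_atStage hS (ι := PEmpty) (hasCardinalLT_of_finite _ _ h.aleph0_le)
      (k := fun i => i.elim) (f := fun i => i.elim) (extremal_of_isInitial hk))

/-- Coproducts in `C_F` are those of a slice, which are disjoint covers. -/
theorem hasDisjointCoproducts_CF (hC : HasDisjointCoproducts κ C) :
    HasDisjointCoproducts κ (CF F) := by
  intro ι hι X
  have hCF := h.hasStableImages_CF hS
  obtain ⟨x, k, hk⟩ := h.exists_lift_objects hι X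
  obtain ⟨_, hdisj⟩ := hC ι hι fun i => (k i).left
  let c := Sigma.ι fun i => (k i).left
  have hc : IsColimit (Cofan.mk _ c) := coproductIsCoproduct _
  let l : Over x.obj := Over.mk (Sigma.desc fun i => (k i).hom)
  let f : ∀ i, k i ⟶ l := fun i => Over.homMk (c i) (Sigma.ι_desc _ _)
  have hf := h.extremal_atStage hS hι (f := f) (extremal_of_isColimit hc)
  have hm : ∀ i, Mono ((atStage x).map (f i)) := fun i =>
    h.mono_atStage _ (inferInstanceAs (Mono (c i)))
  refine hCF.coproductDisjoint hι (f := fun i => (hk i).some.inv ≫ (atStage x).map (f i))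
    (hf.of_iso (Iso.refl _) (fun i => (hk i).some) fun i => by
      rw [Iso.hom_inv_id_assoc]
      exact Category.comp_id _) (fun i => inferInstance) fun i j hij Z a b hab => ?_
  obtain ⟨hP⟩ := h.isInitial_atStage hS (k := pullback (f i) (f j))
    ((hdisj.nonempty_isInitial_of_ne hc hij _
      ((IsPullback.of_hasPullback (f i) (f j)).map (Over.forget _)).isLimit).some)
  have hpb := h.isPullback_atStage ((IsPullback.of_hasPullback (f i) (f j)).map (Over.forget _))
  exact hCF.isInitial_of_hom h.aleph0_le hP (hpb.lift (a ≫ (hk i).some.inv) (b ≫ (hk j).some.inv)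
    (by simpa only [Category.assoc] using hab))

end IsLexPair

/-! ### Cotrees in `C_F` -/

section

theorem isConnected_op_of_isBot {P : Type u} [Preorder P] {b : P} (hb : IsBot b) :
    IsConnected Pᵒᵖ := by
  have : IsConnected P := isConnected_of_isInitial P
    (IsInitial.ofUniqueHom (X := b) (fun x => homOfLE (hb x)) fun _ _ => Subsingleton.elim _ _)
  infer_instance

variable {T : Type w} [PartialOrder T]

/-- The inclusion of a set of nodes of a tree, as a diagram shape for cotrees. -/
abbrev nodeInclusion (A : Set T) : (A : Type w)ᵒᵖ ⥤ Tᵒᵖ :=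
  (Subtype.mono_coe (· ∈ A)).functor.op

/-- The cone with apex `t` over the predecessors of a node `t`. -/
def nodeCone (t : T) : Cone (nodeInclusion (Set.Iio t)) where
  pt := op t
  π := { app := fun s => (homOfLE (le_of_lt s.unop.2)).op
         naturality := fun _ _ _ => Subsingleton.elim _ _ }

theorem isConnected_Iio [OrderBot T] {t : T} (ht : Order.IsSuccLimit t) :
    IsConnected (Set.Iio t)ᵒᵖ :=
  isConnected_op_of_isBot (b := ⟨⊥, bot_lt_iff_ne_bot.2 ht.ne_bot⟩) fun _ => bot_le (α := T)

theorem isConnected_flag [OrderBot T] (b : Flag T) : IsConnected (b : Set T)ᵒᵖ :=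
  isConnected_op_of_isBot (b := ⟨⊥, b.bot_mem⟩) fun _ => bot_le (α := T)

end

namespace IsLexPair

variable {C : Type u} [Category.{v} C] {κ : Cardinal.{w}} {F : C ⥤ Type w} (h : IsLexPair κ F)
include h

/-- The maps `C/x ⥤ C_F` preserve `κ`-small connected limits. -/
theorem isLimit_atStage_mapCone {J : Type w} [SmallCategory J] [IsConnected J]
    (hJ : HasCardinalLT (Arrow J) κ) {x : Stage F} {D : J ⥤ Over x.obj} {c : Cone D}
    (hc : IsLimit c) : Nonempty (IsLimit ((atStage x).mapCone c)) := by
  have := h.lexFunctor J hJ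
  have hb : IsLimit ((Elt.baseFunctor F).mapCone ((sliceElt x).mapCone c)) := by
    let j₀ : J := Classical.arbitrary J
    have key : ∀ (s : Cone ((D ⋙ sliceElt x) ⋙ Elt.baseFunctor F)) (j : J),
        (show s.pt ⟶ x.obj from s.π.app j₀) = s.π.app j := fun s j =>
      nat_trans_from_is_connected (X := s.pt) (Y := x.obj)
        { app := fun j => s.π.app j
          naturality := fun i j f => s.π.naturality f } j₀ j
    exact { lift := fun s => s.π.app j₀
            fac := fun s j => (Category.comp_id _).trans (key s j)
            uniq := fun s m hm => (Category.comp_id _).symm.trans (hm j₀) }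
  obtain ⟨hl⟩ := Elt.isLimit_of_components (c := (sliceElt x).mapCone c) ⟨hb⟩
    ⟨isLimitOfPreserves (Over.forget x.obj) hc⟩
  exact h.isLimit_toCF_mapCone hJ hl

end IsLexPair

variable {C : Type w} [SmallCategory C] {κ : Cardinal.{w}} {F : C ⥤ Type w}

/-- The cotree condition for `C_F`. By the tree property a cotree with `κ`-small covers is a
`κ`-small diagram, so that it comes from a cotree of `C`. -/
theorem IsLexPair.extremal_cocomposition (hκ : IsWeaklyCompact κ) (hC : IsCoherentCategory κ κ C)
    (h : IsLexPair κ F) (K : Cotree κ (CF F))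
    (hK : ∀ t : K.T, ¬ IsMax t → HasCardinalLT (K.Next t) κ ∧
        ExtremalEpiFamily (fun s : K.Next t => K.at' s.1) (K.step t))
    (c : ∀ b : Flag K.T, Cone (K.branchDiagram b)) (hc : ∀ b, Nonempty (IsLimit (c b))) :
    ExtremalEpiFamily (fun b : Flag K.T => (c b).pt) (fun b => K.cocomposition b (c b)) := by
  have hS := hC.hasStableImages h.aleph0_le
  have := h.hasFiniteLimits
  have hT : HasCardinalLT K.T κ := K.hasCardinalLT_nodes hκ fun t ht => (hK t ht).1
  have hsub : ∀ A : Set K.T, HasCardinalLT (Arrow (A : Type w)ᵒᵖ) κ := fun A =>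
    hasCardinalLT_arrow_of_thin h.aleph0_le _
      ((hasCardinalLT_iff_of_equiv equivToOpposite.symm κ).2
        (hT.of_injective _ Subtype.val_injective))
  have hTop : HasCardinalLT (Arrow K.Tᵒᵖ) κ :=
    hasCardinalLT_arrow_of_thin h.aleph0_le _
      ((hasCardinalLT_iff_of_equiv equivToOpposite.symm κ).2 hT)
  obtain ⟨x, D, ⟨e⟩⟩ := h.exists_lift_diagram hTop K.obj
  -- At a limit node, the comparison map from the node to the limit of the chain below it in the
  -- slice becomes invertible in `C_F`.
  have hL : ∀ t : K.T, Order.IsSuccLimit t → ∃ c : Cone (nodeInclusion (Set.Iio t) ⋙ D),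
      Nonempty (IsLimit c) := fun t ht => by
    have := isConnected_Iio ht
    have := h.lexCategory _ (hsub (Set.Iio t))
    exact ⟨limit.cone _, ⟨limit.isLimit _⟩⟩
  choose L hL using hL
  let cmp : ∀ (t : K.T) (ht : Order.IsSuccLimit t), D.mapCone (nodeCone t) ⟶ L t ht :=
    fun t ht => (hL t ht).some.liftConeMorphism _
  have hcmp : ∀ (t : K.T) (ht : Order.IsSuccLimit t), IsIso ((atStage x).map (cmp t ht).hom) := by
    intro t ht
    have := isConnected_Iio ht
    obtain ⟨l₁⟩ := K.continuous t ht
    have l₂ : IsLimit ((D ⋙ atStage x).mapCone (nodeCone t)) := IsLimit.mapConeEquiv e.symm l₁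
    obtain ⟨l₃⟩ := h.isLimit_atStage_mapCone (hsub _) (hL t ht).some
    have := IsLimit.hom_isIso l₂ l₃ ((Cone.functoriality _ (atStage x)).map (cmp t ht))
    exact inferInstanceAs (IsIso ((Cone.forget _).map
      ((Cone.functoriality _ (atStage x)).map (cmp t ht))))
  let f : ∀ (t : K.T) (s : K.Next t), D.obj (op s.1) ⟶ D.obj (op t) := fun t s =>
    D.map (homOfLE s.2.le).op
  have hf : ∀ t : K.T, ¬ IsMax t → ExtremalEpiFamily
      (fun s : K.Next t => (atStage x).obj (D.obj (op s.1))) (fun s => (atStage x).map (f t s)) :=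
    fun t ht => (hK t ht).2.of_iso (e.symm.app (op t)) (fun s => e.symm.app (op s.1))
      fun s => e.inv.naturality _
  obtain ⟨y, p, hp⟩ := h.exists_common_stage (x := x) (ι := K.T ⊕ K.T)
    ((hasCardinalLT_sum_iff _ _ _ h.aleph0_le).2 ⟨hT, hT⟩)
    (fun i y p => match i with
      | .inl t => ¬ IsMax t → ExtremalEpiFamily
          (fun s : K.Next t => ((Over.pullback (Stage.Hom.map p)).obj (D.obj (op s.1))).left)
          (fun s => ((Over.pullback (Stage.Hom.map p)).map (f t s)).left)
      | .inr t => ∀ ht : Order.IsSuccLimit t,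
          IsIso ((Over.pullback (Stage.Hom.map p)).map (cmp t ht).hom))
    (by
      rintro (t | t) y z q p hp
      · exact fun ht => extremal_pullback_comp hS q p (hK t ht).1 (hp ht)
      · exact fun ht => isIso_pullback_of_isIso q p (hp ht))
    (by
      rintro (t | t)
      · by_cases ht : IsMax t
        · exact ⟨x, 𝟙 _, fun ht' => (ht' ht).elim⟩
        · obtain ⟨y, p, hp⟩ := h.exists_extremal_stage hS (hK t ht).1 (hf t ht)
          exact ⟨y, p, fun _ => hp⟩
      · by_cases ht : Order.IsSuccLimit t
        · obtain ⟨y, p, hp⟩ := h.exists_isIso_stage _ (hcmp t ht)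
          exact ⟨y, p, fun _ => hp⟩
        · exact ⟨x, 𝟙 _, fun ht' => (ht ht').elim⟩)
  let P := Over.pullback (Stage.Hom.map p)
  let K' : Cotree κ C :=
    { T := K.T
      isTree := K.isTree
      limit_unique := K.limit_unique
      branch_lt := K.branch_lt
      obj := (D ⋙ P) ⋙ Over.forget y.obj
      continuous := fun t ht => by
        have := isConnected_Iio ht
        have : IsIso (P.map (cmp t ht).hom) := hp (.inr t) ht
        let c' := (Cone.functoriality _ P).map (cmp t ht)
        have : IsIso c'.hom := this
        have : IsIso c' := Cone.cone_iso_of_hom_iso c'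
        have l := (isLimitOfPreserves P (hL t ht).some).ofIsoLimit (asIso c').symm
        exact ⟨isLimitOfPreserves (Over.forget y.obj) l⟩ }
  let B : ∀ b : Flag K.T, ((b : Set K.T) : Type w)ᵒᵖ ⥤ Over y.obj := fun b =>
    nodeInclusion (b : Set K.T) ⋙ D ⋙ P
  have hB : ∀ b : Flag K.T, ∃ c : Cone (B b), Nonempty (IsLimit c) := fun b => by
    have := isConnected_flag b
    have := h.lexCategory _ (hsub b)
    exact ⟨limit.cone _, ⟨limit.isLimit _⟩⟩
  choose c' hc' using hB
  have hcoc := hC.cotree K' (fun t ht => ⟨(hK t ht).1, hp (.inl t) ht⟩)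
    (fun b => (Over.forget y.obj).mapCone (c' b)) fun b => by
      have := isConnected_flag b
      exact ⟨isLimitOfPreserves (Over.forget y.obj) (hc' b).some⟩
  have hCF := h.extremal_atStage hS (x := y) (hκ.hasCardinalLT_flag hT)
    (k := fun b : Flag K.T => (c' b).pt) (l := (D ⋙ P).obj (op ⊥))
    (f := fun b : Flag K.T => (c' b).π.app (op ⟨⊥, b.bot_mem⟩)) hcoc
  let E : (D ⋙ P) ⋙ atStage y ≅ K.obj := Functor.isoWhiskerLeft D (stageIso p) ≪≫ e
  refine (hCF.comp_isIso (E.hom.app (op ⊥))).of_factors fun b => ?_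
  let s : Cone (K.branchDiagram b) :=
    (Cone.postcompose (Functor.whiskerLeft (nodeInclusion (b : Set K.T)) E.hom)).obj
      ((atStage y).mapCone (c' b))
  exact ⟨b, (hc b).some.lift s, (hc b).some.fac s _⟩

theorem IsLexPair.isCoherentCategory_CF (hκ : IsWeaklyCompact κ) (hC : IsCoherentCategory κ κ C)
    (h : IsLexPair κ F) : IsCoherentCategory κ κ (CF F) := by
  have := h.hasFiniteLimits
  exact (h.hasStableImages_CF (hC.hasStableImages h.aleph0_le)).isCoherentCategory h.aleph0_le
    h.lexCategory_CF (h.extremal_cocomposition hκ hC)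

/-! ### Pruning cotrees -/

namespace Cotree

variable {κ : Cardinal.{w}} {D : Type u} [Category.{v} D] (K : Cotree κ D)
  (N : ∀ t : K.T, Set (K.Next t))

/-- The nodes of the subtree in which the node `t` has only the successors in `N t`. -/
def Pruned : Type w := {t : K.T // ∀ (a : K.T) (b : K.Next a), b.1 ≤ t → b ∈ N a}

namespace Pruned

variable {K N}

instance : PartialOrder (Pruned K N) := inferInstanceAs (PartialOrder (Subtype _))

instance : OrderBot (Pruned K N) where
  bot := ⟨⊥, fun _ b hb => absurd (bot_le.trans_lt b.2.lt) (not_lt_of_ge hb)⟩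
  bot_le t := bot_le (a := t.1)

/-- A predecessor of a node of the subtree, as a node of the subtree. -/
def below (t : Pruned K N) (s : K.T) (h : s ≤ t.1) : Pruned K N :=
  ⟨s, fun a b hb => t.2 a b (hb.trans h)⟩

/-- A successor in `N t`, as a node of the subtree. -/
def above (t : Pruned K N) (n : K.Next t.1) (hn : n ∈ N t.1) : Pruned K N :=
  ⟨n.1, fun a b hb => by
    rcases hb.eq_or_lt with h | h
    · obtain rfl : a = t.1 := by
        obtain ⟨b, hab⟩ := b
        obtain rfl : b = n.1 := h
        rcases K.isTree.le_total hab.le n.2.le with h' | h'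
        · exact h'.eq_of_not_lt fun hlt => hab.2 hlt n.2.lt
        · exact (h'.eq_of_not_lt fun hlt => n.2.2 hlt hab.lt).symm
      obtain rfl : b = n := Subtype.ext h
      exact hn
    · refine t.2 a b ?_
      rcases K.isTree.le_total h.le n.2.le with h' | h'
      · exact h'
      · rcases h'.eq_or_lt with h' | h'
        · exact h'.symm.le
        · exact absurd h (n.2.2 h')⟩

theorem covBy_val {s t : Pruned K N} (h : s ⋖ t) : s.1 ⋖ t.1 :=
  ⟨h.lt, fun c hsc hct => h.2 (c := t.below c hct.le) hsc hct⟩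

theorem covBy_of_val {s t : Pruned K N} (h : s.1 ⋖ t.1) : s ⋖ t :=
  ⟨h.lt, fun c hsc hct => h.2 (c := c.1) hsc hct⟩

theorem isSuccLimit_val {t : Pruned K N} (h : Order.IsSuccLimit t) : Order.IsSuccLimit t.1 := by
  refine ⟨fun hmin => h.1 fun s hs => hmin hs, fun a ha => ?_⟩
  exact h.2 (t.below a ha.le) (covBy_of_val ha)

variable (K N) in
theorem isTree : IsTreeOrder (Pruned K N) := by
  intro t
  have := K.isTree t.1
  let e : ((· < ·) : Set.Iio t → Set.Iio t → Prop) ↪r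
      ((· < ·) : Set.Iio t.1 → Set.Iio t.1 → Prop) :=
    { toFun := fun s => ⟨s.1.1, s.2⟩
      inj' := fun a b h => Subtype.ext (Subtype.ext (Subtype.mk.inj h))
      map_rel_iff' := Iff.rfl }
  exact e.isWellOrder

/-- The predecessors of a node in the subtree and in the whole tree agree. -/
def iioIso (t : Pruned K N) : Set.Iio t ≃o Set.Iio t.1 where
  toFun s := ⟨s.1.1, s.2⟩
  invFun s := ⟨t.below s.1 (le_of_lt s.2), s.2⟩
  left_inv _ := rfl
  right_inv _ := rfl
  map_rel_iff' := Iff.rfl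

theorem exists_flag (b : Flag (Pruned K N)) : ∃ b' : Flag K.T, ∀ t ∈ b, t.1 ∈ b' := by
  have : IsChain (· ≤ ·) (Subtype.val '' (b : Set (Pruned K N))) := by
    rintro _ ⟨s, hs, rfl⟩ _ ⟨t, ht, rfl⟩ -
    exact b.le_or_le hs ht
  obtain ⟨b', hb'⟩ := this.exists_subset_flag
  exact ⟨b', fun t ht => hb' ⟨t, ht, rfl⟩⟩

/-- If no node loses all of its successors, then the branches of the subtree are branches of the
whole tree. -/
theorem exists_mem_flag (hN : ∀ t : K.T, ¬ IsMax t → (N t).Nonempty)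
    {b : Flag (Pruned K N)} {b' : Flag K.T} (hb : ∀ t ∈ b, t.1 ∈ b') {s : K.T} (hs : s ∈ b') :
    ∃ t ∈ b, t.1 = s := by
  have hmem : ∀ t : Pruned K N, t.1 ∈ b' → t ∈ b := fun t ht =>
    Flag.mem_iff_forall_le_or_ge.2 fun {r} hr => b'.le_or_le ht (hb r hr)
  have := K.isTree.wellFoundedLT
  by_contra! hne
  have habove : ∀ r ∈ b', (∀ t ∈ b, t.1 ≠ r) → ∀ t ∈ b, t.1 < r := by
    intro r hr hrne t ht
    refine lt_of_le_of_ne ?_ (hrne t ht)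
    rcases b'.le_or_le (hb t ht) hr with h | h
    · exact h
    · exact absurd rfl (hrne (t.below r h) (hmem _ hr))
  obtain ⟨m, ⟨hm, hmne⟩, hmin⟩ :=
    WellFounded.has_min (IsWellFounded.wf (r := ((· < ·) : K.T → K.T → Prop)))
      {r | r ∈ b' ∧ ∀ t ∈ b, t.1 ≠ r} ⟨s, hs, hne⟩
  have hlt : ∀ r, r < m → ∃ t ∈ b, t.1 = r := by
    intro r hr
    have hrb : r ∈ b' := Flag.mem_iff_forall_le_or_ge.2 fun {q} hq => by
      rcases b'.le_or_le hm hq with h | h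
      · exact .inl (hr.le.trans h)
      · exact K.isTree.le_total hr.le h
    by_contra! hrne
    exact hmin r ⟨hrb, hrne⟩ hr
  refine hmne ⟨m, fun a n hn => ?_⟩ (hmem _ hm) rfl
  rcases hn.eq_or_lt with h | h
  · obtain ⟨t, ht, rfl⟩ := hlt a (n.2.lt.trans_le hn)
    obtain ⟨q, hq⟩ := hN t.1 fun hmax => hmax.not_lt n.2.lt
    have hlast : ∀ r ∈ b, r ≤ t := fun r hr => by
      rcases b.le_or_le hr ht with h' | h'
      · exact h'
      · exact (h'.eq_of_not_lt fun hlt => n.2.2 hlt (h ▸ habove m hm hmne r hr)).ge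
    have : t.above q hq ∈ b := Flag.mem_iff_forall_le_or_ge.2 fun {r} hr =>
      .inr ((hlast r hr).trans q.2.le)
    exact absurd (hlast _ this) (not_le_of_gt q.2.lt)
  · obtain ⟨t, ht, htn⟩ := hlt _ h
    exact t.2 a n htn.ge

end Pruned

/-- The cotree on a subtree. -/
def prune : Cotree κ D where
  T := Pruned K N
  isTree := Pruned.isTree K N
  limit_unique s t hs hst := by
    refine Subtype.ext (K.limit_unique _ _ (Pruned.isSuccLimit_val hs) ?_)
    ext r
    constructor
    · intro hr
      exact (hst.subset (show s.below r (le_of_lt hr) ∈ Set.Iio s from hr) :)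
    · intro hr
      exact (hst.superset (show t.below r (le_of_lt hr) ∈ Set.Iio t from hr) :)
  branch_lt b := by
    obtain ⟨b', hb'⟩ := Pruned.exists_flag b
    exact (K.branch_lt b').of_injective (fun t => ⟨t.1.1, hb' _ t.2⟩)
      fun s t h => Subtype.ext (Subtype.ext (Subtype.mk.inj h))
  obj := (Subtype.mono_coe _).functor.op ⋙ K.obj
  continuous t ht := by
    obtain ⟨l⟩ := K.continuous t.1 (Pruned.isSuccLimit_val ht)
    exact ⟨l.whiskerEquivalence (Pruned.iioIso t).equivalence.op⟩

variable {K N} in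
/-- The cocompositions of the branches of a subtree are cocompositions of branches of the whole
tree. -/
theorem exists_limit_prune (hN : ∀ t : K.T, ¬ IsMax t → (N t).Nonempty)
    (c : ∀ b : Flag K.T, Cone (K.branchDiagram b)) (hc : ∀ b, Nonempty (IsLimit (c b)))
    (b : Flag (K.prune N).T) : ∃ (b' : Flag K.T) (c' : Cone ((K.prune N).branchDiagram b)),
      Nonempty (IsLimit c') ∧ ∃ e : c'.pt ⟶ (c b').pt,
        (K.prune N).cocomposition b c' = e ≫ K.cocomposition b' (c b') := by
  let b₀ : Flag (Pruned K N) := b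
  obtain ⟨b', hb'⟩ := Pruned.exists_flag b₀
  let e : (b₀ : Set (Pruned K N)) ≃o (b' : Set K.T) :=
    { Equiv.ofBijective (fun t : (b₀ : Set (Pruned K N)) => (⟨t.1.1, hb' _ t.2⟩ : (b' : Set K.T)))
        ⟨fun s t h => Subtype.ext (Subtype.ext (Subtype.mk.inj h)), fun s => by
          obtain ⟨t, ht, hts⟩ := Pruned.exists_mem_flag hN hb' s.2
          exact ⟨⟨t, ht⟩, Subtype.ext hts⟩⟩ with
      map_rel_iff' := Iff.rfl }
  exact ⟨b', (c b').whisker e.equivalence.op.functor,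
    ⟨(hc b').some.whiskerEquivalence e.equivalence.op⟩, 𝟙 _, (Category.id_comp _).symm⟩

end Cotree

/-! ### The topology of small extremal epimorphic families -/

section Topology

variable {κ : Cardinal.{w}} {D : Type u} [Category.{v} D]

/-- The topology in which a sieve covers if it contains a `κ`-small extremal epimorphic family. -/
def extremalTopology (hκ : κ.IsRegular) (h : HasStableImages κ D) : GrothendieckTopology D where
  sieves X := {S | ∃ (ι : Type w) (_ : HasCardinalLT ι κ) (Y : ι → D) (f : ∀ i, Y i ⟶ X),
    ExtremalEpiFamily Y f ∧ ∀ i, S (f i)}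
  top_mem' X := ⟨PUnit, hasCardinalLT_punit hκ.aleph0_le, fun _ => X, fun _ => 𝟙 X,
    .of_effectiveEpi _ inferInstance, fun _ => trivial⟩
  pullback_stable' X Y S g := by
    rintro ⟨ι, hι, Z, f, hf, hS⟩
    have := h.hasFiniteLimits
    refine ⟨ι, hι, _, _, h.stable_pullback hι hf g, fun i => ?_⟩
    rw [Sieve.pullback_apply, ← pullback.condition]
    exact S.downward_closed (hS i) _
  transitive' X S := by
    rintro ⟨ι, hι, Z, f, hf, hS⟩ R hR
    have := h.hasFiniteLimits
    have := Fact.mk hκ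
    choose α hα W g hg hgR using fun i => hR (hS i)
    exact ⟨Σ i, α i, hasCardinalLT_sigma _ _ hι hα, _, _, hf.comp hg, fun p => hgR p.1 p.2⟩

theorem mem_extremalTopology_iff {hκ : κ.IsRegular} {h : HasStableImages κ D} {X : D}
    {S : Sieve X} : S ∈ extremalTopology hκ h X ↔
      ∃ R ∈ effectiveEpiFamilies κ D X, R ≤ S.arrows := by
  constructor
  · rintro ⟨ι, hι, Y, f, hf, hS⟩
    exact ⟨_, ⟨ι, Y, f, hι, h.effectiveEpiFamily hι hf, rfl⟩, (Presieve.ofArrows_le_iff).2 hS⟩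
  · rintro ⟨_, ⟨ι, Y, f, hι, hf, rfl⟩, hS⟩
    exact ⟨ι, hι, Y, f, .of_effectiveEpiFamily hf, (Presieve.ofArrows_le_iff).1 hS⟩

/-- A family generates a covering sieve only if it is extremal epimorphic; for the converse
the family has to be `κ`-small. -/
theorem ofArrows_mem_extremalTopology_iff {hκ : κ.IsRegular} {h : HasStableImages κ D} {X : D}
    {ι : Type w} (hι : HasCardinalLT ι κ) {Y : ι → D} {f : ∀ i, Y i ⟶ X} :
    Sieve.ofArrows Y f ∈ extremalTopology hκ h X ↔ ExtremalEpiFamily Y f := by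
  constructor
  · rintro ⟨ι', -, Y', f', hf, hS⟩
    refine hf.of_factors fun i => ?_
    obtain ⟨j, g, hg⟩ := Sieve.mem_ofArrows_iff _ _ _ |>.1 (hS i)
    exact ⟨j, g, hg.symm⟩
  · intro hf
    exact ⟨ι, hι, Y, f, hf, fun i => Sieve.ofArrows_mk _ _ i⟩

/-- Covers of arbitrary size contain `κ`-small ones, so that a cotree of covers contains one to
which the coherence of `D` applies. -/
theorem isKappaTopology_extremalTopology (hκ : IsWeaklyCompact κ) (hD : IsCoherentCategory κ κ D)
    (h : HasStableImages κ D) : IsKappaTopology κ (extremalTopology hκ.regular h) := by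
  classical
  intro K hK c hc
  have key : ∀ t : K.T, ∃ N : Set (K.Next t), HasCardinalLT N κ ∧ (¬ IsMax t → N.Nonempty ∧
      ExtremalEpiFamily (fun s : N => K.at' s.1.1) (fun s => K.step t s.1)) := by
    intro t
    by_cases ht : IsMax t
    · exact ⟨∅, hasCardinalLT_of_finite _ _ hκ.regular.aleph0_le, fun h => (h ht).elim⟩
    obtain ⟨ι, hι, Y, f, hf, hS⟩ := hK t ht
    choose s g hg using fun i => Sieve.mem_ofArrows_iff _ _ _ |>.1 (hS i)
    -- The empty family may cover a node, but the subtree has to be cut at maximal nodes only.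
    obtain ⟨r, hr⟩ := not_isMax_iff.1 ht
    obtain ⟨n, hn, -⟩ := K.isTree.exists_covBy_le hr
    refine ⟨Set.range fun o : Option ι => o.elim ⟨n, hn⟩ s, ?_, fun _ => ⟨⟨_, none, rfl⟩, ?_⟩⟩
    · refine HasCardinalLT.of_surjective ?_ _ Set.rangeFactorization_surjective
      rw [hasCardinalLT_option_iff _ _ hκ.regular.aleph0_le]
      exact hι
    · exact hf.of_factors fun i => ⟨⟨s i, some i, rfl⟩, g i, (hg i).symm⟩
  choose N hNκ hN using key
  have hne : ∀ t : K.T, ¬ IsMax t → (N t).Nonempty := fun t ht => (hN t ht).1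
  choose b' c' hc' e he using K.exists_limit_prune hne c hc
  have hsteps : ∀ t : (K.prune N).T, ¬ IsMax t → HasCardinalLT ((K.prune N).Next t) κ ∧
      ExtremalEpiFamily (fun s : (K.prune N).Next t => (K.prune N).at' s.1)
        ((K.prune N).step t) := by
    intro t ht
    have ht' : ¬ IsMax t.1 := fun hmax => ht fun s hs => hmax hs
    refine ⟨(hNκ t.1).of_injective (fun s => ⟨⟨s.1.1, Cotree.Pruned.covBy_val s.2⟩,
      s.1.2 _ ⟨s.1.1, Cotree.Pruned.covBy_val s.2⟩ le_rfl⟩) fun s s' hss =>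
        Subtype.ext (Subtype.ext (congrArg (fun x => x.1.1) hss)), ?_⟩
    exact (hN t.1 ht').2.of_factors fun n =>
      ⟨⟨Cotree.Pruned.above t n.1 n.2, Cotree.Pruned.covBy_of_val n.1.2⟩, 𝟙 _,
        Category.id_comp _⟩
  refine ⟨Flag (K.prune N).T, hκ.hasCardinalLT_flag
    ((K.prune N).hasCardinalLT_nodes hκ fun t ht => (hsteps t ht).1), _, _,
    hD.cotree _ hsteps c' hc', fun b => ?_⟩
  rw [he b]
  exact Sieve.downward_closed _ (Sieve.ofArrows_mk _ _ (b' b)) _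

end Topology

/-! ### The topology generated by the covers of `C` -/

namespace IsLexPair

variable {C : Type u} [Category.{v} C] {κ : Cardinal.{w}} {F : C ⥤ Type w} (h : IsLexPair κ F)
include h

theorem element_eq_of_isTerminal {one : C} (hone : IsTerminal one) (a b : F.obj one) : a = b := by
  have := h.preservesFiniteLimits
  exact element_ext_of_isLimit F hone fun j => j.as.elim

/-- The map from an object of a slice to the corresponding object of the slice over `1`. -/
noncomputable abbrev toPhi {one : C} (hone : IsTerminal one) (pt : F.obj one)
    (x : Stage F) (k : Over x.obj) :
    (sliceElt x).obj k ⟶ (sliceElt ⟨one, pt⟩).obj ((toOverTerminal hone).obj k.left) :=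
  Elt.homMk (hone.from _) (𝟙 _) (h.element_eq_of_isTerminal hone _ _) (hone.hom_ext _ _)

/-- The maps of a slice are, in `C_F`, pullbacks of maps of `C`. -/
theorem isPullback_phi {one : C} (hone : IsTerminal one) (pt : F.obj one)
    {x : Stage F} {k l : Over x.obj} (f : k ⟶ l) :
    IsPullback ((toCF F).map (h.toPhi hone pt x k)) ((atStage x).map f)
      ((phi F hone pt).map f.left) ((toCF F).map (h.toPhi hone pt x l)) := by
  have hi : ∀ k : Over x.obj, IsIso (Elt.Hom.top (h.toPhi hone pt x k)) := fun k =>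
    inferInstanceAs (IsIso (𝟙 k.left))
  have := hi k
  have := hi l
  exact h.isPullback_toCF (snd := (sliceElt x).map f)
    (f := (sliceElt ⟨one, pt⟩).map ((toOverTerminal hone).map f.left))
    (IsPullback.of_vert_isIso ⟨(Category.comp_id _).trans (Category.id_comp _).symm⟩)
    (IsPullback.of_horiz_isIso ⟨(Category.id_comp _).trans (Category.comp_id _).symm⟩)

end IsLexPair

variable {C : Type w} [SmallCategory C] {κ : Cardinal.{w}} {F : C ⥤ Type w}

/-- The sieves containing a `κ`-small extremal epimorphic family form the topology generated by the
images of the covers of `C`: they form a `κ`-topology, and by `isPullback_phi` such a family of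
`C_F` is, up to isomorphism, a pullback of the image of a cover of `C`. -/
theorem IsLexPair.generatedTopology_eq (hκ : IsWeaklyCompact κ) (hC : IsCoherentCategory κ κ C)
    (h : IsLexPair κ F) {one : C} (hone : IsTerminal one) (pt : F.obj one)
    (hCF : HasStableImages κ (CF F)) :
    generatedTopology κ (imageFamilies (phi F hone pt) (effectiveEpiFamilies κ C)) =
      extremalTopology hκ.regular hCF := by
  have hS := hC.hasStableImages h.aleph0_le
  have := h.hasFiniteLimits
  apply le_antisymm
  · refine sInf_le ⟨isKappaTopology_extremalTopology hκ (h.isCoherentCategory_CF hκ hC) hCF, ?_⟩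
    rintro _ _ ⟨ι, Y, f, hι, hf, rfl⟩
    rw [Presieve.map_ofArrows]
    exact (ofArrows_mem_extremalTopology_iff hι).2
      (h.extremal_phi hS hone pt _ ι hι Y f (.of_effectiveEpiFamily hf))
  · refine le_sInf ?_
    rintro J ⟨-, hJ⟩ X S ⟨ι, hι, Y, φ, hφ, hSφ⟩
    obtain ⟨x, l, k, f, e, d, hw⟩ := h.exists_lift_sink hι φ
    obtain ⟨y, p, hp⟩ := h.exists_extremal_stage hS hι (hφ.of_iso e.symm (fun i => (d i).symm)
      fun i => show φ i ≫ e.inv = (d i).inv ≫ (atStage x).map (f i) by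
        rw [Iso.comp_inv_eq, Category.assoc, hw, Iso.inv_hom_id_assoc])
    let P := Over.pullback (Stage.Hom.map p)
    have hcov : Sieve.ofArrows _ (fun i => (phi F hone pt).map (P.map (f i)).left) ∈ J _ := by
      have := hJ _ _ (ImageCovering.mk (G := phi F hone pt) (E := effectiveEpiFamilies κ C)
        ⟨ι, _, _, hι, hS.effectiveEpiFamily hι hp, rfl⟩)
      rwa [Presieve.map_ofArrows] at this
    have hE : IsIso ((stageIso p).hom.app l ≫ e.hom) := inferInstance
    rw [← J.pullback_mem_iff_of_isIso (i := (stageIso p).hom.app l ≫ e.hom)]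
    refine J.superset_covering ?_
      (J.pullback_stable ((toCF F).map (h.toPhi hone pt y (P.obj l))) hcov)
    intro Z g hg
    obtain ⟨i, t, ht⟩ := (Sieve.mem_ofArrows_iff _ _ _).1 hg
    let s := (h.isPullback_phi hone pt (P.map (f i))).lift t g ht.symm
    have hs : s ≫ (atStage y).map (P.map (f i)) = g := IsPullback.lift_snd _ _ _ _
    have : g ≫ (stageIso p).hom.app l ≫ e.hom =
        (s ≫ (stageIso p).hom.app (k i) ≫ (d i).hom) ≫ φ i := by
      rw [← hs, Category.assoc, atStage_map_pullback]
      simp only [Category.assoc]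
      rw [Iso.inv_hom_id_app_assoc, hw]
    change S (g ≫ _)
    rw [this]
    exact S.downward_closed (hSφ i) _

/-! ### Small unions of subobjects -/

section SubobjectLattice

variable {κ : Cardinal.{w}} {D : Type u} [Category.{v} D]

theorem extremal_of_isLUB {X : D} {ι : Type*} {b : ι → Subobject X} {u : Subobject X}
    (hu : IsLUB (Set.range b) u) (hle : ∀ i, b i ≤ u) :
    ExtremalEpiFamily (fun i => (b i : D)) (fun i => (b i).ofLE u (hle i)) := by
  intro Z m hm hZ
  have hub : u ≤ Subobject.mk (m ≫ u.arrow) := hu.2 <| by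
    rintro _ ⟨i, rfl⟩
    obtain ⟨g, hg⟩ := hZ i
    exact Subobject.le_mk_of_comm g (by rw [reassoc_of% hg, Subobject.ofLE_arrow])
  refine isIso_of_mono_of_section m hm (u.ofLEMk _ hub) ?_
  rw [← cancel_mono u.arrow, Category.assoc, Subobject.ofLEMk_comp, Category.id_comp]

theorem isLUB_of_extremal [HasPullbacks D] {X : D} {ι : Type*} {b : ι → Subobject X}
    {u : Subobject X} (hle : ∀ i, b i ≤ u)
    (hb : ExtremalEpiFamily (fun i => (b i : D)) (fun i => (b i).ofLE u (hle i))) :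
    IsLUB (Set.range b) u := by
  refine ⟨by rintro _ ⟨i, rfl⟩; exact hle i, fun c hc => ?_⟩
  obtain ⟨k, hk⟩ := hb.exists_lift c.arrow u.arrow fun i =>
    ⟨(b i).ofLE c (hc ⟨i, rfl⟩), by rw [Subobject.ofLE_arrow, Subobject.ofLE_arrow]⟩
  exact Subobject.le_of_comm k hk

namespace HasStableImages

variable (h : HasStableImages κ D)
include h

theorem exists_isLUB {X : D} {ι : Type w} (hι : HasCardinalLT ι κ) (b : ι → Subobject X) :
    ∃ u, IsLUB (Set.range b) u := by
  have := h.hasFiniteLimits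
  obtain ⟨I, m, g, hm, hg, hge⟩ := h.image X ι hι _ fun i => (b i).arrow
  refine ⟨Subobject.mk m, ?_, fun c hc => ?_⟩
  · rintro _ ⟨i, rfl⟩
    exact Subobject.le_mk_of_comm (g i) (hg i)
  · obtain ⟨k, hk⟩ := hge.exists_lift c.arrow m fun i =>
      ⟨(b i).ofLE c (hc ⟨i, rfl⟩), by rw [Subobject.ofLE_arrow, hg]⟩
    exact Subobject.mk_le_of_comm k hk

/-- Binary intersections of subobjects distribute over `κ`-small unions. -/
theorem isLUB_inf [HasPullbacks D] {X : D} {ι : Type w} (hι : HasCardinalLT ι κ)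
    {b : ι → Subobject X} {u : Subobject X} (hu : IsLUB (Set.range b) u) (c : Subobject X) :
    IsLUB (Set.range fun i => b i ⊓ c) (u ⊓ c) := by
  have hle : ∀ i, b i ≤ u := fun i => hu.1 ⟨i, rfl⟩
  have hle' : ∀ i, b i ⊓ c ≤ u ⊓ c := fun i => inf_le_inf_right c (hle i)
  refine isLUB_of_extremal hle' ((h.stable_pullback hι (extremal_of_isLUB hu hle)
    ((u ⊓ c).ofLE u inf_le_left)).of_factors fun i => ?_)
  let p := pullback.fst ((b i).ofLE u (hle i)) ((u ⊓ c).ofLE u inf_le_left)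
  let q := pullback.snd ((b i).ofLE u (hle i)) ((u ⊓ c).ofLE u inf_le_left)
  have hpq : p ≫ (b i).arrow = q ≫ (u ⊓ c).arrow := by
    have := congrArg (· ≫ u.arrow)
      (pullback.condition (f := (b i).ofLE u (hle i)) (g := (u ⊓ c).ofLE u inf_le_left))
    simpa using this
  have hf : (b i ⊓ c).Factors (q ≫ (u ⊓ c).arrow) := by
    rw [Subobject.inf_factors]
    refine ⟨hpq ▸ Subobject.factors_comp_arrow p, ?_⟩
    rw [← Subobject.ofLE_arrow (inf_le_right : u ⊓ c ≤ c), ← Category.assoc]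
    exact Subobject.factors_comp_arrow _
  refine ⟨i, (b i ⊓ c).factorThru _ hf, ?_⟩
  rw [← cancel_mono (u ⊓ c).arrow, Category.assoc, Subobject.ofLE_arrow,
    Subobject.factorThru_arrow]

end HasStableImages

theorem areComplements_iff_isCompl {P : Type u} [PartialOrder P] [BoundedOrder P] {b c : P} :
    AreComplements b c ↔ IsCompl b c := by
  constructor
  · rintro ⟨⟨z, hz, hbc⟩, ⟨y, hy, hbc'⟩⟩
    exact ⟨fun x hxb hxc => (hbc.2 (by rintro _ (rfl | rfl) <;> assumption)).trans (hz ⊥),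
      fun x hxb hxc => (hy ⊤).trans (hbc'.2 (by rintro _ (rfl | rfl) <;> assumption))⟩
  · intro hbc
    exact ⟨⟨⊥, fun _ => bot_le, fun _ _ => bot_le,
      fun x hx => hbc.1 (hx (by simp)) (hx (by simp))⟩,
      ⟨⊤, fun _ => le_top, fun _ _ => le_top, fun x hx => hbc.2 (hx (by simp)) (hx (by simp))⟩⟩

theorem AreComplements.symm {P : Type u} [PartialOrder P] {b c : P} (hbc : AreComplements b c) :
    AreComplements c b := by
  unfold AreComplements
  rw [Set.pair_comm]
  exact hbc

/-- The lattice of subobjects of an object of a category with stable images. -/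
noncomputable abbrev HasStableImages.subobjectLattice [HasPullbacks D]
    (h : HasStableImages κ D) (hκ : Cardinal.aleph0 ≤ κ) (X : D) : Lattice (Subobject X) :=
  have hs : ∀ a b : Subobject X, ∃ u, IsLUB (Set.range fun i : ULift.{w} Bool =>
      if i.down then a else b) u := fun _ _ => h.exists_isLUB (hasCardinalLT_of_finite _ _ hκ) _
  { (inferInstance : SemilatticeInf (Subobject X)) with
    sup := fun a b => (hs a b).choose
    le_sup_left := fun a b => (hs a b).choose_spec.1 ⟨⟨true⟩, rfl⟩
    le_sup_right := fun a b => (hs a b).choose_spec.1 ⟨⟨false⟩, rfl⟩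
    sup_le := fun a b c hac hbc => (hs a b).choose_spec.2 <| by
      rintro _ ⟨⟨_ | _⟩, rfl⟩
      exacts [hbc, hac] }

/-- The subobjects form a bounded distributive lattice, and in such a lattice the complemented
elements form a Boolean algebra. -/
theorem HasStableImages.isBooleanAlgebra_complSub (h : HasStableImages κ D)
    (hκ : Cardinal.aleph0 ≤ κ) (X : D) : IsBooleanAlgebra (ComplSub X) := by
  have := h.hasFiniteLimits
  let : Lattice (Subobject X) := h.subobjectLattice hκ X
  let : DistribLattice (Subobject X) := .ofInfSupLe fun a b c => by
    have hu : IsLUB (Set.range fun i : ULift.{w} Bool => if i.down then b else c) (b ⊔ c) :=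
      ⟨by rintro _ ⟨⟨_ | _⟩, rfl⟩; exacts [le_sup_right, le_sup_left],
        fun d hd => sup_le (hd ⟨⟨true⟩, rfl⟩) (hd ⟨⟨false⟩, rfl⟩)⟩
    rw [inf_comm]
    refine (h.isLUB_inf (hasCardinalLT_of_finite _ _ hκ) hu a).2 ?_
    rintro _ ⟨⟨_ | _⟩, rfl⟩
    · exact (inf_comm _ _).le.trans le_sup_right
    · exact (inf_comm _ _).le.trans le_sup_left
  obtain ⟨z, hz⟩ := h.exists_isLUB (X := X) (ι := PEmpty) (hasCardinalLT_of_finite _ _ hκ)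
    fun i => i.elim
  let : BoundedOrder (Subobject X) :=
    { bot := z
      bot_le := fun a => hz.2 (by rintro _ ⟨i, _⟩; exact i.elim)
      top := ⊤
      le_top := fun a => le_top }
  refine ⟨Complementeds (Subobject X), DistribLattice.booleanAlgebraOfComplemented _, ⟨?_⟩⟩
  exact
    { toFun := fun b => ⟨b.1, b.2.imp fun _ => areComplements_iff_isCompl.1⟩
      invFun := fun b => ⟨b.1, b.2.imp fun _ => areComplements_iff_isCompl.2⟩
      left_inv := fun _ => rfl
      right_inv := fun _ => rfl
      map_rel_iff' := Iff.rfl }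

end SubobjectLattice

/-! ### Subobjects of the terminal object -/

section Subterminal

variable {κ : Cardinal.{w}} {D : Type u} [Category.{v} D] {t : D} (ht : IsTerminal t)
include ht

theorem subterminal_hom_ext {b : Subobject t} {W : D} (f g : W ⟶ (b : D)) : f = g := by
  rw [← cancel_mono b.arrow]
  exact ht.hom_ext _ _

/-- The intersection `u` is tested on all objects `W`, not only on subobjects, by passing to the
image of `W` in the terminal object. -/
theorem HasStableImages.exists_hom_of_isGLB (h : HasStableImages κ D) (hκ : Cardinal.aleph0 ≤ κ)
    {ι : Type*} {b : ι → Subobject t} {u : Subobject t} (hu : IsGLB (Set.range b) u) {W : D}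
    (g : ∀ i, W ⟶ (b i : D)) : Nonempty (W ⟶ (u : D)) := by
  have := h.hasFiniteLimits
  obtain ⟨I, m, e, hm, -, he⟩ := h.image t PUnit (hasCardinalLT_punit hκ) (fun _ => W)
    fun _ => ht.from W
  have hI : Subobject.mk m ≤ u := hu.2 <| by
    rintro _ ⟨i, rfl⟩
    obtain ⟨k, hk⟩ := he.exists_lift (b i).arrow m fun _ => ⟨g i, ht.hom_ext _ _⟩
    exact Subobject.mk_le_of_comm k hk
  exact ⟨e ⟨⟩ ≫ (Subobject.underlyingIso m).inv ≫ Subobject.ofLE _ _ hI⟩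

/-- Intersections of subobjects of the terminal object are limits. -/
theorem HasStableImages.isLimit_of_isGLB (h : HasStableImages κ D) (hκ : Cardinal.aleph0 ≤ κ)
    {J : Type u'} [Category.{v'} J] {K : J ⥤ Subobject t}
    (c : Cone (K ⋙ Subobject.underlying)) {u : Subobject t} (hc : c.pt = (u : D))
    (hu : IsGLB (Set.range K.obj) u) : Nonempty (IsLimit c) := by
  obtain ⟨pt, π⟩ := c
  obtain rfl : pt = (u : D) := hc
  exact ⟨{ lift := fun s => (h.exists_hom_of_isGLB ht hκ hu s.π.app).some
           fac := fun _ _ => subterminal_hom_ext ht _ _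
           uniq := fun _ _ _ => subterminal_hom_ext ht _ _ }⟩

theorem exists_isGLB (hκ : Cardinal.aleph0 ≤ κ) (hlex : IsLexCategory κ D) {ι : Type w}
    (hι : HasCardinalLT ι κ) (b : ι → Subobject t) : ∃ u, IsGLB (Set.range b) u := by
  have := hlex (Discrete ι) (hasCardinalLT_arrow_of_thin hκ _
    ((hasCardinalLT_iff_of_equiv discreteEquiv κ).2 hι))
  let G : Discrete ι ⥤ D := Discrete.functor fun i => (b i : D)
  have hm : Mono (ht.from (limit G)) := ⟨fun f g _ => limit.hom_ext fun j =>
    subterminal_hom_ext ht _ _⟩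
  refine ⟨Subobject.mk (ht.from (limit G)), ?_, fun c hc => ?_⟩
  · rintro _ ⟨i, rfl⟩
    exact Subobject.mk_le_of_comm (limit.π G ⟨i⟩) (ht.hom_ext _ _)
  · exact Subobject.le_mk_of_comm (limit.lift G
      { pt := (c : D)
        π := Discrete.natTrans fun j => c.ofLE (b j.as) (hc ⟨j.as, rfl⟩) }) (ht.hom_ext _ _)

end Subterminal

/-! ### Small unions of complemented subobjects -/

/-- The tree with a spine `WithTop ι`, and a leaf attached to each node of the spine but the last
one. -/
inductive SpineTree (ι : Type w) : Type w
  | spine (i : WithTop ι) : SpineTree ι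
  | leaf (j : ι) : SpineTree ι

namespace SpineTree

variable {ι : Type w} [LinearOrder ι]

/-- The order of the tree: a leaf is above the part of the spine up to the node it is attached
to. -/
def Le : SpineTree ι → SpineTree ι → Prop
  | spine i, spine j => i ≤ j
  | spine i, leaf j => i ≤ j
  | leaf _, spine _ => False
  | leaf i, leaf j => i = j

instance : PartialOrder (SpineTree ι) where
  le := Le
  le_refl := by
    rintro (i | i)
    exacts [le_refl i, rfl]
  le_trans := by
    rintro (i | i) (j | j) (k | k) hij hjk
    · exact le_trans (α := WithTop ι) hij hjk
    · exact le_trans (α := WithTop ι) hij hjk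
    · exact hjk.elim
    · obtain rfl : j = k := hjk
      exact hij
    · exact hij.elim
    · exact hij.elim
    · exact hjk.elim
    · exact Eq.trans (α := ι) hij hjk
  le_antisymm := by
    rintro (i | i) (j | j) hij hji
    · exact congrArg spine (le_antisymm (α := WithTop ι) hij hji)
    · exact hji.elim
    · exact hij.elim
    · exact congrArg leaf hij

theorem spine_le_spine {i j : WithTop ι} : spine i ≤ spine j ↔ i ≤ j := Iff.rfl

theorem spine_le_leaf {i : WithTop ι} {j : ι} : spine i ≤ leaf j ↔ i ≤ j := Iff.rfl

theorem leaf_le_iff {j : ι} {t : SpineTree ι} : leaf j ≤ t ↔ leaf j = t := by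
  constructor
  · intro h
    cases t with
    | spine i => exact False.elim h
    | leaf i => exact congrArg leaf h
  · rintro rfl
    exact le_rfl

theorem isMax_leaf (j : ι) : IsMax (leaf j) := fun _ h => (leaf_le_iff.1 h).ge

theorem isMax_spine_top : IsMax (spine (⊤ : WithTop ι)) := by
  rintro (i | i) h
  · exact spine_le_spine.2 le_top
  · exact absurd (spine_le_leaf.1 h) (by simp)

theorem spine_lt_spine {i j : WithTop ι} : spine i < spine j ↔ i < j := by
  rw [lt_iff_le_not_ge, lt_iff_le_not_ge, spine_le_spine, spine_le_spine]

theorem exists_spine_of_lt {s t : SpineTree ι} (h : s < t) : ∃ i, s = spine i := by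
  cases s with
  | spine i => exact ⟨i, rfl⟩
  | leaf j => exact absurd h (isMax_leaf j).not_lt

theorem spine_lt_leaf {i : WithTop ι} {j : ι} : spine i < leaf j ↔ i ≤ j :=
  ⟨fun h => spine_le_leaf.1 h.le, fun h => lt_of_le_not_ge (spine_le_leaf.2 h) fun h => h.elim⟩

theorem spine_covBy_leaf (j : ι) : spine (j : WithTop ι) ⋖ leaf j := by
  refine ⟨spine_lt_leaf.2 le_rfl, fun c hc hcj => ?_⟩
  obtain ⟨i, rfl⟩ := exists_spine_of_lt hcj
  exact absurd (spine_lt_leaf.1 hcj) (not_le_of_gt (spine_lt_spine.1 hc))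

/-- The spine node a node is attached to. -/
def index : SpineTree ι → WithTop ι
  | spine i => i
  | leaf j => j

theorem exists_spine_of_isSuccLimit {s : SpineTree ι} (hs : Order.IsSuccLimit s) :
    ∃ i, s = spine i := by
  cases s with
  | spine i => exact ⟨i, rfl⟩
  | leaf j => exact absurd (spine_covBy_leaf j) (hs.2 _)

theorem exists_between {i k : WithTop ι} (hi : Order.IsSuccLimit (spine i)) (hk : k < i) :
    ∃ l, k < l ∧ l < i := by
  have := hi.2 (spine k)
  rw [not_covBy_iff (spine_lt_spine.2 hk)] at this
  obtain ⟨c, hc, hci⟩ := this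
  obtain ⟨l, rfl⟩ := exists_spine_of_lt hci
  exact ⟨l, spine_lt_spine.1 hc, spine_lt_spine.1 hci⟩

theorem limit_unique (s t : SpineTree ι) (hs : Order.IsSuccLimit s)
    (hst : Set.Iio s = Set.Iio t) : s = t := by
  obtain ⟨i, rfl⟩ := exists_spine_of_isSuccLimit hs
  cases t with
  | spine k =>
    refine congrArg spine (le_antisymm ?_ ?_)
    · by_contra! hki
      exact lt_irrefl (spine k) (hst.subset
        (show spine k ∈ Set.Iio (spine i) from spine_lt_spine.2 hki))
    · by_contra! hki
      exact lt_irrefl (spine i) (hst.superset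
        (show spine i ∈ Set.Iio (spine k) from spine_lt_spine.2 hki))
  | leaf j =>
    have hj : spine (j : WithTop ι) ∈ Set.Iio (spine i) :=
      hst.superset (spine_lt_leaf.2 le_rfl)
    obtain ⟨l, hl, hli⟩ := exists_between hs (spine_lt_spine.1 hj)
    exact absurd (spine_lt_leaf.1 (hst.subset (show spine l ∈ _ from spine_lt_spine.2 hli)))
      (not_le_of_gt hl)

theorem exists_leaf_or_top_mem (b : Flag (SpineTree ι)) :
    spine ⊤ ∈ b ∨ ∃ j, leaf j ∈ b := by
  by_contra! hb
  refine hb.1 (Flag.mem_iff_forall_le_or_ge.2 fun {s} hs => ?_)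
  cases s with
  | spine i => exact .inr (spine_le_spine.2 le_top)
  | leaf j => exact (hb.2 j hs).elim

omit [LinearOrder ι] in
theorem hasCardinalLT {κ : Cardinal.{w}} (hκ : Cardinal.aleph0 ≤ κ) (hι : HasCardinalLT ι κ) :
    HasCardinalLT (SpineTree ι) κ := by
  have : HasCardinalLT (WithTop ι ⊕ ι) κ :=
    (hasCardinalLT_sum_iff _ _ _ hκ).2 ⟨(hasCardinalLT_option_iff _ _ hκ).2 hι, hι⟩
  refine this.of_surjective (fun x => x.elim spine leaf) ?_
  rintro (i | j)
  exacts [⟨.inl i, rfl⟩, ⟨.inr j, rfl⟩]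

variable [WellFoundedLT ι]

theorem isTree : IsTreeOrder (SpineTree ι) := by
  intro t
  let e : ((· < ·) : Set.Iio t → Set.Iio t → Prop) ↪r
      ((· < ·) : WithTop ι → WithTop ι → Prop) :=
    { toFun := fun s => s.1.index
      inj' := by
        rintro ⟨a, ha⟩ ⟨b, hb⟩ hab
        obtain ⟨i, rfl⟩ := exists_spine_of_lt ha
        obtain ⟨k, rfl⟩ := exists_spine_of_lt hb
        exact Subtype.ext (congrArg spine hab)
      map_rel_iff' := by
        rintro ⟨a, ha⟩ ⟨b, hb⟩
        obtain ⟨i, rfl⟩ := exists_spine_of_lt ha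
        obtain ⟨k, rfl⟩ := exists_spine_of_lt hb
        exact spine_lt_spine.symm }
  exact e.isWellOrder

noncomputable instance : OrderBot (SpineTree ι) :=
  have hbot : ∃ m : WithTop ι, ∀ i, m ≤ i := by
    obtain ⟨m, -, hm⟩ := WellFounded.has_min
      (IsWellFounded.wf (r := ((· < ·) : WithTop ι → WithTop ι → Prop))) Set.univ ⟨⊤, trivial⟩
    exact ⟨m, fun i => not_lt.1 (hm i trivial)⟩
  { bot := spine hbot.choose
    bot_le := by
      rintro (i | j)
      · exact spine_le_spine.2 (hbot.choose_spec i)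
      · exact spine_le_leaf.2 (hbot.choose_spec j) }

theorem exists_bot_eq : ∃ m : WithTop ι, (⊥ : SpineTree ι) = spine m ∧ ∀ i, m ≤ i :=
  ⟨_, rfl, fun i => spine_le_spine.1 (bot_le (a := spine i))⟩

theorem exists_spine_covBy (i : ι) : ∃ k, spine (i : WithTop ι) ⋖ spine k := by
  obtain ⟨m, hm, hmin⟩ := WellFounded.has_min
    (IsWellFounded.wf (r := ((· < ·) : WithTop ι → WithTop ι → Prop))) {k | (i : WithTop ι) < k}
    ⟨⊤, WithTop.coe_lt_top i⟩
  refine ⟨m, spine_lt_spine.2 hm, fun c hc hcm => ?_⟩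
  obtain ⟨l, rfl⟩ := exists_spine_of_lt hcm
  exact hmin l (spine_lt_spine.1 hc) (spine_lt_spine.1 hcm)

end SpineTree

section

variable {κ : Cardinal.{w}} {D : Type u} [Category.{v} D] {t : D}

/-- If the `c i` are complements of the `b i`, then the `b i` and the intersection of the `c i`
jointly cover the terminal object. This is the coherence condition for the cotree which splits
off the `b i` one after the other. -/
theorem IsCoherentCategory.top_le_of_complements (hκ : IsWeaklyCompact κ)
    (hD : IsCoherentCategory κ κ D) (ht : IsTerminal t) {ι : Type w} (hι : HasCardinalLT ι κ)
    {b c : ι → Subobject t} (hbc : ∀ i, AreComplements (b i) (c i)) {v d : Subobject t}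
    (hv : IsGLB (Set.range c) v) (hbd : ∀ i, b i ≤ d) (hvd : v ≤ d) : ⊤ ≤ d := by
  have h := hD.hasStableImages hκ.regular.aleph0_le
  have := h.hasFiniteLimits
  obtain ⟨_, _⟩ := exists_wellFoundedLT ι
  have hS : ∀ k : WithTop ι, ∃ s, IsGLB (Set.range fun j : {j : ι // (j : WithTop ι) < k} =>
      c j.1) s := fun k => exists_isGLB ht hκ.regular.aleph0_le hD.lex
    (hι.of_injective _ Subtype.val_injective) _
  choose S hS using hS
  have hSc : ∀ (k : WithTop ι) (j : ι), (j : WithTop ι) < k → S k ≤ c j :=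
    fun k j hj => (hS k).1 ⟨⟨j, hj⟩, rfl⟩
  have hSanti : ∀ {k l : WithTop ι}, k ≤ l → S l ≤ S k := fun {k l} hkl => (hS k).2 <| by
    rintro _ ⟨⟨j, hj⟩, rfl⟩
    exact hSc l j (hj.trans_le hkl)
  let val : SpineTree ι → Subobject t := fun s => match s with
    | .spine k => S k
    | .leaf j => S j ⊓ b j
  have hval : ∀ {r s : SpineTree ι}, r ≤ s → val s ≤ val r := by
    rintro (k | k) (l | l) hrs
    · exact hSanti hrs
    · exact inf_le_left.trans (hSanti hrs)
    · exact hrs.elim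
    · obtain rfl : k = l := hrs
      exact le_rfl
  let V : (SpineTree ι)ᵒᵖ ⥤ Subobject t :=
    { obj := fun s => val s.unop
      map := fun f => homOfLE (hval (leOfHom f.unop)) }
  let K : Cotree κ D :=
    { T := SpineTree ι
      isTree := SpineTree.isTree
      limit_unique := SpineTree.limit_unique
      branch_lt := fun b => (SpineTree.hasCardinalLT hκ.regular.aleph0_le hι).of_injective _
        Subtype.val_injective
      obj := V ⋙ Subobject.underlying
      continuous := fun s hs => by
        refine h.isLimit_of_isGLB ht hκ.regular.aleph0_le
          (K := nodeInclusion (Set.Iio s) ⋙ V) _ (u := val s) rfl ⟨?_, fun d hd => ?_⟩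
        · rintro _ ⟨⟨r, hr⟩, rfl⟩
          exact hval (le_of_lt hr)
        · obtain ⟨i, rfl⟩ := SpineTree.exists_spine_of_isSuccLimit hs
          refine (hS i).2 ?_
          rintro _ ⟨⟨j, hj⟩, rfl⟩
          obtain ⟨l, hjl, hli⟩ := SpineTree.exists_between hs hj
          exact (hd ⟨op ⟨.spine l, SpineTree.spine_lt_spine.2 hli⟩, rfl⟩).trans (hSc l j hjl) }
  have hstep : ∀ s : K.T, ¬ IsMax s → HasCardinalLT (K.Next s) κ ∧
      ExtremalEpiFamily (fun r : K.Next s => K.at' r.1) (K.step s) := by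
    intro s hs
    refine ⟨(SpineTree.hasCardinalLT hκ.regular.aleph0_le hι).of_injective _
      Subtype.val_injective, ?_⟩
    rcases s with (_ | j) | j
    · exact (hs SpineTree.isMax_spine_top).elim
    swap
    · exact (hs (SpineTree.isMax_leaf j)).elim
    · change ι at j
      obtain ⟨⟨z, -, -⟩, ⟨y, hy, hy'⟩⟩ := hbc j
      have hlub : IsLUB (Set.range fun i : ULift.{w} Bool => if i.down then b j else c j) ⊤ := by
        refine ⟨fun _ _ => le_top, fun e he => (hy ⊤).trans (hy'.2 ?_)⟩
        rintro _ (rfl | rfl)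
        exacts [he ⟨⟨true⟩, rfl⟩, he ⟨⟨false⟩, rfl⟩]
      have hlub' := h.isLUB_inf (hasCardinalLT_of_finite _ _ hκ.regular.aleph0_le) hlub (S j)
      rw [top_inf_eq] at hlub'
      obtain ⟨k, hk⟩ := SpineTree.exists_spine_covBy j
      refine (extremal_of_isLUB hlub' fun _ => inf_le_right).of_factors ?_
      rintro ⟨_ | _⟩
      · have hle : c j ⊓ S j ≤ S k := (hS k).2 <| by
          rintro _ ⟨⟨l, hl⟩, rfl⟩
          rcases lt_or_ge (l : WithTop ι) j with hlj | hlj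
          · exact inf_le_right.trans (hSc _ _ hlj)
          · obtain rfl : l = j := by
              refine le_antisymm ?_ (WithTop.coe_le_coe.1 hlj)
              by_contra! hjl
              exact hk.2 (c := .spine l) (SpineTree.spine_lt_spine.2 (WithTop.coe_lt_coe.2 hjl))
                (SpineTree.spine_lt_spine.2 hl)
            exact inf_le_left
        exact ⟨⟨.spine k, hk⟩, Subobject.ofLE _ _ hle, subterminal_hom_ext ht _ _⟩
      · exact ⟨⟨.leaf j, SpineTree.spine_covBy_leaf j⟩, Subobject.ofLE _ _ (inf_comm _ _).le,
          subterminal_hom_ext ht _ _⟩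
  have hlim : ∀ b : Flag K.T, ∃ c : Cone (K.branchDiagram b), Nonempty (IsLimit c) := fun b => by
    have := hD.lex ((b : Set K.T) : Type w)ᵒᵖ (hasCardinalLT_arrow_of_thin hκ.regular.aleph0_le _
      ((hasCardinalLT_iff_of_equiv equivToOpposite.symm κ).2
        ((SpineTree.hasCardinalLT hκ.regular.aleph0_le hι).of_injective _
          Subtype.val_injective)))
    exact ⟨limit.cone _, ⟨limit.isLimit _⟩⟩
  choose L hL using hlim
  have hfam := hD.cotree K hstep L hL
  obtain ⟨k, -⟩ := hfam.exists_lift d.arrow (val ⊥).arrow fun f => by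
    rcases SpineTree.exists_leaf_or_top_mem f with hf | ⟨j, hf⟩
    · have hle : S ⊤ ≤ d := le_trans (hv.2 <| by
        rintro _ ⟨j, rfl⟩
        exact hSc ⊤ j (WithTop.coe_lt_top j)) hvd
      exact ⟨(L f).π.app (op ⟨_, hf⟩) ≫ Subobject.ofLE (S ⊤) d hle, ht.hom_ext _ _⟩
    · exact ⟨(L f).π.app (op ⟨_, hf⟩) ≫ Subobject.ofLE (S j ⊓ b j) d
        (inf_le_right.trans (hbd j)), ht.hom_ext _ _⟩
  have hle : val ⊥ ≤ d := Subobject.le_of_comm k (ht.hom_ext _ _)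
  refine le_trans ?_ hle
  obtain ⟨m, hm, hmin⟩ := SpineTree.exists_bot_eq (ι := ι)
  rw [hm]
  refine (hS m).2 ?_
  rintro _ ⟨⟨j, hj⟩, rfl⟩
  exact absurd hj (not_lt_of_ge (hmin j))

/-- The union of a `κ`-small family of complemented subobjects is complemented by the intersection
of the complements. -/
theorem IsCoherentCategory.areComplements (hκ : IsWeaklyCompact κ)
    (hD : IsCoherentCategory κ κ D) (ht : IsTerminal t) {ι : Type w} (hι : HasCardinalLT ι κ)
    {b c : ι → Subobject t} (hbc : ∀ i, AreComplements (b i) (c i)) {u v : Subobject t}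
    (hu : IsLUB (Set.range b) u) (hv : IsGLB (Set.range c) v) : AreComplements u v := by
  have h := hD.hasStableImages hκ.regular.aleph0_le
  have := h.hasFiniteLimits
  refine ⟨?_, ⊤, fun _ => le_top, fun _ _ => le_top, fun d hd => ?_⟩
  · obtain ⟨z, hz⟩ := h.exists_isLUB (X := t) (ι := PEmpty)
      (hasCardinalLT_of_finite _ _ hκ.regular.aleph0_le) fun i => i.elim
    have hz' : IsBot z := fun a => hz.2 (by rintro _ ⟨i, _⟩; exact i.elim)
    refine ⟨z, hz', fun _ _ => hz' _, fun e he => ?_⟩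
    have heu : e ≤ u := he (by simp)
    have hev : e ≤ v := he (by simp)
    have := h.isLUB_inf hι hu e
    rw [inf_eq_right.2 heu] at this
    refine this.2 ?_
    rintro _ ⟨i, rfl⟩
    obtain ⟨⟨y, hy, hy'⟩, -⟩ := hbc i
    refine (hy'.2 ?_).trans (hy z)
    rintro _ (rfl | rfl)
    exacts [inf_le_left, inf_le_right.trans (hev.trans (hv.1 ⟨i, rfl⟩))]
  · exact hD.top_le_of_complements hκ ht hι hbc hv
      (fun i => (hu.1 ⟨i, rfl⟩).trans (hd (by simp))) (hd (by simp))

end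

/-! ### Coherence of the poset of complemented subobjects -/

section

variable {κ : Cardinal.{w}} {D : Type u} [Category.{v} D] {P : Type u'} [Category.{v'} P]

/-- Extremal epimorphic families are reflected. -/
theorem ExtremalEpiFamily.of_map {G : P ⥤ D} [G.ReflectsIsomorphisms] [G.PreservesMonomorphisms]
    {X : P} {ι : Type*} {Y : ι → P} {f : ∀ i, Y i ⟶ X}
    (h : ExtremalEpiFamily (fun i => G.obj (Y i)) (fun i => G.map (f i))) :
    ExtremalEpiFamily Y f := by
  intro Z m hm hZ
  have := h (G.map m) inferInstance fun i => by
    obtain ⟨g, hg⟩ := hZ i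
    exact ⟨G.map g, by rw [← Functor.map_comp, hg]⟩
  exact isIso_of_reflects_iso m G

/-- Coherence is reflected by functors which preserve `κ`-small limits and `κ`-small extremal
epimorphic families and reflect isomorphisms. -/
theorem IsCoherentCategory.of_functor (hκ : IsWeaklyCompact κ) (hD : IsCoherentCategory κ κ D)
    {G : P ⥤ D} [G.ReflectsIsomorphisms] (hP : IsLexCategory κ P) (hG : IsLexFunctor κ G)
    (himage : ∀ (X : P) (ι : Type w), HasCardinalLT ι κ → ∀ (Y : ι → P) (f : ∀ i, Y i ⟶ X),
      ∃ (I : P) (m : I ⟶ X) (g : ∀ i, Y i ⟶ I), Mono m ∧ (∀ i, g i ≫ m = f i) ∧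
        ExtremalEpiFamily Y g)
    (hext : ∀ (X : P) (ι : Type w), HasCardinalLT ι κ → ∀ (Y : ι → P) (f : ∀ i, Y i ⟶ X),
      ExtremalEpiFamily Y f → ExtremalEpiFamily (fun i => G.obj (Y i)) (fun i => G.map (f i))) :
    HasStableImages κ P ∧ IsCoherentCategory κ κ P := by
  have hκ' := hκ.regular.aleph0_le
  have h := hD.hasStableImages hκ'
  have := hP.hasFiniteLimits hκ'
  have := hG.preservesFiniteLimits hκ'
  have hS : HasStableImages κ P :=
    { hasFiniteLimits := inferInstance
      image := himage
      stable := fun X ι hι Y f hf X' g Y' f' p hp => .of_map (G := G)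
        (h.stable _ ι hι _ _ (hext X ι hι Y f hf) _ (G.map g) _ _ _ fun i => (hp i).map G) }
  refine ⟨hS, hS.isCoherentCategory hκ' hP fun K hK c hc => ?_⟩
  have hT : HasCardinalLT K.T κ := K.hasCardinalLT_nodes hκ fun t ht => (hK t ht).1
  have hpres : ∀ A : Set K.T, PreservesLimitsOfShape ((A : Type w)ᵒᵖ) G := fun A =>
    hG _ (hasCardinalLT_arrow_of_thin hκ' _ ((hasCardinalLT_iff_of_equiv equivToOpposite.symm κ).2
      (hT.of_injective _ Subtype.val_injective)))
  let K' : Cotree κ D :=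
    { T := K.T
      isTree := K.isTree
      limit_unique := K.limit_unique
      branch_lt := K.branch_lt
      obj := K.obj ⋙ G
      continuous := fun t ht => by
        have := hpres (Set.Iio t)
        exact ⟨isLimitOfPreserves G (K.continuous t ht).some⟩ }
  refine .of_map (G := G) (hD.cotree K' (fun t ht => ⟨(hK t ht).1, hext _ _ (hK t ht).1 _ _
    (hK t ht).2⟩) (fun b => G.mapCone (c b)) fun b => ?_)
  have := hpres (b : Set K.T)
  exact ⟨isLimitOfPreserves G (hc b).some⟩

end

section

variable {κ : Cardinal.{w}} {D : Type u} [Category.{v} D] {t : D}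
  (hκ : IsWeaklyCompact κ) (hD : IsCoherentCategory κ κ D) (ht : IsTerminal t)
include hκ hD ht

theorem exists_isLUB_complSub {ι : Type w} (hι : HasCardinalLT ι κ) (b : ι → ComplSub t) :
    ∃ u : ComplSub t, IsLUB (Set.range fun i => (b i).1) u.1 := by
  have h := hD.hasStableImages hκ.regular.aleph0_le
  choose c hc using fun i => (b i).2
  obtain ⟨u, hu⟩ := h.exists_isLUB hι fun i => (b i).1
  obtain ⟨v, hv⟩ := exists_isGLB ht hκ.regular.aleph0_le hD.lex hι c
  exact ⟨⟨u, v, hD.areComplements hκ ht hι hc hu hv⟩, hu⟩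

theorem exists_isGLB_complSub {ι : Type w} (hι : HasCardinalLT ι κ) (b : ι → ComplSub t) :
    ∃ u : ComplSub t, IsGLB (Set.range fun i => (b i).1) u.1 := by
  have h := hD.hasStableImages hκ.regular.aleph0_le
  choose c hc using fun i => (b i).2
  obtain ⟨u, hu⟩ := h.exists_isLUB hι c
  obtain ⟨v, hv⟩ := exists_isGLB ht hκ.regular.aleph0_le hD.lex hι fun i => (b i).1
  exact ⟨⟨v, u, (hD.areComplements hκ ht hι (fun i => (hc i).symm) hu hv).symm⟩, hv⟩

theorem isLexCategory_complSub : IsLexCategory κ (ComplSub t) := by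
  intro J _ hJ
  refine ⟨fun K => ?_⟩
  obtain ⟨u, hu⟩ := exists_isGLB_complSub hκ hD ht (hasCardinalLT_of_arrow hJ) K.obj
  exact ⟨⟨{
    cone := { pt := u
              π := { app := fun j => homOfLE (hu.1 ⟨j, rfl⟩)
                     naturality := fun _ _ _ => Subsingleton.elim _ _ } }
    isLimit :=
      { lift := fun s => homOfLE (show s.pt.1 ≤ u.1 from hu.2 (by
          rintro _ ⟨j, rfl⟩
          exact leOfHom (s.π.app j)))
        fac := fun _ _ => Subsingleton.elim _ _
        uniq := fun _ _ _ => Subsingleton.elim _ _ } }⟩⟩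

theorem isLexFunctor_complSubInclusion : IsLexFunctor κ (complSubInclusion t) := by
  intro J _ hJ
  refine ⟨fun {K} => ⟨fun {c} hc => ?_⟩⟩
  have h := hD.hasStableImages hκ.regular.aleph0_le
  obtain ⟨u, hu⟩ := exists_isGLB_complSub hκ hD ht (hasCardinalLT_of_arrow hJ) K.obj
  have hle : u ≤ c.pt := leOfHom (hc.lift
    { pt := u
      π := { app := fun j => homOfLE (hu.1 ⟨j, rfl⟩)
             naturality := fun _ _ _ => Subsingleton.elim _ _ } })
  have hc' : IsGLB (Set.range fun j => (K.obj j).1) c.pt.1 :=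
    ⟨by rintro _ ⟨j, rfl⟩; exact leOfHom (c.π.app j), fun d hd => (hu.2 hd).trans hle⟩
  exact h.isLimit_of_isGLB ht hκ.regular.aleph0_le (u := c.pt.1)
    (K := K ⋙ (Subtype.mono_coe (fun b : Subobject t => ∃ c, AreComplements b c)).functor)
    ((complSubInclusion t).mapCone c) rfl hc'

omit hκ hD in
theorem reflectsIsomorphisms_complSubInclusion :
    (complSubInclusion t).ReflectsIsomorphisms where
  reflects {b c} f hf := by
    let g := inv ((complSubInclusion t).map f)
    have hcb : c.1 ≤ b.1 := Subobject.le_of_comm (show (c.1 : D) ⟶ (b.1 : D) from g)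
      (ht.hom_ext _ _)
    exact ⟨homOfLE (show c ≤ b from hcb), Subsingleton.elim _ _, Subsingleton.elim _ _⟩

omit ht hD hκ in
theorem mono_of_partialOrder {Q : Type u} [PartialOrder Q] {b c : Q} (f : b ⟶ c) : Mono f :=
  ⟨fun _ _ _ => Subsingleton.elim _ _⟩

omit ht hD hκ in
theorem le_of_extremal {Q : Type u} [PartialOrder Q] {ι : Type*} {b : ι → Q} {u c : Q}
    {f : ∀ i, b i ⟶ u} (hf : ExtremalEpiFamily b f) (hcu : c ≤ u) (hc : ∀ i, b i ≤ c) : u ≤ c := by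
  have := hf (homOfLE hcu) (mono_of_partialOrder _) fun i =>
    ⟨homOfLE (hc i), Subsingleton.elim _ _⟩
  exact leOfHom (inv (homOfLE hcu))

/-- An extremal epimorphic family of complemented subobjects exhibits a union among all subobjects,
as that union is itself complemented. -/
theorem isLUB_of_extremal_complSub {ι : Type w} (hι : HasCardinalLT ι κ) {b : ι → ComplSub t}
    {u : ComplSub t} {f : ∀ i, b i ⟶ u} (hf : ExtremalEpiFamily b f) :
    IsLUB (Set.range fun i => (b i).1) u.1 := by
  obtain ⟨d, hd⟩ := exists_isLUB_complSub hκ hD ht hι b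
  have hdu : d ≤ u := hd.2 (by rintro _ ⟨i, rfl⟩; exact leOfHom (f i))
  have hud : u ≤ d := le_of_extremal hf hdu fun i => hd.1 ⟨i, rfl⟩
  rwa [le_antisymm hud hdu]

theorem extremal_complSubInclusion (u : ComplSub t) (ι : Type w) (hι : HasCardinalLT ι κ)
    (b : ι → ComplSub t) (f : ∀ i, b i ⟶ u) (hf : ExtremalEpiFamily b f) :
    ExtremalEpiFamily (fun i => (complSubInclusion t).obj (b i))
      (fun i => (complSubInclusion t).map (f i)) :=
  extremal_of_isLUB (isLUB_of_extremal_complSub hκ hD ht hι hf) fun i => leOfHom (f i)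

theorem hasStableImages_and_isCoherentCategory_complSub : HasStableImages κ (ComplSub t) ∧
    IsCoherentCategory κ κ (ComplSub t) := by
  have := reflectsIsomorphisms_complSubInclusion ht
  refine hD.of_functor hκ (G := complSubInclusion t) (isLexCategory_complSub hκ hD ht)
    (isLexFunctor_complSubInclusion hκ hD ht) (fun u ι hι b f => ?_)
    (extremal_complSubInclusion hκ hD ht)
  obtain ⟨d, hd⟩ := exists_isLUB_complSub hκ hD ht hι b
  have hdu : d ≤ u := hd.2 (by rintro _ ⟨i, rfl⟩; exact leOfHom (f i))
  have hbd : ∀ i, b i ≤ d := fun i => hd.1 ⟨i, rfl⟩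
  refine ⟨d, homOfLE hdu, fun i => homOfLE (hbd i), mono_of_partialOrder _,
    fun i => Subsingleton.elim _ _, fun z m hm hz => ?_⟩
  have hdz : d ≤ z := hd.2 <| by
    rintro _ ⟨i, rfl⟩
    exact leOfHom (hz i).choose
  exact ⟨homOfLE hdz, Subsingleton.elim _ _, Subsingleton.elim _ _⟩

theorem isCoherentFunctor_complSubInclusion : IsCoherentFunctor κ κ (complSubInclusion t) :=
  .of_extremal hκ.regular.aleph0_le (hasStableImages_and_isCoherentCategory_complSub hκ hD ht).1
    (hD.hasStableImages hκ.regular.aleph0_le) (isLexFunctor_complSubInclusion hκ hD ht)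
    (extremal_complSubInclusion hκ hD ht)

end

/-! ### Sheaves -/

section

variable {κ : Cardinal.{w}} {D : Type u} [Category.{v} D]

/-- Representable functors are sheaves since extremal epimorphic families are effective and
stable. -/
theorem subcanonical_extremalTopology (hκ : κ.IsRegular) (h : HasStableImages κ D) :
    (extremalTopology hκ h).Subcanonical := by
  have := h.hasFiniteLimits
  refine GrothendieckTopology.Subcanonical.of_isSheaf_yoneda_obj _ fun W X S hS x hx => ?_
  obtain ⟨ι, hι, Y, f, hf, hfS⟩ := hS
  have heff := h.effectiveEpiFamily hι hf
  have hx' : ∀ {Z : D} {A B : D} (a : Z ⟶ A) (b : Z ⟶ B) (p : A ⟶ X) (q : B ⟶ X) (hp : S p)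
      (hq : S q), a ≫ p = b ≫ q → a ≫ x p hp = b ≫ x q hq := fun a b p q hp hq hpq =>
    hx a b hp hq hpq
  let d : X ⟶ W := EffectiveEpiFamily.desc Y f (fun i => x (f i) (hfS i))
    fun i j a b hab => hx' a b _ _ _ _ hab
  have hd : ∀ i, f i ≫ d = x (f i) (hfS i) := fun i => EffectiveEpiFamily.fac Y f _ _ i
  refine ⟨d, fun Z g hg => ?_, fun d' hd' => hf.hom_ext fun i => ?_⟩
  · refine (h.stable_pullback hι hf g).hom_ext fun i => ?_
    have h₁ : pullback.snd (f i) g ≫ x g hg = pullback.fst (f i) g ≫ x (f i) (hfS i) :=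
      hx' _ _ _ _ _ _ pullback.condition.symm
    rw [h₁, ← hd i]
    exact (pullback.condition_assoc (f := f i) (g := g) d).symm
  · exact (hd' (f i) (hfS i)).trans (hd i).symm

theorem unionTopology_le (hκ : κ.IsRegular) {P : Type u} [PartialOrder P]
    (h : HasStableImages κ P) : unionTopology κ P ≤ extremalTopology hκ h := by
  unfold unionTopology
  rw [Precoverage.toGrothendieck_eq_sInf]
  refine sInf_le ?_
  rintro b _ ⟨ι, x, hx, hι, hb, rfl⟩
  refine (ofArrows_mem_extremalTopology_iff hι).2 fun z m _ hz => ?_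
  have hbz : b ≤ z := hb.2 <| by
    rintro _ ⟨i, rfl⟩
    exact leOfHom (hz i).choose
  exact ⟨homOfLE hbz, Subsingleton.elim _ _, Subsingleton.elim _ _⟩

/-- Functors preserving finite limits and `κ`-small extremal epimorphic families are
continuous. -/
theorem isContinuous_of_extremal (hκ : κ.IsRegular) (h : HasStableImages κ D) {P : Type u'}
    [Category.{v'} P] (hP : HasStableImages κ P) (G : P ⥤ D) [PreservesFiniteLimits G]
    (hext : ∀ (X : P) (ι : Type w), HasCardinalLT ι κ → ∀ (Y : ι → P) (f : ∀ i, Y i ⟶ X),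
      ExtremalEpiFamily Y f → ExtremalEpiFamily (fun i => G.obj (Y i)) (fun i => G.map (f i)))
    {K : GrothendieckTopology P} (hK : K ≤ extremalTopology hκ hP) :
    G.IsContinuous K (extremalTopology hκ h) := by
  have := hP.hasFiniteLimits
  have := flat_of_preservesFiniteLimits G
  refine Functor.isContinuous_of_coverPreserving (compatiblePreservingOfFlat _ G) ⟨?_⟩
  intro X S hS
  obtain ⟨ι, hι, Y, f, hf, hfS⟩ := hK _ hS
  exact ⟨ι, hι, _, _, hext X ι hι Y f hf, fun i => Sieve.image_mem_functorPushforward G S (hfS i)⟩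

end

/-! ### Projectivity of complemented subobjects -/

section

variable {κ : Cardinal.{w}} {D : Type u} [Category.{v} D] {t : D}

theorem HasStableImages.isInitial_of_isBot (h : HasStableImages κ D) (hκ : Cardinal.aleph0 ≤ κ)
    {z : Subobject t} (hz : IsBot z) {W : D} (g : W ⟶ (z : D)) : Nonempty (IsInitial W) := by
  obtain ⟨I, m, e, hm, -, he⟩ := h.image t PEmpty (hasCardinalLT_of_finite _ _ hκ)
    (fun i => i.elim) fun i => i.elim
  obtain ⟨hI⟩ := h.isInitial_of_extremal (hasCardinalLT_of_finite _ _ hκ) he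
  exact h.isInitial_of_hom hκ hI (g ≫ Subobject.ofLEMk z m (hz _))

/-- An object with maps to two complementary subobjects of the terminal object is initial. -/
theorem HasStableImages.isInitial_of_areComplements (h : HasStableImages κ D)
    (hκ : Cardinal.aleph0 ≤ κ) (ht : IsTerminal t) {b c : Subobject t} (hbc : AreComplements b c)
    {W : D} (f : W ⟶ (b : D)) (g : W ⟶ (c : D)) : Nonempty (IsInitial W) := by
  obtain ⟨⟨z, hz, hz'⟩, -⟩ := hbc
  have hz'' : IsGLB (Set.range fun i : Bool => if i then b else c) z := by
    convert hz' using 1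
    ext d
    simp [eq_comm, or_comm]
  obtain ⟨k⟩ := h.exists_hom_of_isGLB ht hκ hz'' (W := W) fun i => match i with
    | true => f
    | false => g
  exact h.isInitial_of_isBot hκ hz k

/-- If the terminal object is projective, then so are its complemented subobjects: an effective
epimorphism onto `b` is extended to one onto the terminal object by adding the complement
of `b`. -/
theorem HasStableImages.exists_hom_of_effectiveEpi (h : HasStableImages κ D)
    (hκ : Cardinal.aleph0 ≤ κ) (ht : IsTerminal t) (hD : HasDisjointCoproducts κ D)
    (hproj : ∀ (Z : D) (e : Z ⟶ t), EffectiveEpi e → Nonempty (t ⟶ Z)) (b : ComplSub t) {Z : D}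
    (e : Z ⟶ (b.1 : D)) (he : EffectiveEpi e) : Nonempty ((b.1 : D) ⟶ Z) := by
  have := h.hasFiniteLimits
  obtain ⟨c, hbc⟩ := b.2
  let Y : ULift.{w} Bool → D := fun i => match i with
    | ⟨true⟩ => Z
    | ⟨false⟩ => (c : D)
  have hY : HasCardinalLT (ULift.{w} Bool) κ := hasCardinalLT_of_finite _ _ hκ
  obtain ⟨_, _⟩ := hD _ hY Y
  have hc : IsColimit (Cofan.mk _ (Sigma.ι Y)) := coproductIsCoproduct _
  have hcov : ExtremalEpiFamily (fun _ : PUnit.{w + 1} => ∐ Y) (fun _ => ht.from (∐ Y)) := by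
    intro W m hm hW
    obtain ⟨k, -⟩ := hW ⟨⟩
    obtain ⟨-, y, hy, hy'⟩ := hbc
    have hb : b.1 ≤ Subobject.mk m := by
      obtain ⟨k', hk'⟩ := (ExtremalEpiFamily.of_effectiveEpi.{0} e he).exists_lift m b.1.arrow
        fun _ => ⟨Sigma.ι Y ⟨true⟩ ≫ k, ht.hom_ext _ _⟩
      exact Subobject.le_mk_of_comm k' hk'
    have hc : c ≤ Subobject.mk m :=
      Subobject.le_mk_of_comm (Sigma.ι Y ⟨false⟩ ≫ k) (ht.hom_ext _ _)
    have htop : ⊤ ≤ Subobject.mk m := (hy ⊤).trans (hy'.2 (by rintro _ (rfl | rfl) <;> assumption))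
    rw [top_le_iff, ← Subobject.isIso_iff_mk_eq_top] at htop
    exact htop
  obtain ⟨s⟩ := hproj _ _ ((h.effectiveEpi_iff hκ _).2 hcov)
  obtain ⟨k, -⟩ := (h.stable_pullback hY (extremal_of_isColimit hc) (b.1.arrow ≫ s)).exists_lift
    (Sigma.ι Y ⟨true⟩) (b.1.arrow ≫ s) (by
      rintro ⟨_ | _⟩
      · obtain ⟨hI⟩ := h.isInitial_of_areComplements hκ ht hbc
          (pullback.snd (Sigma.ι Y ⟨false⟩) (b.1.arrow ≫ s))
          (pullback.fst (Sigma.ι Y ⟨false⟩) (b.1.arrow ≫ s))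
        exact ⟨hI.to _, hI.hom_ext _ _⟩
      · exact ⟨pullback.fst _ _, pullback.condition⟩)
  exact ⟨k⟩

end

namespace IsLexPair

variable {C : Type u} [Category.{v} C] {κ : Cardinal.{w}} {F : C ⥤ Type w} (h : IsLexPair κ F)
include h

/-- At every stage `(x, a)` the terminal object of `C/x` becomes the terminal object of `C_F`. -/
theorem isTerminal_atStage_id {one : C} (hone : IsTerminal one) (x : Stage F) :
    Nonempty (IsTerminal ((atStage x).obj (Over.mk (𝟙 x.obj)))) := by
  have := h.preservesFiniteLimits
  have hpt : ∃ pt : F.obj one, F.map (hone.from x.obj) x.pt = pt := ⟨_, rfl⟩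
  obtain ⟨pt, hpt⟩ := hpt
  have := (h.lexFunctor_phi hone pt).preservesFiniteLimits h.aleph0_le
  have h₁ : IsTerminal ((phi F hone pt).obj one) := hone.isTerminalObj _ _
  let s : (sliceElt x).obj (Over.mk (𝟙 x.obj)) ⟶
      (sliceElt ⟨one, pt⟩).obj ((toOverTerminal hone).obj one) :=
    Elt.homMk (hone.from _) (hone.from _) hpt (hone.hom_ext _ _)
  have hi : IsIso (hone.from one) := by
    rw [hone.hom_ext (hone.from one) (𝟙 _)]
    infer_instance
  have hs : Elt.cartesian F s :=
    IsPullback.of_vert_isIso (snd := 𝟙 x.obj) (f := hone.from one) ⟨hone.hom_ext _ _⟩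
  have := isIso_toCF_map hs
  exact ⟨h₁.ofIso (asIso ((toCF F).map s)).symm⟩

/-- If `F` is `κ`-regular, then the terminal object of `C_F` is projective: an effective
epimorphism onto it comes from an effective epimorphism `k ⟶ x` of `C` for an element `(x, a)`
of `F`, and it is split at a stage `(k, a')` where `a' ∈ F k` is taken to `a`. -/
theorem exists_section (hS : HasStableImages κ C) (hF : IsRegularFunctor κ F) {one : C}
    (hone : IsTerminal one) {t : CF F} (ht : IsTerminal t) (Z : CF F) (e : Z ⟶ t)
    (he : EffectiveEpi e) : Nonempty (t ⟶ Z) := by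
  have := h.hasFiniteLimits
  have hpu := hasCardinalLT_punit h.aleph0_le
  obtain ⟨x, k, hk⟩ := h.exists_lift_objects hpu fun _ => Z
  obtain ⟨d⟩ := hk ⟨⟩
  obtain ⟨hx⟩ := h.isTerminal_atStage_id hone x
  let f : PUnit.{w + 1} → (k ⟨⟩ ⟶ Over.mk (𝟙 x.obj)) := fun _ => Over.homMk (k ⟨⟩).hom
  obtain ⟨y, p, hp⟩ := h.exists_extremal_stage hS hpu (f := f)
    ((ExtremalEpiFamily.of_effectiveEpi e he).of_iso (ht.uniqueUpToIso hx) (fun _ => d.symm)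
      fun _ => hx.hom_ext _ _)
  let k' : Over y.obj := (Over.pullback (Stage.Hom.map p)).obj (k ⟨⟩)
  let l' : Over y.obj := (Over.pullback (Stage.Hom.map p)).obj (Over.mk (𝟙 x.obj))
  have hl' : IsIso l'.hom :=
    inferInstanceAs (IsIso (pullback.snd (𝟙 x.obj) (Stage.Hom.map p)))
  have hk' : EffectiveEpi k'.hom := (hS.effectiveEpi_iff h.aleph0_le _).2 <|
    (hp.comp_isIso l'.hom).of_factors fun _ => ⟨⟨⟩, 𝟙 _, (Category.id_comp _).trans
      (Over.w ((Over.pullback (Stage.Hom.map p)).map (f ⟨⟩))).symm⟩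
  have := hF.effectiveEpi _ hk'
  obtain ⟨a, ha⟩ := (epi_iff_surjective (F.map k'.hom)).1 inferInstance y.pt
  obtain ⟨hz⟩ := h.isTerminal_atStage_id hone (⟨k'.left, a⟩ : Stage F)
  let s : (sliceElt ⟨k'.left, a⟩).obj (Over.mk (𝟙 k'.left)) ⟶ (sliceElt y).obj k' :=
    Elt.homMk k'.hom (𝟙 _) ha rfl
  exact ⟨hz.from t ≫ (toCF F).map s ≫ (stageIso p).hom.app (k ⟨⟩) ≫ d.hom⟩

end IsLexPair

/-! ### Coherence of the restricted Yoneda functor -/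

section

variable {D : Type u} [Category.{v} D] {P : Type u'} [Category.{v'} P] (G : P ⥤ D)
  (K : GrothendieckTopology P) (J : GrothendieckTopology D) [J.Subcanonical] [G.IsContinuous K J]

/-- The functor taking `x` to the sheaf `b ↦ (G b ⟶ x)`. -/
noncomputable abbrev restrictedYoneda : D ⥤ Sheaf K (Type v) :=
  J.yoneda ⋙ G.sheafPushforwardContinuous (Type v) K J

/-- Limits of sheaves are computed pointwise, and `y ↦ (G b ⟶ y)` preserves limits. -/
theorem preservesLimitsOfShape_restrictedYoneda (I : Type w) [SmallCategory I]
    [HasLimitsOfShape I (Type v)] :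
    PreservesLimitsOfShape I (restrictedYoneda G K J) := by
  have : PreservesLimitsOfShape I (restrictedYoneda G K J ⋙ sheafToPresheaf K (Type v)) :=
    inferInstanceAs (PreservesLimitsOfShape I
      (CategoryTheory.yoneda ⋙ (Functor.whiskeringLeft _ _ (Type v)).obj G.op))
  exact preservesLimitsOfShape_of_reflects_of_preserves _ (sheafToPresheaf K (Type v))

variable {G K J}

/-- A map through which all maps from objects `G b` factor is sent to an effective epimorphism.
The descended map is defined on a section `G b ⟶ x` through any lift; independence of the lift is
tested on the sheaf represented by `G b`. -/
theorem effectiveEpi_restrictedYoneda {X Z : D} (e : Z ⟶ X)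
    (hs : ∀ (b : P) (f : G.obj b ⟶ X), ∃ g : G.obj b ⟶ Z, g ≫ e = f) :
    EffectiveEpi ((restrictedYoneda G K J).map e) := by
  have key : ∀ {W : Sheaf K (Type v)} (g : (restrictedYoneda G K J).obj Z ⟶ W),
      (∀ {V : Sheaf K (Type v)} (g₁ g₂ : V ⟶ (restrictedYoneda G K J).obj Z),
        g₁ ≫ (restrictedYoneda G K J).map e = g₂ ≫ (restrictedYoneda G K J).map e →
          g₁ ≫ g = g₂ ≫ g) → ∀ (b : P) (z z' : G.obj b ⟶ Z), z ≫ e = z' ≫ e →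
          g.hom.app (op b) z = g.hom.app (op b) z' := by
    intro W g hg b z z' hz
    have h₁ := hg ((restrictedYoneda G K J).map z) ((restrictedYoneda G K J).map z')
      (by rw [← Functor.map_comp, ← Functor.map_comp, hz])
    have h₂ : ∀ y : G.obj b ⟶ Z,
        ((restrictedYoneda G K J).map y ≫ g).hom.app (op b) (𝟙 (G.obj b)) =
          g.hom.app (op b) y := fun y =>
      congrArg (g.hom.app (op b)) (Category.id_comp y)
    rw [← h₂ z, ← h₂ z', h₁]
  choose s hs using hs
  have hnat : ∀ {W : Sheaf K (Type v)} (g : (restrictedYoneda G K J).obj Z ⟶ W) {b c : P}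
      (r : c ⟶ b) (z : G.obj b ⟶ Z),
      g.hom.app (op c) (G.map r ≫ z) = W.obj.map r.op (g.hom.app (op b) z) := fun g b c r z =>
    ConcreteCategory.congr_hom (g.hom.naturality r.op) z
  refine ⟨⟨{
    desc := fun {W} g hg => ObjectProperty.homMk
      { app := fun b => TypeCat.ofHom fun z => g.hom.app b (s b.unop z)
        naturality := fun b c r => by
          ext z
          refine (key g hg c.unop _ (G.map r.unop ≫ s b.unop z) ?_).trans (hnat g r.unop _)
          exact (hs c.unop (G.map r.unop ≫ z)).trans ((congrArg (G.map r.unop ≫ ·)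
            (hs b.unop z).symm).trans (Category.assoc _ _ _).symm) }
    fac := fun {W} g hg => ?_
    uniq := fun {W} g hg d hd => ?_ }⟩⟩
  · ext b z
    exact key g hg b.unop _ _ (hs _ _)
  · ext b z
    have : (((restrictedYoneda G K J).map e ≫ d).hom.app b) (s b.unop z) =
        g.hom.app b (s b.unop z) := by rw [hd]
    refine Eq.trans ?_ this
    exact congrArg (d.hom.app b) (hs b.unop z).symm

/-- A family `g i : Y i ⟶ U` through which, locally, all maps from objects `G b` factor is sent
to a family generating the sheaf of `U`. -/
theorem isUnion_restrictedYoneda {X U : D} {ι : Type w} {Y : ι → D} (g : ∀ i, Y i ⟶ U)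
    (m : U ⟶ X) [Mono m]
    (hloc : ∀ (b : P) (f : G.obj b ⟶ U), ∃ S ∈ K b, ∀ (c : P) (r : c ⟶ b), S r →
      ∃ (i : ι) (k : G.obj c ⟶ Y i), k ≫ g i = G.map r ≫ f) :
    IsUnion (fun i => (restrictedYoneda G K J).map (g i ≫ m))
      ((restrictedYoneda G K J).map m) := by
  have := preservesLimitsOfShape_restrictedYoneda G K J WalkingCospan
  refine ⟨inferInstance, fun i => ⟨(restrictedYoneda G K J).map (g i),
    ((restrictedYoneda G K J).map_comp _ _).symm⟩, fun N n hn hN => ?_⟩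
  choose t ht using hN
  have hinj : ∀ b : P, Function.Injective (n.hom.app (op b)) := fun b => by
    have h₁ : Mono ((sheafToPresheaf K (Type v)).map n) := inferInstance
    rw [NatTrans.mono_iff_mono_app] at h₁
    exact (mono_iff_injective _).1 (h₁ (op b))
  have hnat : ∀ {b c : P} (r : c ⟶ b) (a : N.obj.obj (op b)) (y : G.obj b ⟶ X),
      n.hom.app (op b) a = y → n.hom.app (op c) (N.obj.map r.op a) = (G.map r ≫ y :) := by
    rintro b c r a _ rfl
    exact ConcreteCategory.congr_hom (n.hom.naturality r.op) a
  have hNs := (isSheaf_iff_isSheaf_of_type K N.obj).1 N.property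
  have hXs := (isSheaf_iff_isSheaf_of_type K _).1 ((restrictedYoneda G K J).obj X).property
  have hex : ∀ (b : P) (f : G.obj b ⟶ U), ∃ a : N.obj.obj (op b),
      n.hom.app (op b) a = (f ≫ m :) := by
    intro b f
    obtain ⟨S, hS, hSf⟩ := hloc b f
    have hloc' : ∀ (c : P) (r : c ⟶ b), S r → ∃ a : N.obj.obj (op c),
        n.hom.app (op c) a = (G.map r ≫ f ≫ m :) := by
      intro c r hr
      obtain ⟨i, k, hk⟩ := hSf c r hr
      refine ⟨(t i).hom.app (op c) k, ?_⟩
      have h₁ : (t i ≫ n).hom.app (op c) k = (k ≫ g i ≫ m :) := by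
        rw [ht i]
        rfl
      refine Eq.trans h₁ ?_
      rw [reassoc_of% hk]
    choose a ha using hloc'
    have hcomp : Presieve.FamilyOfElements.Compatible (P := N.obj) (R := S.arrows)
        fun c r hr => a c r hr := by
      intro c₁ c₂ d p₁ p₂ r₁ r₂ h₁ h₂ hp
      refine hinj _ ?_
      rw [hnat p₁ _ _ (ha _ _ _), hnat p₂ _ _ (ha _ _ _), ← Category.assoc, ← Functor.map_comp, hp,
        Functor.map_comp, Category.assoc]
    obtain ⟨a', ha', -⟩ := hNs S hS _ hcomp
    refine ⟨a', (hXs S hS).isSeparatedFor.ext fun c r hr => ?_⟩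
    refine (hnat r a' _ rfl).symm.trans ?_
    rw [ha' r hr, ha]
    rfl
  choose a ha using hex
  refine ⟨ObjectProperty.homMk
    { app := fun b => TypeCat.ofHom fun f => a b.unop f
      naturality := fun b c r => ?_ }, ?_⟩
  · ext f
    refine hinj _ ?_
    exact (ha c.unop (G.map r.unop ≫ f)).trans ((Category.assoc _ _ _).trans
      (hnat r.unop _ _ (ha b.unop f)).symm)
  · ext b f
    exact ha _ _

end

section

variable {κ : Cardinal.{w}} {D : Type u} [Category.{v} D] {t : D}

/-- The members of a `κ`-small partition of a complemented subobject are complemented. -/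
theorem HasStableImages.exists_areComplements_of_partition [HasPullbacks D]
    (h : HasStableImages κ D) (hκ : Cardinal.aleph0 ≤ κ) {b c : Subobject t}
    (hbc : AreComplements b c)
    {ι : Type w} (hι : HasCardinalLT ι κ) {x : ι → Subobject t} (hx : IsLUB (Set.range x) b)
    (hd : ∀ i j, i ≠ j → IsBot (x i ⊓ x j)) (i : ι) : ∃ d, AreComplements (x i) d := by
  classical
  obtain ⟨⟨z, hz, hz'⟩, y, hy, hy'⟩ := hbc
  have hι' : HasCardinalLT (Option {j // j ≠ i}) κ :=
    (hasCardinalLT_option_iff _ _ hκ).2 (hι.of_injective _ Subtype.val_injective)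
  let x' : Option {j // j ≠ i} → Subobject t := fun o => o.elim c fun j => x j.1
  obtain ⟨d, hd'⟩ := h.exists_isLUB hι' x'
  refine ⟨d, ⟨z, hz, fun _ _ => hz _, fun e he => ?_⟩, y, hy, fun _ _ => hy _, fun e he => ?_⟩
  · have hei : e ≤ x i := he (by simp)
    have hed : e ≤ d := he (by simp)
    have := h.isLUB_inf hι' hd' e
    rw [inf_eq_right.2 hed] at this
    refine this.2 ?_
    rintro _ ⟨_ | ⟨j, hj⟩, rfl⟩
    · refine hz'.2 ?_
      rintro _ (rfl | rfl)
      exacts [inf_le_right.trans (hei.trans (hx.1 ⟨i, rfl⟩)), inf_le_left]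
    · exact (inf_le_inf_left _ hei).trans (hd j i hj z)
  · have hxe : ∀ o, x' o ≤ e := fun o => (hd'.1 ⟨o, rfl⟩).trans (he (by simp))
    refine hy'.2 ?_
    rintro _ (rfl | rfl)
    · refine hx.2 ?_
      rintro _ ⟨j, rfl⟩
      by_cases hj : j = i
      · exact hj ▸ he (by simp)
      · exact hxe (some ⟨j, hj⟩)
    · exact hxe none

/-- If the terminal object is projective, then maps from complemented subobjects lift along
effective epimorphisms. -/
theorem HasStableImages.exists_lift_of_effectiveEpi (h : HasStableImages κ D)
    (hκ : Cardinal.aleph0 ≤ κ) (ht : IsTerminal t) (hD : HasDisjointCoproducts κ D)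
    (hproj : ∀ (Z : D) (e : Z ⟶ t), EffectiveEpi e → Nonempty (t ⟶ Z)) (b : ComplSub t) {Z X : D}
    (e : Z ⟶ X) (he : EffectiveEpi e) (f : (b.1 : D) ⟶ X) : ∃ g, g ≫ e = f := by
  have := h.hasFiniteLimits
  obtain ⟨s⟩ := h.exists_hom_of_effectiveEpi hκ ht hD hproj b (pullback.snd e f)
    ((h.effectiveEpi_iff hκ _).2
      (h.stable_pullback (hasCardinalLT_punit hκ) ((h.effectiveEpi_iff hκ _).1 he) f))
  have hs : s ≫ pullback.snd e f = 𝟙 _ := subterminal_hom_ext ht _ _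
  exact ⟨s ≫ pullback.fst e f, by rw [Category.assoc, pullback.condition, reassoc_of% hs]⟩

/-- If the terminal object is projective, then a map from a complemented subobject to an object
with a `κ`-small cover by objects `Y i` lifts to the `Y i` on the members of a partition: it lifts
to the coproduct of the `Y i`, whose decomposition pulls back to the subobject. -/
theorem HasStableImages.exists_partition (h : HasStableImages κ D) [HasPullbacks D]
    (hκ : Cardinal.aleph0 ≤ κ) (ht : IsTerminal t) (hD : HasDisjointCoproducts κ D)
    (hproj : ∀ (Z : D) (e : Z ⟶ t), EffectiveEpi e → Nonempty (t ⟶ Z)) {U : D} {ι : Type w}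
    (hι : HasCardinalLT ι κ) {Y : ι → D} {g : ∀ i, Y i ⟶ U} (hg : ExtremalEpiFamily Y g)
    (b : ComplSub t) (f : (b.1 : D) ⟶ U) :
    ∃ (x : ι → Subobject t) (hx : ∀ i, x i ≤ b.1), IsLUB (Set.range x) b.1 ∧
      (∀ i j, i ≠ j → IsBot (x i ⊓ x j)) ∧
      ∀ i, ∃ q : (x i : D) ⟶ Y i, q ≫ g i = (x i).ofLE b.1 (hx i) ≫ f := by
  obtain ⟨_, hdisj⟩ := hD _ hι Y
  have hc : IsColimit (Cofan.mk _ (Sigma.ι Y)) := coproductIsCoproduct _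
  have he : ExtremalEpiFamily (fun _ : PUnit.{w + 1} => ∐ Y) (fun _ => Sigma.desc g) :=
    hg.of_factors fun i => ⟨⟨⟩, Sigma.ι Y i, Sigma.ι_desc _ _⟩
  let e : ∐ Y ⟶ U := Sigma.desc g
  obtain ⟨f', hf'⟩ := h.exists_lift_of_effectiveEpi hκ ht hD hproj b e
    ((h.effectiveEpi_iff hκ _).2 he) f
  let x : ι → Subobject t := fun i => Subobject.mk (pullback.snd (Sigma.ι Y i) f' ≫ b.1.arrow)
  have hxb : ∀ i, x i ≤ b.1 := fun i => Subobject.mk_le_of_comm (pullback.snd _ _) rfl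
  have hq : ∀ i, ∃ q : (x i : D) ⟶ Y i, q ≫ Sigma.ι Y i = (x i).ofLE b.1 (hxb i) ≫ f' := by
    intro i
    let k := (Subobject.underlyingIso (pullback.snd (Sigma.ι Y i) f' ≫ b.1.arrow)).hom
    have h₁ : k ≫ pullback.snd (Sigma.ι Y i) f' = (x i).ofLE b.1 (hxb i) :=
      subterminal_hom_ext ht _ _
    exact ⟨k ≫ pullback.fst _ _, by rw [← h₁, Category.assoc, Category.assoc, pullback.condition]⟩
  choose q hq using hq
  refine ⟨x, hxb, isLUB_of_extremal hxb <|
    (h.stable_pullback hι (extremal_of_isColimit hc) f').of_factors fun i =>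
      ⟨i, (Subobject.underlyingIso (pullback.snd (Sigma.ι Y i) f' ≫ b.1.arrow)).inv,
        subterminal_hom_ext ht _ _⟩, fun i j hij => ?_, fun i => ⟨q i, ?_⟩⟩
  · obtain ⟨hP⟩ := hdisj.nonempty_isInitial_of_ne hc hij _
      (IsPullback.of_hasPullback (Sigma.ι Y i) (Sigma.ι Y j)).isLimit
    have h₁ : (Subobject.ofLE (x i ⊓ x j) (x i) inf_le_left ≫ q i) ≫ Sigma.ι Y i =
        (Subobject.ofLE (x i ⊓ x j) (x j) inf_le_right ≫ q j) ≫ Sigma.ι Y j := by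
      rw [Category.assoc, Category.assoc, hq i, hq j, ← Category.assoc, ← Category.assoc]
      exact congrArg (· ≫ f') (subterminal_hom_ext ht _ _)
    obtain ⟨hI⟩ := h.isInitial_of_hom hκ hP (pullback.lift _ _ h₁)
    exact fun d => Subobject.le_of_comm (hI.to _) (ht.hom_ext _ _)
  · have h₁ : Sigma.ι Y i ≫ e = g i := Sigma.ι_desc _ _
    rw [← h₁, reassoc_of% (hq i), hf']

/-- The partition of `HasStableImages.exists_partition` is a cover of the complemented subobject
`b` on which the map `f` lifts. -/
theorem exists_cover_complSub (hκ : IsWeaklyCompact κ) (h : HasStableImages κ D)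
    (ht : IsTerminal t) (hD : HasDisjointCoproducts κ D)
    (hproj : ∀ (Z : D) (e : Z ⟶ t), EffectiveEpi e → Nonempty (t ⟶ Z)) {U : D} {ι : Type w}
    (hι : HasCardinalLT ι κ) {Y : ι → D} {g : ∀ i, Y i ⟶ U} (hg : ExtremalEpiFamily Y g)
    (b : ComplSub t) (f : (complSubInclusion t).obj b ⟶ U) :
    ∃ S ∈ unionTopology κ (ComplSub t) b, ∀ (c : ComplSub t) (r : c ⟶ b), S r →
      ∃ (i : ι) (k : (complSubInclusion t).obj c ⟶ Y i),
        k ≫ g i = (complSubInclusion t).map r ≫ f := by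
  have := h.hasFiniteLimits
  obtain ⟨x, hxb, hx, hdis, hq⟩ := h.exists_partition hκ.regular.aleph0_le ht hD hproj hι hg b f
  choose q hq using hq
  obtain ⟨c, hbc⟩ := b.2
  let X : ι → ComplSub t := fun i =>
    ⟨x i, h.exists_areComplements_of_partition hκ.regular.aleph0_le hbc hι hx hdis i⟩
  have hX : IsLUB (Set.range X) b := by
    refine ⟨by rintro _ ⟨i, rfl⟩; exact hxb i, fun d hd => hx.2 ?_⟩
    rintro _ ⟨i, rfl⟩
    exact hd ⟨i, rfl⟩
  refine ⟨_, Precoverage.generate_mem_toGrothendieck ⟨ι, X, hxb, hι, hX, rfl⟩, ?_⟩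
  rintro d r ⟨_, a, _, ⟨i⟩, rfl⟩
  refine ⟨i, (complSubInclusion t).map a ≫ (show (complSubInclusion t).obj (X i) ⟶ _ from q i),
    ?_⟩
  rw [Functor.map_comp, Category.assoc, Category.assoc]
  exact congrArg ((complSubInclusion t).map a ≫ ·) (hq i)

end

section

variable {κ : Cardinal.{w}} {D : Type w} [SmallCategory D] {t : D}

/-- If the terminal object is projective, then `x ↦ (b ↦ (b ⟶ x))`, where `b` ranges over the
complemented subobjects of the terminal object, is a coherent functor. -/
theorem isCoherentFunctor_restrictedYoneda (hκ : IsWeaklyCompact κ) (h : HasStableImages κ D)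
    (ht : IsTerminal t) (hD : HasDisjointCoproducts κ D)
    (hproj : ∀ (Z : D) (e : Z ⟶ t), EffectiveEpi e → Nonempty (t ⟶ Z))
    (J : GrothendieckTopology D) [J.Subcanonical]
    [(complSubInclusion t).IsContinuous (unionTopology κ (ComplSub t)) J] :
    IsCoherentFunctor κ κ
      (restrictedYoneda (complSubInclusion t) (unionTopology κ (ComplSub t)) J) where
  lex I _ _ := preservesLimitsOfShape_restrictedYoneda _ _ _ I
  effectiveEpi Z X e he := effectiveEpi_restrictedYoneda e
    (h.exists_lift_of_effectiveEpi hκ.regular.aleph0_le ht hD hproj · e he)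
  union X ι hι Y u hu U m hU := by
    obtain ⟨hm, g, hg, hge⟩ := h.isUnion_iff.1 hU
    obtain rfl : (fun i => g i ≫ m) = u := funext hg
    exact isUnion_restrictedYoneda g m (exists_cover_complSub hκ h ht hD hproj hι hge)

end

end KappaCoh

open KappaCoh
theorem mainTheorem7 (κ : Cardinal.{w}) (hκ : IsWeaklyCompact κ)
    (C : Type w) [SmallCategory C]
    (hC : IsCoherentCategory κ κ C) (hCoprod : HasDisjointCoproducts κ C)
    (F : C ⥤ Type w) (hF : IsLexFunctor κ F)
    (one : C) (hone : IsTerminal one) (pt : F.obj one) :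
    (IsCoherentCategory κ κ (CF F) ∧
      IsCoherentFunctor κ κ (phi F hone pt) ∧
      HasDisjointCoproducts κ (CF F) ∧
      (∀ (X : CF F) (S : Sieve X),
        S ∈ generatedTopology κ (imageFamilies (phi F hone pt) (effectiveEpiFamilies κ C)) X ↔
          ∃ R ∈ effectiveEpiFamilies κ (CF F) X, R ≤ S.arrows) ∧
      (∀ (X : CF F) (ι : Type w) (Y : ι → CF F) (f : ∀ i, Y i ⟶ X), HasCardinalLT ι κ →
        (Sieve.ofArrows Y f ∈
            generatedTopology κ (imageFamilies (phi F hone pt) (effectiveEpiFamilies κ C)) X ↔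
          EffectiveEpiFamily Y f)) ∧
      (∃ oneF : CF F, Nonempty (IsTerminal oneF)) ∧
      ∀ oneF : CF F, IsTerminal oneF →
        IsBooleanAlgebra (ComplSub oneF) ∧
        IsCoherentCategory κ κ (ComplSub oneF) ∧
        IsCoherentFunctor κ κ (complSubInclusion oneF)) ∧
    (IsRegularFunctor κ F → ∀ oneF : CF F, IsTerminal oneF →
      ∃ (_ : (generatedTopology κ
            (imageFamilies (phi F hone pt) (effectiveEpiFamilies κ C))).Subcanonical)
        (_ : (complSubInclusion oneF).IsContinuous (unionTopology κ (ComplSub oneF))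
          (generatedTopology κ
            (imageFamilies (phi F hone pt) (effectiveEpiFamilies κ C)))),
        IsCoherentFunctor κ κ
          ((generatedTopology κ
              (imageFamilies (phi F hone pt) (effectiveEpiFamilies κ C))).yoneda ⋙
            (complSubInclusion oneF).sheafPushforwardContinuous (Type w)
              (unionTopology κ (ComplSub oneF))
              (generatedTopology κ
                (imageFamilies (phi F hone pt) (effectiveEpiFamilies κ C))))) := by
  have h : IsLexPair κ F := ⟨hκ.regular, hC.lex, hF⟩
  have hS := hC.hasStableImages h.aleph0_le
  have := h.hasFiniteLimits
  have hCF := h.isCoherentCategory_CF hκ hC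
  have hSF := hCF.hasStableImages h.aleph0_le
  have hcop := h.hasDisjointCoproducts_CF hS hCoprod
  rw [h.generatedTopology_eq hκ hC hone pt hSF]
  refine ⟨⟨hCF, h.isCoherentFunctor_phi hS hone pt, hcop, fun X S => mem_extremalTopology_iff,
    fun X ι Y f hι => (ofArrows_mem_extremalTopology_iff hι).trans (hSF.extremal_iff hι), ?_,
    fun t ht => ⟨hSF.isBooleanAlgebra_complSub h.aleph0_le t,
      (hasStableImages_and_isCoherentCategory_complSub hκ hCF ht).2,
      isCoherentFunctor_complSubInclusion hκ hCF ht⟩⟩,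
    fun hreg t ht => ?_⟩
  · have := hSF.hasFiniteLimits
    exact ⟨⊤_ _, ⟨terminalIsTerminal⟩⟩
  · have hsub := subcanonical_extremalTopology hκ.regular hSF
    have := (isLexFunctor_complSubInclusion hκ hCF ht).preservesFiniteLimits h.aleph0_le
    have hP := (hasStableImages_and_isCoherentCategory_complSub hκ hCF ht).1
    have hcont := isContinuous_of_extremal hκ.regular hSF hP (complSubInclusion t)
      (extremal_complSubInclusion hκ hCF ht) (unionTopology_le hκ.regular hP)
    exact ⟨hsub, hcont, isCoherentFunctor_restrictedYoneda hκ hSF ht hcop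
      (h.exists_section hS hreg hone ht) _⟩
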